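/- Let $(D,\omega_D)$ be a compact Kähler manifold and let $\pi:E\to D$ be a holomorphic vector bundle of rank $m\ge 1$. Let $M=\mathbb{P}(E)$ be the bundle of complex lines in the fibres of $E$, with projection $p:M\to D$, and let $\mathcal{O}_{\mathbb{P}(E)}(-1)\subset p^*E$ be the tautological line bundle. Assume that $E$ admits a Hermitian metric $h$ such that the curvature form $\gamma$ of $(\mathcal{O}_{\mathbb{P}(E)}(-1),h)$, given by $\gamma=-\sqrt{-1}\,\partial\bar\partial\log h(s,s)$ for any local nowhere vanishing holomorphic section $s$, is negative semi-definite and has constant eigenvalues (with multiplicities) over $M$ with respect to the Kähler form $\omega_M=p^*\omega_D-\gamma$. Assume moreover that $$\operatorname{Ric}(\omega_M)=-m\gamma ,$$ where $\operatorname{Ric}(\omega)=-\sqrt{-1}\,\partial\bar\partial\log\det(g_{j\bar k})$ in local holomorphic coordinates with $\omega=\sqrt{-1}\sum g_{j\bar k}\,dz_j\wedge d\bar z_k$. Then the total space $E$ admits a 1-parameter family of complete steady Kähler–Ricci solitons in the class $[\pi^*\omega_D]$. Precisely, let $Z$ be the holomorphic vector field on $E$ which generates the $\mathbb{C}^*$-action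 by scalar multiplication on the fibres (that is, $Z=\sum_a z_a\,\partial/\partial z_a$ in linear fibre coordinates). There is a family $(\omega_\mu)_{\mu<0}$ of pairwise distinct Kähler forms on $E$, depending smoothly on $\mu\in(-\infty,0)$ and the point of $E$ jointly, such that for every $\mu<0$ the Riemannian metric of $\omega_\mu$ is complete, $$\operatorname{Ric}(\omega_\mu)=-\mathcal{L}_{X_\mu}\omega_\mu\quad\text{with } X_\mu=\mu\operatorname{Re}Z,$$ and $[\omega_\mu]=[\pi^*\omega_D]$ in $H^2(E;\mathbb{R})$. -/

import Mathlib

open Set Filter Topology Bundle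
open scoped Manifold ContDiff LinearAlgebra.Projectivization

noncomputable section

namespace KRS

/-! ## Differential forms and Kähler metrics on complex manifolds

Throughout, `N` is a complex manifold (without boundary) modelled on the complex vector space `V`.
Mathlib identifies the tangent space at `x` with `V` through the preferred chart at `x`; the complex
structure `J` of the tangent space is multiplication by `Complex.I`.
-/

/-- Real differential `k`-forms (not necessarily smooth) on a manifold `N` modelled on `V`. -/
abbrev Form (V : Type*) [NormedAddCommGroup V] [NormedSpace ℂ V] (N : Type*) (k : ℕ) : Type _ :=
  N → V [⋀^Fin k]→L[ℝ] ℝ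

section Local

variable {V : Type*} [NormedAddCommGroup V] [NormedSpace ℂ V]

/-- Multiplication by `i`, as a real linear map. -/
def mulI : V →L[ℝ] V := (Complex.I • ContinuousLinearMap.id ℂ V).restrictScalars ℝ

/-- The real 2-form `i∂∂̄u` of a function `u` on a complex vector space. Since `i∂∂̄ = d ((i/2)(∂̄ - ∂))`
and `(i/2)(∂̄u - ∂u)(v) = - du(iv)/2`, it is the exterior derivative of the 1-form
`v ↦ - du(iv)/2`. -/
def ddbarV (u : V → ℝ) : V → V [⋀^Fin 2]→L[ℝ] ℝ :=
  extDeriv fun z => ContinuousAlternatingMap.ofSubsingleton ℝ V ℝ (0 : Fin 1)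
    ((-(1 / 2 : ℝ)) • (fderiv ℝ u z).comp mulI)

/-- The matrix `(g_{j k̄})` of a real (1,1)-form `α = i ∑ g_{j k̄} dz_j ∧ dz̄_k` in linear
coordinates `z_j` dual to a (fixed) complex basis `b_j` of `V`:
`g_{j k̄} = (α(b_j, i b_k) - i α(b_j, b_k)) / 2`. -/
def hermMatrix [FiniteDimensional ℂ V] (α : V [⋀^Fin 2]→L[ℝ] ℝ) :
    Matrix (Fin (Module.finrank ℂ V)) (Fin (Module.finrank ℂ V)) ℂ :=
  Matrix.of fun j k =>
    let b := Module.finBasis ℂ V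
    ((α ![b j, Complex.I • b k] : ℂ) - Complex.I * (α ![b j, b k] : ℂ)) / 2

/-- The eigenvalues, with multiplicity, of the (1,1)-form `α` with respect to the positive
(1,1)-form `η`, that is, of the endomorphism `g⁻¹ a` where `g` and `a` are the matrices of
`η` and `α`. -/
def relEigenvalues [FiniteDimensional ℂ V] (η α : V [⋀^Fin 2]→L[ℝ] ℝ) : Multiset ℂ :=
  ((hermMatrix η)⁻¹ * hermMatrix α).charpoly.roots

end Local

section Global

variable {V : Type*} [NormedAddCommGroup V] [NormedSpace ℂ V]
  {H : Type*} [TopologicalSpace H] (I : ModelWithCorners ℂ V H)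
  {N : Type*} [TopologicalSpace N] [ChartedSpace H N]

section Calculus

variable [IsManifold I 1 N]

/-- The local expression of a differential form in the preferred chart at `c`. -/
def inChart {k : ℕ} (η : Form V N k) (c : N) (z : V) : V [⋀^Fin k]→L[ℝ] ℝ :=
  (η ((extChartAt I c).symm z)).compContinuousLinearMap
    ((tangentCoordChange I c ((extChartAt I c).symm z)
      ((extChartAt I c).symm z)).restrictScalars ℝ)

/-- Smooth differential forms. -/
def IsSmoothForm {k : ℕ} (η : Form V N k) : Prop :=
  ∀ c : N, ContDiffOn ℝ ∞ (inChart I η c) (extChartAt I c).target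

/-- A family of forms `Ω s`, `s ∈ S ⊆ ℝ`, that is smooth jointly in the parameter and the point. -/
def IsSmoothFamily {k : ℕ} (S : Set ℝ) (Ω : ℝ → Form V N k) : Prop :=
  ∀ c : N, ContDiffOn ℝ ∞ (fun q : ℝ × V => inChart I (Ω q.1) c q.2)
    (S ×ˢ (extChartAt I c).target)

/-- The exterior derivative of a differential form. -/
def extD {k : ℕ} (η : Form V N k) : Form V N (k + 1) := fun x =>
  extDeriv (inChart I η x) (extChartAt I x x)

/-- Two (closed) forms of degree `k + 1` have the same class in de Rham cohomology. -/
def SameClass {k : ℕ} (η η' : Form V N (k + 1)) : Prop :=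
  ∃ α : Form V N k, IsSmoothForm I α ∧ η - η' = extD I α

/-- Contraction of a form with a vector field. -/
def contract {k : ℕ} (X : N → V) (η : Form V N (k + 1)) : Form V N k := fun x =>
  (η x).curryLeft (X x)

/-- The Lie derivative of a form along a vector field, `L_X η = d (ι_X η) + ι_X (d η)`. -/
def lieD {k : ℕ} (X : N → V) (η : Form V N (k + 1)) : Form V N (k + 1) :=
  extD I (contract X η) + contract X (extD I η)

/-- A Kähler form: a smooth closed real 2-form, invariant under the complex structure and
positive. The corresponding Riemannian metric is `g(v, w) = η(v, J w)`. -/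
structure IsKahler (η : Form V N 2) : Prop where
  smooth : IsSmoothForm I η
  closed : extD I η = 0
  invariant : ∀ x (v w : V), η x ![Complex.I • v, Complex.I • w] = η x ![v, w]
  positive : ∀ x (v : V), v ≠ 0 → 0 < η x ![v, Complex.I • v]

/-- The Ricci form `Ric(η) = - i∂∂̄ log det (g_{j k̄})`, in the preferred chart at each point. -/
def ricciForm [FiniteDimensional ℂ V] (η : Form V N 2) : Form V N 2 := fun x =>
  - ddbarV (fun z => Real.log (hermMatrix (inChart I η x z)).det.re) (extChartAt I x x)

/-- A vector field `X` is holomorphic as a section of the holomorphic tangent bundle. Under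
`T N ≅ T^{1,0} N`, `X ↦ (X - i J X) / 2`, this says that the real vector field `X` is
the real part of the holomorphic vector field `X - i J X`. -/
def IsHolomorphicField (X : N → V) : Prop :=
  ContMDiff I I.tangent ω (fun x => (⟨x, X x⟩ : TangentBundle I N))

/-- `(η, X)` is a steady Kähler–Ricci soliton: `η` is a Kähler form, `X` is the real part of a
holomorphic vector field, and `Ric(η) = - L_X η`. -/
structure IsSteadySoliton [FiniteDimensional ℂ V] (η : Form V N 2) (X : N → V) : Prop where
  kahler : IsKahler I η
  holomorphic : IsHolomorphicField I X
  soliton : ricciForm I η = - lieD I X η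

end Calculus

/-- The form `i∂∂̄u` of a real function `u` on a complex manifold. -/
def ddbar (u : N → ℝ) : Form V N 2 := fun x =>
  ddbarV (u ∘ (extChartAt I x).symm) (extChartAt I x x)

/-- The pullback of a form under a holomorphic map. -/
def pullback {V' : Type*} [NormedAddCommGroup V'] [NormedSpace ℂ V']
    {H' : Type*} [TopologicalSpace H'] (I' : ModelWithCorners ℂ V' H')
    {N' : Type*} [TopologicalSpace N'] [ChartedSpace H' N'] {k : ℕ}
    (f : N → N') (η : Form V' N' k) : Form V N k := fun x =>
  let A : V →L[ℂ] V' := mfderiv I I' f x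
  (η (f x)).compContinuousLinearMap (A.restrictScalars ℝ)

/-- The real manifold underlying a complex manifold: the same charts, with scalars restricted
to `ℝ`. -/
def realModel [I.Boundaryless] : ModelWithCorners ℝ V H :=
  ModelWithCorners.ofTargetUniv ℝ I.toPartialEquiv I.source_eq
    (I.range_eq_target.symm.trans I.range_eq_univ) I.continuous_toFun I.continuous_invFun

/-- The norm `|v| = √η(v, J v)` of the Riemannian metric of a Kähler form. -/
@[reducible] def kahlerNorm [I.Boundaryless] (η : Form V N 2) (x : N) :
    ENorm (TangentSpace (realModel I) x) where
  enorm := fun v : V => ENNReal.ofReal (Real.sqrt (η x ![v, Complex.I • v]))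

/-- The Riemannian distance of a Kähler form: the infimum of the lengths of `C^1` paths. -/
def kahlerDist [I.Boundaryless] (η : Form V N 2) (x y : N) : ENNReal :=
  letI : ∀ x : N, ENorm (TangentSpace (realModel I) x) := kahlerNorm I η
  Manifold.riemannianEDist (realModel I) x y

/-- Completeness of the Riemannian metric of a Kähler form: every Cauchy sequence for the
Riemannian distance converges. -/
def IsCompleteMetric [I.Boundaryless] (η : Form V N 2) : Prop :=
  ∀ u : ℕ → N, (∀ ε : ENNReal, 0 < ε → ∃ K, ∀ i ≥ K, ∀ j ≥ K, kahlerDist I η (u i) (u j) < ε) →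
    ∃ x, Tendsto u atTop (𝓝 x)

end Global

/-! ## The projectivisation of a holomorphic vector bundle

`D` is a complex manifold of dimension `d` and `E → D` a holomorphic vector bundle of rank `k + 1`.
-/

/-- The points of the projectivisation `P(E)` of a bundle `E`: the complex lines in the fibres of
`E`. The dimension `d` of the base and the dimension `k` of the fibres of `P(E)` are recorded
for the construction of the complex structure. -/
def ProjBundle (_d _k : ℕ) {D : Type*} (E : D → Type*) [∀ x, AddCommGroup (E x)]
    [∀ x, Module ℂ (E x)] : Type _ :=
  Σ x : D, ℙ ℂ (E x)

/-- The space `ℂ^n`. -/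
abbrev Cn (n : ℕ) : Type := EuclideanSpace ℂ (Fin n)

namespace ProjBundle

/-- The vector of `ℂ^{k+1}` with `i`-th coordinate `1` and other coordinates `w`. -/
def homog {k : ℕ} (i : Fin (k + 1)) (w : Cn k) : Cn (k + 1) :=
  WithLp.toLp 2 (i.insertNth (α := fun _ => ℂ) 1 w)

lemma homog_ne_zero {k : ℕ} (i : Fin (k + 1)) (w : Cn k) : homog i w ≠ 0 := by
  intro h
  have := congrArg (fun u : Cn (k + 1) => u i) h
  simp [homog] at this

variable {d k : ℕ} {D : Type*} {E : D → Type*}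
  [∀ x, AddCommGroup (E x)] [∀ x, Module ℂ (E x)]

/-- The bundle projection `P(E) → D`. -/
abbrev proj (y : ProjBundle d k E) : D := Sigma.fst y

/-- A nonzero vector on the line `y`. -/
def rep (y : ProjBundle d k E) : E y.proj := Projectivization.rep (Sigma.snd y)

/-- The line through a nonzero vector. -/
def mk {x : D} (v : E x) (hv : v ≠ 0) : ProjBundle d k E := ⟨x, Projectivization.mk ℂ v hv⟩

variable [TopologicalSpace D]
  [TopologicalSpace (TotalSpace (Cn (k + 1)) E)] [∀ x, TopologicalSpace (E x)]
  [FiberBundle (Cn (k + 1)) E] [VectorBundle ℂ (Cn (k + 1)) E]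

variable (k E) in
/-- The coordinates of a vector `v ∈ E x` in the preferred trivialisation of `E` at `x₀`. -/
def vecCoord (x₀ : D) (x : D) (v : E x) : Cn (k + 1) :=
  (trivializationAt (Cn (k + 1)) E x₀ ⟨x, v⟩).2

variable (k E) in
/-- The vector of `E x` with coordinates `u` in the preferred trivialisation of `E` at `x₀`
(outside of the domain of that trivialisation, in the one at `x`). -/
def ofCoord (x₀ x : D) (u : Cn (k + 1)) : E x :=
  open Classical in
  if h : x ∈ (trivializationAt (Cn (k + 1)) E x₀).baseSet then
    ((trivializationAt (Cn (k + 1)) E x₀).continuousLinearEquivAt ℂ x h).symm u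
  else
    ((trivializationAt (Cn (k + 1)) E x).continuousLinearEquivAt ℂ x
      (mem_baseSet_trivializationAt _ _ _)).symm u

lemma ofCoord_ne_zero (x₀ x : D) {u : Cn (k + 1)} (hu : u ≠ 0) : ofCoord k E x₀ x u ≠ 0 := by
  unfold ofCoord
  split_ifs with h
  all_goals exact fun h0 => hu (EmbeddingLike.map_eq_zero_iff.1 h0)

lemma vecCoord_smul {x₀ x : D} (hx : x ∈ (trivializationAt (Cn (k + 1)) E x₀).baseSet)
    (a : ℂ) (v : E x) : vecCoord k E x₀ x (a • v) = a • vecCoord k E x₀ x v :=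
  ((trivializationAt (Cn (k + 1)) E x₀).continuousLinearEquivAt ℂ x hx).map_smul a v

lemma vecCoord_ofCoord {x₀ x₁ x : D}
    (hx : x ∈ (trivializationAt (Cn (k + 1)) E x₀).baseSet)
    (hx₁ : x ∈ (trivializationAt (Cn (k + 1)) E x₁).baseSet) (u : Cn (k + 1)) :
    vecCoord k E x₁ x (ofCoord k E x₀ x u) =
      (trivializationAt (Cn (k + 1)) E x₀).coordChangeL ℂ
        (trivializationAt (Cn (k + 1)) E x₁) x u := by
  rw [← Trivialization.comp_continuousLinearEquivAt_eq_coord_change _ _ ⟨hx, hx₁⟩]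
  simp [ofCoord, hx, vecCoord]

lemma vecCoord_ofCoord_self {x₀ x : D}
    (hx : x ∈ (trivializationAt (Cn (k + 1)) E x₀).baseSet) (u : Cn (k + 1)) :
    vecCoord k E x₀ x (ofCoord k E x₀ x u) = u := by
  rw [ofCoord, dif_pos hx]
  exact ContinuousLinearEquiv.apply_symm_apply
    ((trivializationAt (Cn (k + 1)) E x₀).continuousLinearEquivAt ℂ x hx) u

lemma ofCoord_vecCoord {x₀ x : D}
    (hx : x ∈ (trivializationAt (Cn (k + 1)) E x₀).baseSet) (v : E x) :
    ofCoord k E x₀ x (vecCoord k E x₀ x v) = v := by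
  rw [ofCoord, dif_pos hx]
  exact ContinuousLinearEquiv.symm_apply_apply
    ((trivializationAt (Cn (k + 1)) E x₀).continuousLinearEquivAt ℂ x hx) v

lemma vecCoord_ne_zero {x₀ x : D}
    (hx : x ∈ (trivializationAt (Cn (k + 1)) E x₀).baseSet) {v : E x} (hv : v ≠ 0) :
    vecCoord k E x₀ x v ≠ 0 :=
  (((trivializationAt (Cn (k + 1)) E x₀).continuousLinearEquivAt ℂ x hx).map_ne_zero_iff).2 hv

/-- The homogeneous coordinates of (a representative of) a line, in the preferred trivialisation of
`E` at `x₀`. -/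
def homCoord (x₀ : D) (y : ProjBundle d k E) : Cn (k + 1) := vecCoord k E x₀ y.proj y.rep

lemma homCoord_mk {x₀ x : D} (hx : x ∈ (trivializationAt (Cn (k + 1)) E x₀).baseSet)
    (v : E x) (hv : v ≠ 0) : ∃ a : ℂ, a ≠ 0 ∧
      homCoord x₀ (mk v hv : ProjBundle d k E) = a • vecCoord k E x₀ x v := by
  obtain ⟨a, ha⟩ := Projectivization.exists_smul_eq_mk_rep ℂ v hv
  refine ⟨a, a.ne_zero, ?_⟩
  rw [← vecCoord_smul hx]
  exact congrArg (vecCoord k E x₀ x) ha.symm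

lemma exists_homCoord_ne_zero (y : ProjBundle d k E) : ∃ i, homCoord y.proj y i ≠ 0 := by
  by_contra! h
  exact vecCoord_ne_zero (mem_baseSet_trivializationAt _ _ _)
    (Projectivization.rep_nonzero (Sigma.snd y)) (PiLp.ext h)

variable [ChartedSpace (Cn d) D]

/-- The standard affine chart of `P(E)`: in the preferred chart of `D` and the preferred
trivialisation of `E` at `x₀`, the line through `v ∈ E x` with `v_i ≠ 0` has the coordinates
`(x, (v_j / v_i)_{j ≠ i})`. -/
def affineChart (x₀ : D) (i : Fin (k + 1)) :
    PartialEquiv (ProjBundle d k E) (Cn d × Cn k) where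
  toFun y := (chartAt (Cn d) x₀ y.proj,
    WithLp.toLp 2 fun j => homCoord x₀ y (i.succAbove j) / homCoord x₀ y i)
  invFun q := mk (ofCoord k E x₀ ((chartAt (Cn d) x₀).symm q.1) (homog i q.2))
    (ofCoord_ne_zero _ _ (homog_ne_zero _ _))
  source := {y | y.proj ∈ (chartAt (Cn d) x₀).source ∧
    y.proj ∈ (trivializationAt (Cn (k + 1)) E x₀).baseSet ∧ homCoord x₀ y i ≠ 0}
  target := {q | q.1 ∈ (chartAt (Cn d) x₀).target ∧
    (chartAt (Cn d) x₀).symm q.1 ∈ (trivializationAt (Cn (k + 1)) E x₀).baseSet}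
  map_source' := by
    rintro y ⟨h1, h2, h3⟩
    exact ⟨(chartAt (Cn d) x₀).map_source h1, by
      simpa only [(chartAt (Cn d) x₀).left_inv h1] using h2⟩
  map_target' := by
    rintro q ⟨h1, h2⟩
    refine ⟨(chartAt (Cn d) x₀).map_target h1, h2, ?_⟩
    obtain ⟨a, ha, h⟩ := homCoord_mk (d := d) h2 _ (ofCoord_ne_zero (k := k) (E := E) x₀
      ((chartAt (Cn d) x₀).symm q.1) (homog_ne_zero i q.2))
    rw [h, vecCoord_ofCoord_self h2]
    simpa [homog] using ha
  left_inv' := by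
    rintro y ⟨h1, h2, h3⟩
    have key : ∀ x (hx : x = y.proj) (w : Cn k)
        (hw : w = WithLp.toLp 2 fun j => homCoord x₀ y (i.succAbove j) / homCoord x₀ y i),
        (mk (ofCoord k E x₀ x (homog i w)) (ofCoord_ne_zero _ _ (homog_ne_zero _ _)) :
          ProjBundle d k E) = y := by
      rintro x rfl w rfl
      have hu : homog i (WithLp.toLp 2 fun j => homCoord x₀ y (i.succAbove j) / homCoord x₀ y i) =
          (homCoord x₀ y i)⁻¹ • homCoord x₀ y := by
        ext j
        rcases Fin.eq_self_or_eq_succAbove i j with rfl | ⟨j, rfl⟩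
        · simp [homog, h3]
        · simp [homog, div_eq_inv_mul]
      refine Sigma.ext rfl (heq_of_eq ?_)
      refine Eq.trans ?_ (Projectivization.mk_rep (Sigma.snd y))
      refine (Projectivization.mk_eq_mk_iff' ℂ _ _ _ _).2 ⟨(homCoord x₀ y i)⁻¹, ?_⟩
      rw [hu, homCoord, ← vecCoord_smul h2, ofCoord_vecCoord h2]
      rfl
    exact key _ ((chartAt (Cn d) x₀).left_inv h1) _ rfl
  right_inv' := by
    rintro q ⟨h1, h2⟩
    obtain ⟨a, ha, h⟩ := homCoord_mk (d := d) h2 _ (ofCoord_ne_zero (k := k) (E := E) x₀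
      ((chartAt (Cn d) x₀).symm q.1) (homog_ne_zero i q.2))
    refine Prod.ext ((chartAt (Cn d) x₀).right_inv h1) (PiLp.ext fun j => ?_)
    simp only [h, vecCoord_ofCoord_self h2]
    simp [homog, ha]

/-- The coordinates of a point of one affine chart in the trivialisation used for another one. -/
lemma homCoord_affineChart_symm {x₀ x₁ : D} {i : Fin (k + 1)} {q : Cn d × Cn k}
    (h₀ : (chartAt (Cn d) x₀).symm q.1 ∈
      (trivializationAt (Cn (k + 1)) E x₀).baseSet)
    (h₁ : (chartAt (Cn d) x₀).symm q.1 ∈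
      (trivializationAt (Cn (k + 1)) E x₁).baseSet) :
    ∃ a : ℂ, a ≠ 0 ∧ homCoord x₁ ((affineChart x₀ i : PartialEquiv (ProjBundle d k E) _).symm q) =
      a • (trivializationAt (Cn (k + 1)) E x₀).coordChangeL ℂ
        (trivializationAt (Cn (k + 1)) E x₁) ((chartAt (Cn d) x₀).symm q.1)
          (homog i q.2) := by
  rw [← vecCoord_ofCoord h₀ h₁]
  exact homCoord_mk h₁ _ _

variable (k E) in
/-- The set on which two charts of `D` and two trivialisations of `E` are defined, seen in the
first chart. -/
def overlap (x₀ x₁ : D) : Set (Cn d) :=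
  (chartAt (Cn d) x₀).target ∩ (chartAt (Cn d) x₀).symm ⁻¹'
    ((chartAt (Cn d) x₁).source ∩ ((trivializationAt (Cn (k + 1)) E x₀).baseSet ∩
      (trivializationAt (Cn (k + 1)) E x₁).baseSet))

variable (k E) in
/-- The change of homogeneous coordinates between two affine charts. -/
def homTransition (x₀ x₁ : D) (i : Fin (k + 1)) (q : Cn d × Cn k) :
    Cn (k + 1) :=
  (trivializationAt (Cn (k + 1)) E x₀).coordChangeL ℂ
    (trivializationAt (Cn (k + 1)) E x₁) ((chartAt (Cn d) x₀).symm q.1) (homog i q.2)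

lemma transition_source (x₀ x₁ : D) (i i₁ : Fin (k + 1)) :
    ((affineChart x₀ i : PartialEquiv (ProjBundle d k E) _).symm.trans
      (affineChart x₁ i₁)).source =
      {q | q.1 ∈ overlap k E x₀ x₁} ∩ {q | homTransition k E x₀ x₁ i q i₁ ≠ 0} := by
  ext q
  rw [PartialEquiv.trans_source]
  constructor
  · rintro ⟨⟨h1, h2⟩, h3, h4, h5⟩
    refine ⟨⟨h1, h3, h2, h4⟩, ?_⟩
    obtain ⟨a, ha, h⟩ := homCoord_affineChart_symm (d := d) (i := i) h2 h4
    rw [h] at h5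
    exact right_ne_zero_of_mul h5
  · rintro ⟨⟨h1, h3, h2, h4⟩, h5⟩
    refine ⟨⟨h1, h2⟩, h3, h4, ?_⟩
    obtain ⟨a, ha, h⟩ := homCoord_affineChart_symm (d := d) (i := i) h2 h4
    rw [h]
    exact mul_ne_zero ha h5

lemma transition_eqOn (x₀ x₁ : D) (i i₁ : Fin (k + 1)) :
    EqOn ((affineChart x₀ i : PartialEquiv (ProjBundle d k E) _).symm.trans (affineChart x₁ i₁))
      (fun q => (chartAt (Cn d) x₁ ((chartAt (Cn d) x₀).symm q.1), WithLp.toLp 2 fun j =>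
        homTransition k E x₀ x₁ i q (i₁.succAbove j) / homTransition k E x₀ x₁ i q i₁))
      {q | q.1 ∈ overlap k E x₀ x₁} := by
  rintro q ⟨h1, h3, h2, h4⟩
  obtain ⟨a, ha, h⟩ := homCoord_affineChart_symm (d := d) (i := i) h2 h4
  refine Prod.ext rfl (PiLp.ext fun j => ?_)
  change homCoord x₁ ((affineChart x₀ i : PartialEquiv (ProjBundle d k E) _).symm q) _ /
    homCoord x₁ ((affineChart x₀ i : PartialEquiv (ProjBundle d k E) _).symm q) _ = _
  rw [h]
  exact mul_div_mul_left _ _ ha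

variable [IsManifold 𝓘(ℂ, Cn d) ω D]
  [ContMDiffVectorBundle ω (Cn (k + 1)) E 𝓘(ℂ, Cn d)]

lemma contDiffOn_homTransition (x₀ x₁ : D) (i : Fin (k + 1)) :
    ContDiffOn ℂ ω (homTransition (d := d) k E x₀ x₁ i) {q | q.1 ∈ overlap k E x₀ x₁} := by
  have h1 : ContMDiffOn 𝓘(ℂ, Cn d) 𝓘(ℂ, Cn (k + 1) →L[ℂ] Cn (k + 1)) ω
      (fun b : D => ((trivializationAt (Cn (k + 1)) E x₀).coordChangeL ℂ
        (trivializationAt (Cn (k + 1)) E x₁) b :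
          Cn (k + 1) →L[ℂ] Cn (k + 1))) _ :=
    contMDiffOn_coordChangeL _ _
  have h2 := (h1.comp (contMDiffOn_chart_symm (I := 𝓘(ℂ, Cn d)) (n := ω) (x := x₀) |>.mono
    (inter_subset_left : overlap (d := d) k E x₀ x₁ ⊆ _)) fun z hz => hz.2.2).contDiffOn
  have h3 : ContDiff ℂ ω (fun q : Cn d × Cn k => homog i q.2) := by
    refine contDiff_euclidean.2 fun j => ?_
    rcases Fin.eq_self_or_eq_succAbove i j with rfl | ⟨j, rfl⟩
    · simpa [homog] using contDiff_const
    · simpa [homog] using (contDiff_euclidean.1 contDiff_snd j)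
  exact (h2.comp contDiff_fst.contDiffOn fun q hq => hq).clm_apply h3.contDiffOn

lemma contDiffOn_transition (x₀ x₁ : D) (i i₁ : Fin (k + 1)) :
    ContDiffOn ℂ ω
      ((affineChart x₀ i : PartialEquiv (ProjBundle d k E) _).symm.trans (affineChart x₁ i₁))
      ((affineChart x₀ i : PartialEquiv (ProjBundle d k E) _).symm.trans
        (affineChart x₁ i₁)).source := by
  rw [transition_source]
  refine ContDiffOn.congr ?_ ((transition_eqOn x₀ x₁ i i₁).mono inter_subset_left)
  have hT := contDiffOn_euclidean.1 ((contDiffOn_homTransition (d := d) (k := k) (E := E) x₀ x₁ i).mono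
    (inter_subset_left (t := {q | homTransition k E x₀ x₁ i q i₁ ≠ 0})))
  refine ContDiffOn.prodMk ?_ (contDiffOn_euclidean.2 fun j => (hT _).div (hT _) fun q hq => hq.2)
  have h1 : ContMDiffOn 𝓘(ℂ, Cn d) 𝓘(ℂ, Cn d) ω
      (chartAt (Cn d) x₁ ∘ (chartAt (Cn d) x₀).symm) (overlap (d := d) k E x₀ x₁) :=
    (contMDiffOn_chart (I := 𝓘(ℂ, Cn d)) (n := ω) (x := x₁)).comp
      ((contMDiffOn_chart_symm (I := 𝓘(ℂ, Cn d)) (n := ω) (x := x₀)).mono inter_subset_left)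
      fun z hz => hz.2.1
  exact h1.contDiffOn.comp contDiff_fst.contDiffOn fun q hq => hq.1

lemma isOpen_transition_source (x₀ x₁ : D) (i i₁ : Fin (k + 1)) :
    IsOpen ((affineChart x₀ i : PartialEquiv (ProjBundle d k E) _).symm.trans
      (affineChart x₁ i₁)).source := by
  have ho : IsOpen (overlap (d := d) k E x₀ x₁) :=
    (chartAt (Cn d) x₀).isOpen_inter_preimage_symm
      ((chartAt (Cn d) x₁).open_source.inter
        ((trivializationAt (Cn (k + 1)) E x₀).open_baseSet.inter
          (trivializationAt (Cn (k + 1)) E x₁).open_baseSet))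
  rw [transition_source]
  refine ContinuousOn.isOpen_inter_preimage (t := {z : ℂ | z ≠ 0}) ?_
    (ho.preimage continuous_fst) isOpen_ne
  exact (contDiffOn_euclidean.1 (contDiffOn_homTransition (d := d) (k := k) (E := E) x₀ x₁ i) i₁).continuousOn

variable (d k E) in
/-- The affine charts form an atlas of `P(E)`, modelled on `ℂ^d × ℂ^k`. -/
def chartedSpaceCore : ChartedSpaceCore (Cn d × Cn k) (ProjBundle d k E) where
  atlas := {c | ∃ x₀ i, c = affineChart x₀ i}
  chartAt y := affineChart y.proj (exists_homCoord_ne_zero y).choose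
  mem_chart_source y := ⟨mem_chart_source _ _, mem_baseSet_trivializationAt _ _ _,
    (exists_homCoord_ne_zero y).choose_spec⟩
  chart_mem_atlas y := ⟨_, _, rfl⟩
  open_source := by
    rintro _ _ ⟨x₀, i, rfl⟩ ⟨x₁, i₁, rfl⟩
    exact isOpen_transition_source x₀ x₁ i i₁
  continuousOn_toFun := by
    rintro _ _ ⟨x₀, i, rfl⟩ ⟨x₁, i₁, rfl⟩
    exact (contDiffOn_transition x₀ x₁ i i₁).continuousOn

instance : TopologicalSpace (ProjBundle d k E) := (chartedSpaceCore d k E).toTopologicalSpace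

instance : ChartedSpace (Cn d × Cn k) (ProjBundle d k E) :=
  (chartedSpaceCore d k E).toChartedSpace

/-- `P(E)` is a complex manifold. -/
instance : IsManifold 𝓘(ℂ, Cn d × Cn k) ω (ProjBundle d k E) := by
  refine isManifold_of_contDiffOn _ _ _ ?_
  intro e e' he he'
  obtain ⟨_, ⟨x₀, i, rfl⟩, h⟩ := mem_iUnion₂.1 he
  obtain rfl := mem_singleton_iff.1 h
  obtain ⟨_, ⟨x₁, i₁, rfl⟩, h'⟩ := mem_iUnion₂.1 he'
  obtain rfl := mem_singleton_iff.1 h'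
  have := contDiffOn_transition (d := d) (k := k) (E := E) x₀ x₁ i i₁
  refine ContDiffOn.mono (this.congr fun q hq => rfl) ?_
  rintro q ⟨hq, -⟩
  exact hq

/-- The local holomorphic frame of the tautological line bundle `O_{P(E)}(-1) ⊆ p^* E` near
`y₀`: it assigns to a line `y` the vector on `y` that, in the preferred trivialisation of `E`, has
the coordinate `1` at the index used for the preferred chart of `P(E)` at `y₀`. -/
def tautFrame (y₀ y : ProjBundle d k E) : TotalSpace (Cn (k + 1)) E :=
  ⟨y.proj, (homCoord y₀.proj y (exists_homCoord_ne_zero y₀).choose)⁻¹ •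
    Projectivization.rep (Sigma.snd y)⟩

end ProjBundle

section Bundle

variable (d k : ℕ) {D : Type*} [TopologicalSpace D] [ChartedSpace (Cn d) D]
  (E : D → Type*) [∀ x, AddCommGroup (E x)] [∀ x, Module ℂ (E x)]
  [TopologicalSpace (TotalSpace (Cn (k + 1)) E)] [∀ x, TopologicalSpace (E x)]
  [FiberBundle (Cn (k + 1)) E]

/-- The model of `D`. -/
abbrev baseModel : ModelWithCorners ℂ (Cn d) (Cn d) := 𝓘(ℂ, Cn d)

/-- The model of the total space of `E`. -/
abbrev totalModel : ModelWithCorners ℂ (Cn d × Cn (k + 1)) (ModelProd (Cn d) (Cn (k + 1))) :=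
  𝓘(ℂ, Cn d).prod 𝓘(ℂ, Cn (k + 1))

/-- The model of `P(E)`. -/
abbrev projModel : ModelWithCorners ℂ (Cn d × Cn k) (Cn d × Cn k) := 𝓘(ℂ, Cn d × Cn k)

/-- A smooth Hermitian metric on the vector bundle `E`. Smoothness is expressed by the
smoothness of the function `v ↦ h(v, v)` on the total space. -/
structure HermitianMetric where
  /-- The Hermitian inner product, conjugate linear in the first variable. -/
  inner : ∀ x, E x →ₗ⋆[ℂ] E x →ₗ[ℂ] ℂ
  symm : ∀ x (v w : E x), (starRingEnd ℂ) (inner x v w) = inner x w v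
  pos : ∀ x (v : E x), v ≠ 0 → 0 < (inner x v v).re
  smooth : ContMDiff (realModel (totalModel d k)) 𝓘(ℝ, ℝ) ∞
    (fun v : TotalSpace (Cn (k + 1)) E => (inner v.proj v.2 v.2).re)

variable {d k E}

/-- The function `v ↦ h(v, v)` on the total space of `E`. -/
def HermitianMetric.normSq (h : HermitianMetric d k E) (v : TotalSpace (Cn (k + 1)) E) : ℝ :=
  (h.inner v.proj v.2 v.2).re

variable [VectorBundle ℂ (Cn (k + 1)) E]

section Curvature

variable [IsManifold (baseModel d) ω D] [ContMDiffVectorBundle ω (Cn (k + 1)) E (baseModel d)]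

/-- The curvature form `γ = - i∂∂̄ log h(s, s)` of the tautological bundle `O_{P(E)}(-1) ⊆ p^* E`
with the metric `h`, where `s` is a local holomorphic frame of `O_{P(E)}(-1)`. -/
def tautCurvature (h : HermitianMetric d k E) : Form (Cn d × Cn k) (ProjBundle d k E) 2 :=
  fun y => - ddbar (projModel d k) (fun q => Real.log (h.normSq (ProjBundle.tautFrame y q))) y

end Curvature

variable (d k E) in
/-- The Euler vector field: the value at `v ∈ E` of the holomorphic vector field `z ∂/∂z` which
generates the action of `ℂ^*` on `E` by scalar multiplication, i.e. the velocity of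
`s ↦ s v` at `s = 1`. -/
def eulerField (v : TotalSpace (Cn (k + 1)) E) : Cn d × Cn (k + 1) :=
  let A : ℂ →L[ℂ] Cn d × Cn (k + 1) := mfderiv 𝓘(ℂ, ℂ) (totalModel d k)
    (fun s : ℂ => (⟨v.proj, s • v.2⟩ : TotalSpace (Cn (k + 1)) E)) 1
  A 1

end Bundle

end KRS

end

noncomputable section

namespace KRS

/-! ### Calculus of `i∂∂̄` on a complex vector space. -/

section LocalCalculus

set_option synthInstance.maxHeartbeats 200000

variable {V : Type*} [NormedAddCommGroup V] [NormedSpace ℂ V]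
  {W : Type*} [NormedAddCommGroup W] [NormedSpace ℂ W]

/-! The construction is the Calabi ansatz in momentum coordinates. Put `m = k + 1`, `s = h(v, v)`
and look for `ω = π^*ω_D + i∂∂̄ F(s)`. Let `T = F'`, let `τ = s T(s)` be the momentum, and let `φ =
s D(s)` with `D = dτ/ds`. Off the zero section `t = log s` is a pluriharmonic function plus a
potential pulled back from `P(E)`, so `i∂∂̄ t` is the pullback of `-γ` and `ω = (p^*ω_D - τγ) + φ
i∂t ∧ ∂̄t` (`IsKahlerData.totalForm_eq`). Positivity of `ω` therefore reduces to `T > 0` and `D >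
0`.

Up to the squared norm of a holomorphic function, `det ω` is `φ det(p^*ω_D - τγ)`
(`IsKahlerData.exists_det_totalForm_eq`). Since `p^*ω_D - τγ = ω_M + (1 - τ)γ` and the eigenvalues
`β` of `γ` are constant, the last determinant is `det ω_M` times the polynomial `Q(τ) = ∏ (1 + (1 -
τ)β)`. If `Q(τ) φ = m s^m e^{μτ}`, then `log det ω` is `log det ω_M + m log s + μτ` up to
pluriharmonic terms. The hypothesis `Ric(ω_M) = -mγ` says exactly that the first two terms cancel
under `i∂∂̄`, so `Ric(ω) = -μ i∂∂̄τ`; continuity extends this across the zero section. On the other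
side, `s` is invariant under rotation of the fibres and the Euler field differentiates `F(s)` to
`2τ`, so Cartan's formula gives `L_X ω = μ i∂∂̄τ` for `X = (μ/2)·eulerField` (`lieD_solForm`). This
`X` is `μ Re Z`: in the identification of `TE` with `T^{1,0}E` the Euler field corresponds to `Z`,
and `Re Z` is half of it.

It remains to solve the equation. The form `p^*ω_D - xγ` is positive for `x > 0` and degenerates at
`x = 0` exactly along the `k`-dimensional fibres of `P(E)`, so `Q(x) = x^k R(x)` with `R > 0` on
`[0, ∞)` (`IsKahlerData.exists_momentum_polynomial`). The equation then separates into `s^{k+1} =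
∫_0^τ x^k R(x) e^{-μx} dx`. The `(k+1)`-st root of the right side is `τ` times a smooth positive
function, hence can be inverted smoothly across `τ = 0` and jointly in `μ`. As `μ < 0`, the integral
diverges as `τ → ∞`, so `τ` is defined for all `s ≥ 0`; it tends to infinity, and `φ` stays bounded
(`exists_momentum_profile`).

For completeness, `|dτ|²` is at most a constant times `φ`, so `τ` is Lipschitz, and its sublevel
sets are compact because `D` is compact; Cauchy sequences thus stay in a compact set. The cohomology
class is right because `i∂∂̄F(s)` is exact. Distinct `μ` give distinct forms: the value of `ω` on
the Euler field recovers `D`, hence `τ`, and then `e^{μτ}` is read off from the equation at `s = 1`.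
-/

@[simp] lemma mulI_apply (v : V) : mulI v = Complex.I • v := rfl

lemma two_le_infty : (2 : ℕ∞ω) ≤ ∞ := WithTop.coe_le_coe.2 le_top

lemma form2_ext {η η' : V [⋀^Fin 2]→L[ℝ] ℝ} (h : ∀ v w, η ![v, w] = η' ![v, w]) : η = η' := by
  ext x
  have : x = ![x 0, x 1] := by ext i; fin_cases i <;> rfl
  rw [this]
  exact h _ _

lemma form2_self (η : V [⋀^Fin 2]→L[ℝ] ℝ) (v : V) : η ![v, v] = 0 :=
  η.map_eq_zero_of_eq _ (i := 0) (j := 1) rfl (by decide)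

lemma form2_add_left (η : V [⋀^Fin 2]→L[ℝ] ℝ) (u v w : V) :
    η ![u + v, w] = η ![u, w] + η ![v, w] := η.vecCons_add ..

lemma form2_smul_left (η : V [⋀^Fin 2]→L[ℝ] ℝ) (c : ℝ) (v w : V) :
    η ![c • v, w] = c * η ![v, w] := η.vecCons_smul ..

lemma form2_swap (η : V [⋀^Fin 2]→L[ℝ] ℝ) (v w : V) : η ![v, w] = - η ![w, v] := by
  have h := form2_self η (v + w)
  have e : ∀ a b c : V, η ![a, b + c] = η ![a, b] + η ![a, c] := fun a b c => by
    have := η.map_update_add ![a, b] 1 b c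
    have e1 : ∀ z, Function.update ![a, b] 1 z = ![a, z] := fun z => by
      ext i; fin_cases i <;> rfl
    simpa only [e1] using this
  rw [form2_add_left, e, e, form2_self, form2_self] at h
  linarith

lemma form2_add_right (η : V [⋀^Fin 2]→L[ℝ] ℝ) (u v w : V) :
    η ![u, v + w] = η ![u, v] + η ![u, w] := by
  rw [form2_swap, form2_add_left, form2_swap η u v, form2_swap η u w]; ring

lemma form2_smul_right (η : V [⋀^Fin 2]→L[ℝ] ℝ) (c : ℝ) (v w : V) :
    η ![v, c • w] = c * η ![v, w] := by
  rw [form2_swap, form2_smul_left, form2_swap η v w]; ring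

lemma form2_neg_right (η : V [⋀^Fin 2]→L[ℝ] ℝ) (v w : V) :
    η ![v, -w] = - η ![v, w] := by simpa using form2_smul_right η (-1) v w

lemma form2_comp_apply (η : W [⋀^Fin 2]→L[ℝ] ℝ) (A : V →L[ℝ] W) (v w : V) :
    η.compContinuousLinearMap A ![v, w] = η ![A v, A w] := by
  rw [ContinuousAlternatingMap.compContinuousLinearMap_apply]
  congr 1
  ext i; fin_cases i <;> rfl

/-- The real 1-form `(i/2)(∂̄u - ∂u)`, that is, `v ↦ - du(iv)/2`. -/
def dcV (u : V → ℝ) (z : V) : V [⋀^Fin 1]→L[ℝ] ℝ :=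
  ContinuousAlternatingMap.ofSubsingleton ℝ V ℝ (0 : Fin 1)
    ((-(1 / 2 : ℝ)) • (fderiv ℝ u z).comp mulI)

lemma ddbarV_eq (u : V → ℝ) : ddbarV u = extDeriv (dcV u) := rfl

lemma dcV_apply (u : V → ℝ) (z : V) (v : Fin 1 → V) :
    dcV u z v = -(1 / 2) * fderiv ℝ u z (Complex.I • v 0) := rfl

/-- The linear map taking the differential of `u` to `dcV u`. -/
def dcL : (V →L[ℝ] ℝ) →L[ℝ] V [⋀^Fin 1]→L[ℝ] ℝ :=
  ((ContinuousAlternatingMap.ofSubsingletonLIE (𝕜 := ℝ) (E := V) (F := ℝ) (0 : Fin 1)).toContinuousLinearEquiv :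
    (V →L[ℝ] ℝ) →L[ℝ] V [⋀^Fin 1]→L[ℝ] ℝ) ∘L
    ((-(1 / 2 : ℝ)) • (ContinuousLinearMap.compL ℝ V V ℝ).flip mulI)

lemma dcV_eq_dcL (u : V → ℝ) (z : V) : dcV u z = dcL (fderiv ℝ u z) := rfl

/-- The linear map taking the second differential of `u` to `ddbarV u`. -/
def ddbarL : (V →L[ℝ] V →L[ℝ] ℝ) →L[ℝ] V [⋀^Fin 2]→L[ℝ] ℝ :=
  ContinuousAlternatingMap.alternatizeUncurryFinCLM ℝ V ℝ ∘L
    (ContinuousLinearMap.compL ℝ V (V →L[ℝ] ℝ) (V [⋀^Fin 1]→L[ℝ] ℝ) dcL)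

lemma ddbarL_apply (B : V →L[ℝ] V →L[ℝ] ℝ) (v w : V) :
    ddbarL B ![v, w] = -(1 / 2) * (B v (Complex.I • w) - B w (Complex.I • v)) := by
  change ContinuousAlternatingMap.alternatizeUncurryFin (dcL ∘L B) ![v, w] = _
  have e (f : V →L[ℝ] ℝ) (x : Fin 1 → V) : dcL f x = -(1 / 2) * f (Complex.I • x 0) := rfl
  rw [ContinuousAlternatingMap.alternatizeUncurryFin_apply]
  simp [Fin.sum_univ_two, e, Fin.removeNth, Fin.succAbove]
  ring

lemma _root_.ContDiffAt.differentiableAt_fderiv {E F : Type*} [NormedAddCommGroup E] [NormedSpace ℝ E]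
    [NormedAddCommGroup F] [NormedSpace ℝ F] {u : E → F} {z : E} (hu : ContDiffAt ℝ 2 u z) :
    DifferentiableAt ℝ (fderiv ℝ u) z :=
  (hu.fderiv_right (m := 1) (by norm_num)).differentiableAt one_ne_zero

/-- Expresses `i∂∂̄u` as a fixed continuous linear image of the real Hessian. Algebraic properties
and smoothness of `i∂∂̄u` are thereby reduced to those of second derivatives. -/
lemma ddbarV_eq_ddbarL {u : V → ℝ} {z : V} (hu : ContDiffAt ℝ 2 u z) :
    ddbarV u z = ddbarL (fderiv ℝ (fderiv ℝ u) z) := by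
  have h : fderiv ℝ (dcV u) z = dcL ∘L fderiv ℝ (fderiv ℝ u) z := by
    have : dcV u = fun z => dcL (fderiv ℝ u z) := funext fun z => dcV_eq_dcL u z
    rw [this]
    exact (dcL.hasFDerivAt.comp z hu.differentiableAt_fderiv.hasFDerivAt).fderiv
  rw [ddbarV_eq, extDeriv, h]
  rfl

lemma ddbarV_apply {u : V → ℝ} {z : V} (hu : ContDiffAt ℝ 2 u z) (v w : V) :
    ddbarV u z ![v, w] = -(1 / 2) * (fderiv ℝ (fderiv ℝ u) z v (Complex.I • w)
      - fderiv ℝ (fderiv ℝ u) z w (Complex.I • v)) := by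
  rw [ddbarV_eq_ddbarL hu, ddbarL_apply]

lemma ddbarV_congr {u u' : V → ℝ} {z : V} (h : u =ᶠ[𝓝 z] u') : ddbarV u z = ddbarV u' z := by
  refine Filter.EventuallyEq.extDeriv_eq ?_
  filter_upwards [h.fderiv (𝕜 := ℝ)] with y hy
  rw [hy]

lemma fderiv2_symm {u : V → ℝ} {z : V} (hu : ContDiffAt ℝ 2 u z) (v w : V) :
    fderiv ℝ (fderiv ℝ u) z v w = fderiv ℝ (fderiv ℝ u) z w v :=
  (hu.isSymmSndFDerivAt (by simp)).eq v w

/-- The form in which positivity gets tested: half the trace of the Hessian on the complex line of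
`v`. -/
lemma ddbarV_apply_I {u : V → ℝ} {z : V} (hu : ContDiffAt ℝ 2 u z) (v : V) :
    ddbarV u z ![v, Complex.I • v] = (1 / 2) * (fderiv ℝ (fderiv ℝ u) z v v
      + fderiv ℝ (fderiv ℝ u) z (Complex.I • v) (Complex.I • v)) := by
  rw [ddbarV_apply hu, smul_smul, Complex.I_mul_I, neg_one_smul, map_neg]; ring

lemma ddbarV_invariant {u : V → ℝ} {z : V} (hu : ContDiffAt ℝ 2 u z) (v w : V) :
    ddbarV u z ![Complex.I • v, Complex.I • w] = ddbarV u z ![v, w] := by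
  rw [ddbarV_apply hu, ddbarV_apply hu, smul_smul, smul_smul, Complex.I_mul_I, neg_one_smul,
    neg_one_smul, map_neg, map_neg, fderiv2_symm hu _ w, fderiv2_symm hu _ v]; ring

lemma ddbarV_add {u u' : V → ℝ} {z : V} (hu : ContDiffAt ℝ 2 u z) (hu' : ContDiffAt ℝ 2 u' z) :
    ddbarV (fun p => u p + u' p) z = ddbarV u z + ddbarV u' z := by
  have h : fderiv ℝ (fderiv ℝ fun p => u p + u' p) z =
      fderiv ℝ (fderiv ℝ u) z + fderiv ℝ (fderiv ℝ u') z := by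
    rw [← fderiv_add hu.differentiableAt_fderiv hu'.differentiableAt_fderiv]
    refine Filter.EventuallyEq.fderiv_eq ?_
    filter_upwards [hu.eventually (by simp), hu'.eventually (by simp)] with y hy hy'
    exact fderiv_add (hy.differentiableAt (by simp)) (hy'.differentiableAt (by simp))
  rw [ddbarV_eq_ddbarL (hu.add hu'), h, map_add, ddbarV_eq_ddbarL hu, ddbarV_eq_ddbarL hu']

lemma ddbarV_const_mul (u : V → ℝ) (z : V) (c : ℝ) :
    ddbarV (fun p => c * u p) z = c • ddbarV u z := by
  have h : dcV (fun p => c * u p) = c • dcV u := by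
    ext p v
    have : fderiv ℝ (fun p => c * u p) p = c • fderiv ℝ u p :=
      congrFun (fderiv_const_smul_field (𝕜 := ℝ) (f := u) c) p
    simp [dcV_apply, this]
    ring
  rw [ddbarV_eq, h, ddbarV_eq, extDeriv_smul]

lemma ddbarV_clm (l : V →L[ℝ] ℝ) (z : V) : ddbarV l z = 0 := by
  have : fderiv ℝ (l : V → ℝ) = fun _ => l := by ext; simp
  rw [ddbarV_eq_ddbarL l.contDiff.contDiffAt, this]
  simp

lemma ddbarV_const (c : ℝ) (z : V) : ddbarV (fun _ : V => c) z = 0 := by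
  rw [ddbarV_eq_ddbarL contDiff_const.contDiffAt]
  simp [fderiv_fun_const]

/-- A holomorphic map has a complex bilinear second differential. -/
lemma fderiv2_restrictScalars_I {f : V → W} {z : V} (hf : ContDiffAt ℂ 2 f z) (v w : V) :
    fderiv ℝ (fderiv ℝ f) z v (Complex.I • w) = Complex.I • fderiv ℝ (fderiv ℝ f) z v w := by
  have h1 : fderiv ℝ f =ᶠ[𝓝 z] fun p => (fderiv ℂ f p).restrictScalars ℝ := by
    filter_upwards [hf.eventually (by simp)] with p hp
    exact (hp.differentiableAt (by simp)).fderiv_restrictScalars ℝ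
  have hd : DifferentiableAt ℂ (fderiv ℂ f) z :=
    (hf.fderiv_right (m := 1) (by norm_num)).differentiableAt one_ne_zero
  have h2 : HasFDerivAt (fun p => (fderiv ℂ f p).restrictScalars ℝ)
      ((ContinuousLinearMap.restrictScalarsL ℂ V W ℝ ℝ) ∘L
        ((fderiv ℂ (fderiv ℂ f) z).restrictScalars ℝ)) z :=
    (ContinuousLinearMap.restrictScalarsL ℂ V W ℝ ℝ).hasFDerivAt.comp z
      (hd.hasFDerivAt.restrictScalars ℝ)
  rw [h1.fderiv_eq, h2.fderiv]
  simp

lemma fderiv_restrictScalars_I {f : V → W} {z : V} (hf : DifferentiableAt ℂ f z) (v : V) :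
    fderiv ℝ f z (Complex.I • v) = Complex.I • fderiv ℝ f z v := by
  rw [hf.fderiv_restrictScalars ℝ]; simp

lemma fderiv2_comp {E F : Type*} [NormedAddCommGroup E] [NormedSpace ℝ E]
    [NormedAddCommGroup F] [NormedSpace ℝ F] {u : F → ℝ} {f : E → F} {z : E}
    (hu : ContDiffAt ℝ 2 u (f z)) (hf : ContDiffAt ℝ 2 f z) (v w : E) :
    fderiv ℝ (fderiv ℝ (u ∘ f)) z v w =
      fderiv ℝ (fderiv ℝ u) (f z) (fderiv ℝ f z v) (fderiv ℝ f z w)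
        + fderiv ℝ u (f z) (fderiv ℝ (fderiv ℝ f) z v w) := by
  have h1 : fderiv ℝ (u ∘ f) =ᶠ[𝓝 z] fun p => (fderiv ℝ u (f p)) ∘L (fderiv ℝ f p) := by
    filter_upwards [hf.eventually (by simp),
      hf.continuousAt.eventually (hu.eventually (by simp))] with p hp hp'
    exact fderiv_comp p (hp'.differentiableAt (by simp)) (hp.differentiableAt (by simp))
  have h2 : HasFDerivAt (fun p => fderiv ℝ u (f p))
      ((fderiv ℝ (fderiv ℝ u) (f z)) ∘L (fderiv ℝ f z)) z :=
    hu.differentiableAt_fderiv.hasFDerivAt.comp z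
      (hf.differentiableAt (by simp)).hasFDerivAt
  rw [h1.fderiv_eq, (h2.clm_comp hf.differentiableAt_fderiv.hasFDerivAt).fderiv]
  simp [add_comm]

/-- The second derivative of `u ∘ f` contains the extra term `du(D²f)`. It cancels in the
antisymmetrisation because `D²f` is symmetric and complex bilinear. -/
lemma ddbarV_comp {u : W → ℝ} {f : V → W} {z : V}
    (hu : ContDiffAt ℝ 2 u (f z)) (hf : ContDiffAt ℂ 2 f z) :
    ddbarV (u ∘ f) z = (ddbarV u (f z)).compContinuousLinearMap (fderiv ℝ f z) := by
  have hfr : ContDiffAt ℝ 2 f z := hf.restrict_scalars ℝ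
  refine form2_ext fun v w => ?_
  rw [form2_comp_apply, ddbarV_apply (hu.comp z hfr), ddbarV_apply hu, fderiv2_comp hu hfr,
    fderiv2_comp hu hfr, fderiv2_restrictScalars_I hf, fderiv2_restrictScalars_I hf,
    (hfr.isSymmSndFDerivAt (by simp)).eq v w,
    fderiv_restrictScalars_I (hf.differentiableAt (by simp)),
    fderiv_restrictScalars_I (hf.differentiableAt (by simp))]
  ring

/-- `log |g|²` is pluriharmonic: it is locally twice the real part of a holomorphic logarithm.
Dividing by the constant `g z` moves the values near `1`, inside the domain of the principal branch.
-/
lemma ddbarV_log_norm_sq {g : V → ℂ} {z : V} (hg : ContDiffAt ℂ 2 g z) (h0 : g z ≠ 0) :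
    ddbarV (fun p => Real.log (‖g p‖ ^ 2)) z = 0 := by
  have hs : g z * (g z)⁻¹ ∈ Complex.slitPlane := by rw [mul_inv_cancel₀ h0]; simp
  have hf : ContDiffAt ℂ 2 (fun p => Complex.log (g p * (g z)⁻¹)) z :=
    ContDiffAt.comp (g := Complex.log) z (Complex.contDiffAt_log hs) (hg.mul contDiffAt_const)
  have h1 : (fun p => Real.log (‖g p‖ ^ 2)) =ᶠ[𝓝 z]
      fun p => Real.log (‖g z‖ ^ 2) +
        ((2 : ℝ) • Complex.reCLM) (Complex.log (g p * (g z)⁻¹)) := by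
    filter_upwards [hg.continuousAt.eventually_ne h0] with p hp
    have h2 : ‖g p‖ ≠ 0 := by simpa using hp
    have h3 : ‖g z‖ ≠ 0 := by simpa using h0
    simp only [smul_apply, Complex.reCLM_apply, Complex.log_re, norm_mul,
      norm_inv, smul_eq_mul, Real.log_pow, Real.log_mul h2 (inv_ne_zero h3), Real.log_inv]
    push_cast
    ring
  have h4 : ContDiffAt ℝ 2 (((2 : ℝ) • Complex.reCLM : ℂ →L[ℝ] ℝ) ∘
      fun p => Complex.log (g p * (g z)⁻¹)) z :=
    (ContinuousLinearMap.contDiff _).contDiffAt.comp z (hf.restrict_scalars ℝ)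
  rw [ddbarV_congr h1]
  have h5 := ddbarV_add (u := fun _ => Real.log (‖g z‖ ^ 2)) contDiffAt_const h4
  have h6 := ddbarV_comp (u := ((2 : ℝ) • Complex.reCLM : ℂ →L[ℝ] ℝ)) (z := z)
    (ContinuousLinearMap.contDiff _).contDiffAt hf
  rw [ddbarV_const, h6, ddbarV_clm] at h5
  refine h5.trans ?_
  ext; simp

/-- The form `i ∂t ∧ ∂̄t`. -/
lemma ddbarV_real_comp {F : ℝ → ℝ} {t : V → ℝ} {z : V} (hF : ContDiffAt ℝ 2 F (t z))
    (ht : ContDiffAt ℝ 2 t z) (v w : V) :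
    ddbarV (F ∘ t) z ![v, w] = deriv F (t z) * ddbarV t z ![v, w] +
      deriv (deriv F) (t z) * (-(1 / 2) * (fderiv ℝ t z v * fderiv ℝ t z (Complex.I • w)
        - fderiv ℝ t z w * fderiv ℝ t z (Complex.I • v))) := by
  have e (x : ℝ) : fderiv ℝ F (t z) x = deriv F (t z) * x := by
    rw [fderiv_eq_smul_deriv]; simp [mul_comm]
  have h1 : ∀ x y : ℝ, fderiv ℝ (fderiv ℝ F) (t z) x y = deriv (deriv F) (t z) * (x * y) := by
    intro x y
    have h2 : deriv F = fun s => ContinuousLinearMap.apply ℝ ℝ (1 : ℝ) (fderiv ℝ F s) := by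
      ext; simp
    have h3 : deriv (deriv F) (t z) = fderiv ℝ (fderiv ℝ F) (t z) 1 1 := by
      rw [h2]
      have := ((ContinuousLinearMap.apply ℝ ℝ (1 : ℝ)).hasFDerivAt.comp_hasDerivAt (t z)
        (hF.differentiableAt_fderiv.hasFDerivAt.hasDerivAt)).deriv
      simpa [Function.comp_def] using this
    have hx : x = x • (1 : ℝ) := by simp
    have hy : y = y • (1 : ℝ) := by simp
    rw [h3, hx, map_smul, smul_apply, hy, map_smul]
    simp only [smul_eq_mul]; ring
  rw [ddbarV_apply (hF.comp z ht), ddbarV_apply ht, fderiv2_comp hF ht, fderiv2_comp hF ht,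
    h1, h1, e, e]
  ring

/-- Contraction of `i∂∂̄u` with the linear vector field `L`, for `u` invariant under the flow of
`i L`. -/
lemma extDeriv_curryLeft_ddbarV {u : V → ℝ} {z : V} (hu : ContDiffAt ℝ 3 u z) (L : V →L[ℂ] V)
    (hL : ∀ᶠ p in 𝓝 z, fderiv ℝ u p (Complex.I • L p) = 0) :
    extDeriv (fun p => (ddbarV u p).curryLeft (L p)) z =
      ddbarV (fun p => fderiv ℝ u p (L p)) z := by
  rw [ddbarV_eq]
  refine Filter.EventuallyEq.extDeriv_eq ?_
  have hcd : ∀ᶠ p in 𝓝 z, ContDiffAt ℝ 3 u p := hu.eventually (by simp)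
  filter_upwards [hcd, hL.eventually_nhds] with p hp hpL
  have hp2 : ContDiffAt ℝ 2 u p := hp.of_le (by norm_num)
  have hd := hp2.differentiableAt_fderiv.hasFDerivAt
  have h1 : HasFDerivAt (fun p => fderiv ℝ u p (L p)) _ p :=
    hd.clm_apply (L.hasFDerivAt.restrictScalars ℝ)
  have h2 : HasFDerivAt (fun p => fderiv ℝ u p (Complex.I • L p)) _ p :=
    hd.clm_apply ((L.hasFDerivAt.restrictScalars ℝ).const_smul Complex.I)
  have h3 : fderiv ℝ (fun p => fderiv ℝ u p (Complex.I • L p)) p = 0 := by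
    rw [Filter.EventuallyEq.fderiv_eq (f := fun _ => (0 : ℝ)) hpL]; simp
  rw [h2.fderiv] at h3
  ext v
  change (ddbarV u p).curryLeft (L p) v = dcV (fun p => fderiv ℝ u p (L p)) p v
  -- Differentiating `du(iL) = 0` in the direction `v` gives `D²u(v, iL) = -du(iLv)`, precisely the
  -- discrepancy between the two sides.
  have h4 := congrArg (fun l : V →L[ℝ] ℝ => l (v 0)) h3
  have hv : Matrix.vecCons (L p) v = ![L p, v 0] := by
    ext i; fin_cases i <;> rfl
  rw [ContinuousAlternatingMap.curryLeft_apply_apply, hv, ddbarV_apply hp2, dcV_apply, h1.fderiv]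
  simp only [add_apply, ContinuousLinearMap.comp_apply,
    ContinuousLinearMap.coe_restrictScalars', ContinuousLinearMap.flip_apply,
    zero_apply, smul_apply, map_smul] at h4 ⊢
  rw [fderiv2_symm hp2 (L p)]
  linarith

/-- Joint smoothness in a parameter and the point; this is what makes the family of solitons smooth
in `μ`. -/
lemma contDiffAt_ddbarV_param {P : Type*} [NormedAddCommGroup P] [NormedSpace ℝ P]
    {u : P → V → ℝ} {p : P} {z : V} (hu : ContDiffAt ℝ ∞ (Function.uncurry u) (p, z)) :
    ContDiffAt ℝ ∞ (fun q : P × V => ddbarV (u q.1) q.2) (p, z) := by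
  have h1 : ContDiffAt ℝ ∞ (fun q : P × V => fderiv ℝ (u q.1) q.2) (p, z) := by
    refine ContDiffAt.fderiv (n := ∞) (f := fun q : P × V => u q.1) (g := Prod.snd) ?_
      contDiffAt_snd (by simp)
    exact ContDiffAt.comp (g := Function.uncurry u) ((p, z), z) hu
      ((contDiffAt_fst.comp _ contDiffAt_fst).prodMk contDiffAt_snd)
  have h2 : ContDiffAt ℝ ∞ (fun q : P × V => fderiv ℝ (fderiv ℝ (u q.1)) q.2) (p, z) := by
    refine ContDiffAt.fderiv (n := ∞) (f := fun q : P × V => fderiv ℝ (u q.1)) (g := Prod.snd) ?_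
      contDiffAt_snd (by simp)
    exact ContDiffAt.comp (g := fun q : P × V => fderiv ℝ (u q.1) q.2) ((p, z), z) h1
      ((contDiffAt_fst.comp _ contDiffAt_fst).prodMk contDiffAt_snd)
  refine (ddbarL.contDiff.contDiffAt.comp (p, z) h2).congr_of_eventuallyEq ?_
  have h3 : ∀ᶠ q in 𝓝 (p, z), ContDiffAt ℝ 2 (Function.uncurry u) q :=
    (hu.of_le two_le_infty).eventually (by simp)
  filter_upwards [h3] with q hq
  refine ddbarV_eq_ddbarL ?_
  exact ContDiffAt.comp (g := Function.uncurry u) q.2 hq (contDiffAt_const.prodMk contDiffAt_id)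

lemma contDiffAt_ddbarV {u : V → ℝ} {z : V} (hu : ContDiffAt ℝ ∞ u z) :
    ContDiffAt ℝ ∞ (ddbarV u) z := by
  have := contDiffAt_ddbarV_param (P := ℝ) (u := fun _ => u) (p := 0) (z := z)
    (hu.comp (0, z) contDiffAt_snd)
  exact ContDiffAt.comp (g := fun q : ℝ × V => ddbarV u q.2) z this
    (contDiffAt_const.prodMk contDiffAt_id)

lemma contDiffAt_dcV {u : V → ℝ} {z : V} (hu : ContDiffAt ℝ ∞ u z) :
    ContDiffAt ℝ ∞ (dcV u) z :=
  (ContinuousLinearMap.contDiff (dcL (V := V))).contDiffAt.comp z (hu.fderiv_right (m := ∞) (by simp))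

lemma extDeriv_ddbarV {u : V → ℝ} {z : V} (hu : ContDiffAt ℝ ∞ u z) :
    extDeriv (ddbarV u) z = 0 :=
  extDeriv_extDeriv_apply (r := ∞) (contDiffAt_dcV hu) (by simpa using two_le_infty)

end LocalCalculus

/-! ### Hermitian matrices of (1,1)-forms and their determinants. -/

section HermitianAlgebra

open Matrix ComplexOrder

set_option synthInstance.maxHeartbeats 200000

variable {V : Type*} [NormedAddCommGroup V] [NormedSpace ℂ V]
  {W : Type*} [NormedAddCommGroup W] [NormedSpace ℂ W]

/-- Invariance of a real 2-form under the complex structure. -/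
def InvI (α : V [⋀^Fin 2]→L[ℝ] ℝ) : Prop :=
  ∀ v w : V, α ![Complex.I • v, Complex.I • w] = α ![v, w]

lemma InvI.add {α β : V [⋀^Fin 2]→L[ℝ] ℝ} (hα : InvI α) (hβ : InvI β) : InvI (α + β) :=
  fun v w => by simp [hα v w, hβ v w]

lemma InvI.smul {α : V [⋀^Fin 2]→L[ℝ] ℝ} (hα : InvI α) (c : ℝ) : InvI (c • α) :=
  fun v w => by simp [hα v w]

lemma InvI.comp {α : W [⋀^Fin 2]→L[ℝ] ℝ} (hα : InvI α) (T : V →L[ℂ] W) :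
    InvI (α.compContinuousLinearMap (T.restrictScalars ℝ)) := fun v w => by
  simp only [form2_comp_apply, ContinuousLinearMap.coe_restrictScalars', map_smul]
  exact hα _ _

lemma InvI.left {α : V [⋀^Fin 2]→L[ℝ] ℝ} (hα : InvI α) (v w : V) :
    α ![Complex.I • v, w] = - α ![v, Complex.I • w] := by
  rw [← hα v, smul_smul, Complex.I_mul_I, neg_one_smul, form2_neg_right, neg_neg]

/-- The Hermitian form of a real (1,1)-form. -/
def hermForm (α : V [⋀^Fin 2]→L[ℝ] ℝ) (v w : V) : ℂ :=
  ((α ![v, Complex.I • w] : ℂ) - Complex.I * (α ![v, w] : ℂ)) / 2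

lemma complex_smul_eq (c : ℂ) (v : V) : c • v = c.re • v + c.im • (Complex.I • v) := by
  have : c • v = ((c.re : ℂ) + c.im * Complex.I) • v := by rw [Complex.re_add_im]
  rw [this, add_smul, mul_smul]; simp

lemma InvI.hermForm_smul_left {α : V [⋀^Fin 2]→L[ℝ] ℝ} (hα : InvI α) (c : ℂ) (v w : V) :
    hermForm α (c • v) w = c * hermForm α v w := by
  rw [complex_smul_eq c v]
  simp only [hermForm, form2_add_left, form2_smul_left, hα v w, hα.left v w]
  push_cast
  linear_combination
    (((α ![v, Complex.I • w] : ℂ) - Complex.I * (α ![v, w] : ℂ)) / 2) * (Complex.re_add_im c) +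
    ((c.im : ℂ) * (α ![v, w] : ℂ) / 2) * Complex.I_mul_I

lemma InvI.hermForm_symm {α : V [⋀^Fin 2]→L[ℝ] ℝ} (hα : InvI α) (v w : V) :
    (starRingEnd ℂ) (hermForm α v w) = hermForm α w v := by
  have h1 : α ![w, Complex.I • v] = α ![v, Complex.I • w] := by
    rw [form2_swap, hα.left, neg_neg]
  simp only [hermForm, h1, form2_swap α w v, map_div₀, map_sub, map_mul, Complex.conj_ofReal,
    Complex.conj_I, Complex.conj_ofNat]
  push_cast
  ring

/-- The Hermitian form of a real (1,1)-form, as a sesquilinear map. -/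
def InvI.sesq {α : V [⋀^Fin 2]→L[ℝ] ℝ} (hα : InvI α) : V →ₗ[ℂ] V →ₗ⋆[ℂ] ℂ :=
  LinearMap.mk₂'ₛₗ (RingHom.id ℂ) (starRingEnd ℂ) (hermForm α)
    (fun u v w => by simp only [hermForm, form2_add_left]; push_cast; ring)
    (fun c v w => hα.hermForm_smul_left c v w)
    (fun u v w => by
      simp only [hermForm, form2_add_right, smul_add]; push_cast; ring)
    (fun c v w => by
      rw [← hα.hermForm_symm, hα.hermForm_smul_left, map_mul, hα.hermForm_symm]; rfl)

lemma InvI.sesq_apply {α : V [⋀^Fin 2]→L[ℝ] ℝ} (hα : InvI α) (v w : V) :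
    hα.sesq v w = hermForm α v w := rfl

lemma hermForm_self {α : V [⋀^Fin 2]→L[ℝ] ℝ} (v : V) :
    hermForm α v v = ((α ![v, Complex.I • v] / 2 : ℝ) : ℂ) := by
  simp [hermForm, form2_self]

/-- The matrix of the Hermitian form of `α` in a family of vectors. -/
def hermMatrixOf {ι : Type*} (b : ι → V) (α : V [⋀^Fin 2]→L[ℝ] ℝ) : Matrix ι ι ℂ :=
  Matrix.of fun j k => hermForm α (b j) (b k)

lemma hermMatrix_eq [FiniteDimensional ℂ V] (α : V [⋀^Fin 2]→L[ℝ] ℝ) :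
    hermMatrix α = hermMatrixOf (Module.finBasis ℂ V) α := rfl

lemma hermMatrix_add_smul [FiniteDimensional ℂ V] (α β : V [⋀^Fin 2]→L[ℝ] ℝ) (s : ℝ) :
    hermMatrix (α + s • β) = hermMatrix α + (s : ℂ) • hermMatrix β := by
  ext j k
  simp [hermMatrix]
  ring

/-- The change of basis formula `Tᵗ G T̄`; the conjugate falls on the right because the Hermitian
form is linear in its first argument. -/
lemma hermMatrixOf_comp {ι κ : Type*} [Fintype ι] [Fintype κ] [DecidableEq ι]
    (b : Module.Basis ι ℂ V) (c : Module.Basis κ ℂ W) {α : W [⋀^Fin 2]→L[ℝ] ℝ} (hα : InvI α)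
    (T : V →L[ℂ] W) :
    hermMatrixOf b (α.compContinuousLinearMap (T.restrictScalars ℝ)) =
      (LinearMap.toMatrix b c T)ᵀ * hermMatrixOf c α * (LinearMap.toMatrix b c T).map star := by
  ext j k
  have h1 : hermMatrixOf b (α.compContinuousLinearMap (T.restrictScalars ℝ)) j k =
      hα.sesq (T (b j)) (T (b k)) := by
    simp only [hermMatrixOf, hermForm, form2_comp_apply, hα.sesq_apply, Matrix.of_apply,
      ContinuousLinearMap.coe_restrictScalars', map_smul]
  rw [h1, ← c.sum_repr (T (b j)), ← c.sum_repr (T (b k))]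
  simp only [map_sum, LinearMap.sum_apply, LinearMap.map_smulₛₗ, LinearMap.smul_apply,
    hα.sesq_apply, Matrix.mul_apply, Matrix.transpose_apply, LinearMap.toMatrix_apply,
    Matrix.map_apply, hermMatrixOf, Matrix.of_apply, smul_eq_mul, Finset.sum_mul, RingHom.id_apply]
  simp only [Finset.mul_sum]
  refine Finset.sum_congr rfl fun a _ => Finset.sum_congr rfl fun a' _ => ?_
  simp only [ContinuousLinearMap.coe_coe, RCLike.star_def]
  ring

lemma det_map_star {ι : Type*} [Fintype ι] [DecidableEq ι] (M : Matrix ι ι ℂ) :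
    (M.map star).det = star M.det := by
  simpa [RingHom.mapMatrix_apply] using ((starRingEnd ℂ).map_det M).symm

lemma mul_star_eq_norm_sq (z : ℂ) : z * star z = ((‖z‖ ^ 2 : ℝ) : ℂ) := by
  rw [RCLike.star_def, Complex.mul_conj, Complex.normSq_eq_norm_sq]

/-- A complex linear change of coordinates multiplies the determinant by `|det T|²`. Hence quotients
of such determinants do not depend on the chart. -/
lemma det_hermMatrix_comp [FiniteDimensional ℂ V] {α : V [⋀^Fin 2]→L[ℝ] ℝ} (hα : InvI α)
    (T : V →L[ℂ] V) :
    (hermMatrix (α.compContinuousLinearMap (T.restrictScalars ℝ))).det =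
      ((‖LinearMap.det (T : V →ₗ[ℂ] V)‖ ^ 2 : ℝ) : ℂ) * (hermMatrix α).det := by
  rw [hermMatrix_eq, hermMatrix_eq, hermMatrixOf_comp _ (Module.finBasis ℂ V) hα, det_mul, det_mul,
    det_transpose, det_map_star, LinearMap.det_toMatrix, ← mul_star_eq_norm_sq]
  ring

lemma hermMatrixOf_isHermitian {ι : Type*} (b : ι → V) {α : V [⋀^Fin 2]→L[ℝ] ℝ} (hα : InvI α) :
    (hermMatrixOf b α).IsHermitian := by
  ext j k
  simp only [hermMatrixOf, Matrix.conjTranspose_apply, Matrix.of_apply]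
  exact hα.hermForm_symm _ _

lemma det_hermMatrix_pos [FiniteDimensional ℂ V] {α : V [⋀^Fin 2]→L[ℝ] ℝ} (hα : InvI α)
    (hpos : ∀ v, v ≠ 0 → 0 < α ![v, Complex.I • v]) : 0 < (hermMatrix α).det := by
  refine Matrix.PosDef.det_pos ?_
  rw [hermMatrix_eq]
  set b := Module.finBasis ℂ V
  refine Matrix.PosDef.of_dotProduct_mulVec_pos (hermMatrixOf_isHermitian _ hα) fun x hx => ?_
  -- The coefficients are conjugated since the Hermitian form is linear in the first variable, while
  -- `star x` multiplies the row index.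
  have h1 : star x ⬝ᵥ (hermMatrixOf b α *ᵥ x) =
      hα.sesq (∑ j, star (x j) • b j) (∑ j, star (x j) • b j) := by
    simp only [map_sum, LinearMap.sum_apply, LinearMap.map_smulₛₗ, LinearMap.smul_apply,
      hα.sesq_apply, dotProduct, Matrix.mulVec, hermMatrixOf, Matrix.of_apply, smul_eq_mul,
      RingHom.id_apply, Finset.mul_sum, Pi.star_apply]
    rw [Finset.sum_comm]
    refine Finset.sum_congr rfl fun a _ => Finset.sum_congr rfl fun a' _ => ?_
    simp
    ring
  rw [h1, hα.sesq_apply, hermForm_self]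
  have h2 : ∑ j, star (x j) • b j ≠ 0 := by
    intro h
    apply hx
    ext j
    have := Fintype.linearIndependent_iff.1 b.linearIndependent _ h j
    simpa using this
  exact_mod_cast half_pos (hpos _ h2)

lemma re_pos_of_pos {z : ℂ} (h : 0 < z) : 0 < z.re := (Complex.pos_iff.1 h).1

/-- For `s ≠ 0` write `1 + sM = -s(-s⁻¹ - M)` and evaluate the characteristic polynomial, which
splits over `ℂ`, at `-s⁻¹`. -/
lemma det_one_add_smul {n : Type*} [Fintype n] [DecidableEq n] (M : Matrix n n ℂ) (s : ℂ) :
    (1 + s • M).det = (M.charpoly.roots.map fun β => 1 + s * β).prod := by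
  rcases eq_or_ne s 0 with rfl | hs
  · simp
  have hsp : M.charpoly.Splits := IsAlgClosed.splits _
  have h1 : 1 + s • M = (-s) • (Matrix.scalar n (-s⁻¹) - M) := by
    ext i j
    by_cases hij : i = j
    · subst hij; simp [Matrix.scalar_apply]; field_simp; ring
    · simp [Matrix.scalar_apply, hij]
  have hcard : M.charpoly.roots.card = Fintype.card n := by
    rw [← hsp.natDegree_eq_card_roots, Matrix.charpoly_natDegree_eq_dim]
  rw [h1, det_smul, ← Matrix.eval_charpoly, hsp.eval_eq_prod_roots,
    (Matrix.charpoly_monic M).leadingCoeff, one_mul, ← hcard]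
  have h2 : ∀ t : Multiset ℂ, (-s) ^ t.card * (t.map fun a => -s⁻¹ - a).prod =
      (t.map fun β => 1 + s * β).prod := by
    intro t
    induction t using Multiset.induction with
    | empty => simp
    | cons a t ih =>
      simp only [Multiset.card_cons, Multiset.map_cons, Multiset.prod_cons, ← ih, pow_succ]
      field_simp
      ring
  exact h2 _

/-- The determinant of `η + s α` in terms of the relative eigenvalues of `α`. -/
lemma det_hermMatrix_add_smul [FiniteDimensional ℂ V] (η α : V [⋀^Fin 2]→L[ℝ] ℝ)
    (h : (hermMatrix η).det ≠ 0) (s : ℝ) :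
    (hermMatrix (η + s • α)).det =
      (hermMatrix η).det * ((relEigenvalues η α).map fun β => 1 + (s : ℂ) * β).prod := by
  rw [hermMatrix_add_smul, relEigenvalues, ← det_one_add_smul, ← det_mul, mul_add, mul_one,
    Matrix.mul_smul, ← Matrix.mul_assoc, Matrix.mul_nonsing_inv _ (Ne.isUnit h), Matrix.one_mul]

/-- The determinant of `q^* α + φ i a ∧ ā`, where `a = a₀ + l ∘ q`. -/
lemma exists_det_hermMatrix_add_wedge [FiniteDimensional ℂ V] [FiniteDimensional ℂ W]
    (hdim : Module.finrank ℂ V = Module.finrank ℂ W + 1) :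
    ∃ N : (V →L[ℂ] W) → (V →L[ℂ] ℂ) →
        Matrix (Fin (Module.finrank ℂ W) ⊕ Unit) (Fin (Module.finrank ℂ W) ⊕ Unit) ℂ,
      (∀ i j, ∃ l : (V →L[ℂ] W) × (V →L[ℂ] ℂ) →L[ℂ] ℂ, ∀ q a, N q a i j = l (q, a)) ∧
      ∀ (η : V [⋀^Fin 2]→L[ℝ] ℝ) (α : W [⋀^Fin 2]→L[ℝ] ℝ) (q : V →L[ℂ] W) (a a₀ : V →L[ℂ] ℂ)
        (l : W →L[ℂ] ℂ) (φ : ℝ), InvI α → a = a₀ + l ∘L q →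
        (∀ v w, η ![v, w] = α ![q v, q w] + φ * (2 * ((starRingEnd ℂ) (a v) * a w).im)) →
        (hermMatrix η).det = ((‖(N q a₀).det‖ ^ 2 * φ : ℝ) : ℂ) * (hermMatrix α).det := by
  let b := Module.finBasis ℂ V
  let c := Module.finBasis ℂ W
  let e : Fin (Module.finrank ℂ W) ⊕ Unit ≃ Fin (Module.finrank ℂ V) :=
    (Equiv.optionEquivSumPUnit _).symm.trans ((finSuccEquiv _).symm.trans (finCongr hdim.symm))
  let R : (V →L[ℂ] W) → (V →L[ℂ] ℂ) →
      Matrix (Fin (Module.finrank ℂ W) ⊕ Unit) (Fin (Module.finrank ℂ V)) ℂ := fun q a =>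
    Matrix.fromRows (LinearMap.toMatrix b c q) (Matrix.of fun _ k => a (b k))
  refine ⟨fun q a => (R q a).submatrix id e, ?_, ?_⟩
  · rintro (i | i) j
    · refine ⟨LinearMap.toContinuousLinearMap (c.coord i) ∘L
        (ContinuousLinearMap.apply ℂ W (b (e j))) ∘L ContinuousLinearMap.fst _ _ _, fun q a => ?_⟩
      simp [R, LinearMap.toMatrix_apply]
    · refine ⟨(ContinuousLinearMap.apply ℂ ℂ (b (e j))) ∘L ContinuousLinearMap.snd _ _ _,
        fun q a => ?_⟩
      simp [R]
  intro η α q a a₀ l φ hα ha hη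
  let P : Matrix (Fin (Module.finrank ℂ W) ⊕ Unit) (Fin (Module.finrank ℂ W) ⊕ Unit) ℂ :=
    Matrix.fromBlocks 1 0 (Matrix.of fun _ k => l (c k)) 1
  let D : Matrix (Fin (Module.finrank ℂ W) ⊕ Unit) (Fin (Module.finrank ℂ W) ⊕ Unit) ℂ :=
    Matrix.fromBlocks (hermMatrixOf c α) 0 0 (Matrix.of fun _ _ => (φ : ℂ))
  -- Passing from `a₀` to `a = a₀ + l ∘ q` is a row operation with unipotent matrix, so the
  -- determinant only sees `a₀`. In the application `a₀` depends holomorphically on the point and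
  -- `a` does not.
  have hR : R q a = P * R q a₀ := by
    simp only [R, P, Matrix.fromBlocks_mul_fromRows, Matrix.one_mul, Matrix.zero_mul, add_zero]
    congr 1
    ext i k
    have h0 : a (b k) = a₀ (b k) + l (q (b k)) := by rw [ha]; rfl
    simp only [h0, Matrix.of_apply, Matrix.add_apply, Matrix.mul_apply]
    have h9 : l (q (b k)) = ∑ x, l (c x) * c.repr (q (b k)) x := by
      conv_lhs => rw [← c.sum_repr (q (b k)), map_sum]
      simp only [map_smul, smul_eq_mul, mul_comm]
    rw [h9]
    simp [LinearMap.toMatrix_apply, add_comm]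
  -- In the coframe `(q, a)` the form is block diagonal with blocks `α` and `φ`; `R q a` is the
  -- matrix of `v ↦ (q v, a v)`.
  have hη' : hermMatrixOf b η = (R q a)ᵀ * D * (R q a).map star := by
    have h1 : (R q a)ᵀ * D * (R q a).map star =
        (LinearMap.toMatrix b c q)ᵀ * hermMatrixOf c α * (LinearMap.toMatrix b c q).map star +
        (Matrix.of fun (_ : Unit) k => a (b k))ᵀ * (Matrix.of fun (_ _ : Unit) => (φ : ℂ)) *
          (Matrix.of fun (_ : Unit) k => a (b k)).map star := by
      simp only [R, D, Matrix.transpose_fromRows, Matrix.fromCols_mul_fromBlocks, Matrix.mul_zero,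
        add_zero, zero_add]
      have : ∀ (X : Matrix (Fin (Module.finrank ℂ W)) (Fin (Module.finrank ℂ V)) ℂ)
        (Y : Matrix Unit (Fin (Module.finrank ℂ V)) ℂ), (Matrix.fromRows X Y).map star =
          Matrix.fromRows (X.map star) (Y.map star) := by
        intro X Y; ext (i | i) j <;> rfl
      rw [this, Matrix.fromCols_mul_fromRows]
    rw [h1, ← hermMatrixOf_comp b c hα]
    ext j k
    simp only [hermMatrixOf, hermForm, Matrix.of_apply, Matrix.add_apply, hη, form2_comp_apply,
      Matrix.mul_apply, Finset.univ_unique, Finset.sum_singleton, Matrix.transpose_apply,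
      Matrix.map_apply, map_smul, ContinuousLinearMap.coe_restrictScalars', smul_eq_mul]
    have h2 : ∀ x y : ℂ, (((2 * ((starRingEnd ℂ) x * (Complex.I * y)).im : ℝ) : ℂ) -
        Complex.I * ((2 * ((starRingEnd ℂ) x * y).im : ℝ) : ℂ)) / 2 = x * star y := by
      intro x y
      apply Complex.ext <;> simp <;> ring
    rw [mul_comm (a (b j)), mul_assoc, ← h2]
    push_cast
    ring
  have h3 : ((R q a).submatrix id e).det = ((R q a₀).submatrix id e).det := by
    rw [hR, ← Matrix.submatrix_mul_equiv _ _ id (Equiv.refl _) e, det_mul]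
    have : (P.submatrix id (Equiv.refl _)).det = 1 := by
      change P.det = 1
      simp [P]
    rw [this, one_mul]; rfl
  have h4 : (hermMatrixOf b η).submatrix e e = ((R q a).submatrix id e)ᵀ * D *
      ((R q a).submatrix id e).map star := by
    rw [hη']
    rfl
  rw [hermMatrix_eq, hermMatrix_eq, ← Matrix.det_submatrix_equiv_self e, h4, det_mul, det_mul,
    det_transpose, det_map_star, h3]
  have h5 : D.det = (φ : ℂ) * (hermMatrixOf c α).det := by
    simp [D, mul_comm]
  rw [h5]
  have := mul_star_eq_norm_sq ((R q a₀).submatrix id e).det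
  push_cast at this ⊢
  rw [← this]
  ring

end HermitianAlgebra

/-! ### Smooth dependence of integrals over `[0, 1]` on parameters. -/

section ParametricIntegral

open MeasureTheory

variable {E F : Type} [NormedAddCommGroup E] [NormedSpace ℝ E]
  [NormedAddCommGroup F] [NormedSpace ℝ F]

set_option linter.unusedSectionVars false

lemma continuousOn_slice_of_continuousAt {f : E → ℝ → F} {x : E}
    (hf : ∀ t ∈ Icc (0 : ℝ) 1, ContinuousAt (Function.uncurry f) (x, t)) :
    ContinuousOn (f x) (Icc 0 1) := fun t ht =>
  (ContinuousAt.comp (g := Function.uncurry f) (hf t ht)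
    (continuousAt_const.prodMk continuousAt_id)).continuousWithinAt

/-- Compactness of `[0, 1]` gives one neighbourhood of `x` on which the bound holds for all `t`. The
constant serves as the dominating function below. -/
lemma eventually_norm_le_of_continuousAt {f : E → ℝ → F} {x : E}
    (hf : ∀ t ∈ Icc (0 : ℝ) 1, ContinuousAt (Function.uncurry f) (x, t)) :
    ∃ C : ℝ, ∀ᶠ y in 𝓝 x, ∀ t ∈ Icc (0 : ℝ) 1, ‖f y t‖ ≤ C := by
  obtain ⟨C, hC⟩ := isCompact_Icc.exists_bound_of_continuousOn
    (continuousOn_slice_of_continuousAt hf)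
  refine ⟨C + 1, isCompact_Icc.eventually_forall_of_forall_eventually fun t ht => ?_⟩
  have h1 : ‖Function.uncurry f (x, t)‖ < C + 1 := (hC t ht).trans_lt (by linarith)
  filter_upwards [(hf t ht).norm.eventually_lt_const h1] with z hz
  exact hz.le

variable [CompleteSpace F]

lemma continuousAt_parametric_integral {f : E → ℝ → F} {U : Set E} (hU : IsOpen U)
    (hf : ∀ x ∈ U, ∀ t ∈ Icc (0 : ℝ) 1, ContinuousAt (Function.uncurry f) (x, t))
    {x : E} (hx : x ∈ U) : ContinuousAt (fun x => ∫ t in (0 : ℝ)..1, f x t) x := by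
  obtain ⟨C, hC⟩ := eventually_norm_le_of_continuousAt (hf x hx)
  have hI : uIoc (0 : ℝ) 1 ⊆ Icc 0 1 := by
    rw [uIoc_of_le zero_le_one]; exact Ioc_subset_Icc_self
  refine intervalIntegral.continuousAt_of_dominated_interval (bound := fun _ => C) ?_ ?_ (by simp) ?_
  · filter_upwards [hU.mem_nhds hx] with y hy
    exact ((continuousOn_slice_of_continuousAt (hf y hy)).mono hI).aestronglyMeasurable
      measurableSet_uIoc
  · filter_upwards [hC] with y hy
    exact Eventually.of_forall fun t ht => hy t (hI ht)
  · exact Eventually.of_forall fun t ht => ContinuousAt.comp (g := Function.uncurry f)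
      (f := fun x => (x, t)) (hf x hx t (hI ht)) (continuousAt_id.prodMk continuousAt_const)

lemma contDiffAt_partial_fderiv {n m : ℕ∞ω} {f : E → ℝ → F} {x : E} {t : ℝ}
    (hf : ContDiffAt ℝ n (Function.uncurry f) (x, t)) (hm : m + 1 ≤ n) :
    ContDiffAt ℝ m (Function.uncurry fun y t => fderiv ℝ (fun y => f y t) y) (x, t) := by
  refine ContDiffAt.fderiv (n := n) (f := fun (q : E × ℝ) y => f y q.2) (g := Prod.fst) ?_
    contDiffAt_fst hm
  exact ContDiffAt.comp (g := Function.uncurry f) ((x, t), x) hf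
    (contDiffAt_snd.prodMk (contDiffAt_snd.comp _ contDiffAt_fst))

lemma hasFDerivAt_parametric_integral {f : E → ℝ → F} {U : Set E} (hU : IsOpen U)
    (hf : ∀ x ∈ U, ∀ t ∈ Icc (0 : ℝ) 1, ContDiffAt ℝ 1 (Function.uncurry f) (x, t))
    {x : E} (hx : x ∈ U) : HasFDerivAt (fun x => ∫ t in (0 : ℝ)..1, f x t)
      (∫ t in (0 : ℝ)..1, fderiv ℝ (fun y => f y t) x) x := by
  have hI : uIoc (0 : ℝ) 1 ⊆ Icc 0 1 := by
    rw [uIoc_of_le zero_le_one]; exact Ioc_subset_Icc_self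
  have hg : ∀ x ∈ U, ∀ t ∈ Icc (0 : ℝ) 1, ContinuousAt
      (Function.uncurry fun y t => fderiv ℝ (fun y => f y t) y) (x, t) := fun x hx t ht =>
    (contDiffAt_partial_fderiv (m := 0) (hf x hx t ht) (by simp)).continuousAt
  have hfc : ∀ x ∈ U, ContinuousOn (f x) (Icc 0 1) := fun x hx =>
    continuousOn_slice_of_continuousAt fun t ht => (hf x hx t ht).continuousAt
  obtain ⟨C, hC⟩ := eventually_norm_le_of_continuousAt (hg x hx)
  refine intervalIntegral.hasFDerivAt_integral_of_dominated_of_fderiv_le (𝕜 := ℝ) (μ := volume)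
    (F := f) (F' := fun y t => fderiv ℝ (fun y => f y t) y) (x₀ := x) (a := 0) (b := 1)
    (bound := fun _ => C) (s := {y | ∀ t ∈ Icc (0 : ℝ) 1, ‖fderiv ℝ (fun y => f y t) y‖ ≤ C} ∩ U)
    (Filter.inter_mem hC (hU.mem_nhds hx)) ?_ ?_ ?_ ?_
    intervalIntegrable_const ?_
  · filter_upwards [hU.mem_nhds hx] with y hy
    exact ((hfc y hy).mono hI).aestronglyMeasurable measurableSet_uIoc
  · exact ContinuousOn.intervalIntegrable (by simpa using hfc x hx)
  · exact ((continuousOn_slice_of_continuousAt (hg x hx)).mono hI).aestronglyMeasurable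
      measurableSet_uIoc
  · exact Eventually.of_forall fun t ht y hy => hy.1 t (hI ht)
  · refine Eventually.of_forall fun t ht y hy => DifferentiableAt.hasFDerivAt ?_
    exact DifferentiableAt.comp (g := Function.uncurry f) (f := fun y => (y, t)) y
      ((hf y hy.2 t (hI ht)).differentiableAt one_ne_zero)
      (differentiableAt_id.prodMk (differentiableAt_const _))

/-- Induction on `n`: the derivative is the integral of the partial derivative, of class `C^n`. The
target `F` has to be quantified inside because it becomes `E →L[ℝ] F`. -/
lemma contDiffOn_parametric_integral (n : ℕ) :
    ∀ {F : Type} [NormedAddCommGroup F] [NormedSpace ℝ F] [CompleteSpace F] {f : E → ℝ → F}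
      {U : Set E}, IsOpen U →
      (∀ x ∈ U, ∀ t ∈ Icc (0 : ℝ) 1, ContDiffAt ℝ n (Function.uncurry f) (x, t)) →
      ContDiffOn ℝ n (fun x => ∫ t in (0 : ℝ)..1, f x t) U := by
  induction n with
  | zero =>
    intro F _ _ _ f U hU hf
    exact contDiffOn_zero.2 fun x hx => (continuousAt_parametric_integral hU
      (fun x hx t ht => (hf x hx t ht).continuousAt) hx).continuousWithinAt
  | succ n ih =>
    intro F _ _ _ f U hU hf
    have h1 : ∀ x ∈ U, HasFDerivAt (fun x => ∫ t in (0 : ℝ)..1, f x t)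
      (∫ t in (0 : ℝ)..1, fderiv ℝ (fun y => f y t) x) x := fun x hx =>
      hasFDerivAt_parametric_integral hU
        (fun x hx t ht => (hf x hx t ht).of_le (by push_cast; simp)) hx
    push_cast
    refine (contDiffOn_succ_iff_fderiv_of_isOpen hU).2
      ⟨fun x hx => (h1 x hx).differentiableAt.differentiableWithinAt, by simp, ?_⟩
    refine (ih hU (f := fun x t => fderiv ℝ (fun y => f y t) x) fun x hx t ht =>
      contDiffAt_partial_fderiv (hf x hx t ht) (by push_cast; simp)).congr fun x hx =>
      (h1 x hx).fderiv

/-- An integral over `[0, 1]` depends smoothly on parameters. -/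
lemma contDiffAt_parametric_integral {f : E → ℝ → F} {x : E}
    (hf : ∀ t ∈ Icc (0 : ℝ) 1, ContDiffAt ℝ ∞ (Function.uncurry f) (x, t)) :
    ContDiffAt ℝ ∞ (fun x => ∫ t in (0 : ℝ)..1, f x t) x := by
  refine contDiffAt_infty.2 fun n => ?_
  have h1 : ∀ᶠ y in 𝓝 x, ∀ t ∈ Icc (0 : ℝ) 1, ContDiffAt ℝ n (Function.uncurry f) (y, t) := by
    refine isCompact_Icc.eventually_forall_of_forall_eventually fun t ht => ?_
    exact ((contDiffAt_infty.1 (hf t ht)) n).eventually (by simp)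
  obtain ⟨U, hU, hUo, hxU⟩ := eventually_nhds_iff.1 h1
  exact (contDiffOn_parametric_integral n hUo hU).contDiffAt (hUo.mem_nhds hxU)

end ParametricIntegral

/-! ### The separated momentum equation: `s = Ψ(τ)`. -/

section MomentumProfile

open MeasureTheory Polynomial

/-- The integral `∫_0^1 u^k R(uτ) e^{-μuτ} du`, so that `τ^{k+1} profileS = ∫_0^τ x^k R(x) e^{-μx} dx`. -/
def profileS (k : ℕ) (R : ℝ[X]) (μ τ : ℝ) : ℝ :=
  ∫ u in (0 : ℝ)..1, u ^ k * (R.eval (τ * u) * Real.exp (-μ * (τ * u)))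

lemma contDiff_polynomial_eval (R : ℝ[X]) : ContDiff ℝ ∞ fun x : ℝ => R.eval x := by
  simpa using R.contDiff_aeval (𝕜 := ℝ) ∞

lemma contDiffAt_profileS (k : ℕ) (R : ℝ[X]) (p : ℝ × ℝ) :
    ContDiffAt ℝ ∞ (Function.uncurry (profileS k R)) p := by
  refine contDiffAt_parametric_integral (E := ℝ × ℝ) (F := ℝ)
    (f := fun q u => u ^ k * (R.eval (q.2 * u) * Real.exp (-q.1 * (q.2 * u)))) fun u _ => ?_
  have := contDiff_polynomial_eval R
  refine ContDiff.contDiffAt ?_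
  change ContDiff ℝ ∞ fun z : (ℝ × ℝ) × ℝ =>
    z.2 ^ k * (R.eval (z.1.2 * z.2) * Real.exp (-z.1.1 * (z.1.2 * z.2)))
  fun_prop

/-- Substitution `x = τu`. Pulling out `τ^{k+1}` leaves a factor that is smooth, and positive at `τ
= 0`, so its `(k+1)`-st root causes no trouble there. -/
lemma pow_mul_profileS (k : ℕ) (R : ℝ[X]) (μ τ : ℝ) : τ ^ (k + 1) * profileS k R μ τ =
    ∫ x in (0 : ℝ)..τ, x ^ k * (R.eval x * Real.exp (-μ * x)) := by
  have h := intervalIntegral.mul_integral_comp_mul_left (a := 0) (b := 1) (c := τ)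
    (f := fun x => x ^ k * (R.eval x * Real.exp (-μ * x)))
  rw [mul_zero, mul_one] at h
  rw [← h, pow_succ', mul_assoc, profileS, ← intervalIntegral.integral_const_mul (τ ^ k)]
  congr 1
  refine intervalIntegral.integral_congr fun x _ => ?_
  ring

lemma hasDerivAt_pow_mul_profileS (k : ℕ) (R : ℝ[X]) (μ τ : ℝ) :
    HasDerivAt (fun τ => τ ^ (k + 1) * profileS k R μ τ)
      (τ ^ k * (R.eval τ * Real.exp (-μ * τ))) τ := by
  have hc : Continuous fun x : ℝ => x ^ k * (R.eval x * Real.exp (-μ * x)) := by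
    have := (contDiff_polynomial_eval R).continuous
    fun_prop
  simp_rw [pow_mul_profileS]
  exact intervalIntegral.integral_hasDerivAt_right (hc.intervalIntegrable _ _)
    (hc.stronglyMeasurableAtFilter _ _) hc.continuousAt

lemma profileS_zero (k : ℕ) (R : ℝ[X]) (μ : ℝ) : profileS k R μ 0 = R.eval 0 / (k + 1) := by
  simp only [profileS, zero_mul, mul_zero, Real.exp_zero, mul_one,
    intervalIntegral.integral_mul_const, integral_pow]
  simp
  ring

/-- Positivity is needed slightly to the left of `0` as well, so that `τ = 0` becomes an interior
point for the inverse function argument. -/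
lemma profileS_pos (k : ℕ) {R : ℝ[X]} {ε : ℝ} (hε : 0 < ε) (hR : ∀ x, -ε < x → 0 < R.eval x)
    (μ : ℝ) {τ : ℝ} (hτ : -ε < τ) : 0 < profileS k R μ τ := by
  have hc : Continuous fun u : ℝ => u ^ k * (R.eval (τ * u) * Real.exp (-μ * (τ * u))) := by
    have := (contDiff_polynomial_eval R).continuous
    fun_prop
  refine intervalIntegral.intervalIntegral_pos_of_pos_on (hc.intervalIntegrable _ _) ?_ one_pos
  intro u hu
  have : -ε < τ * u := by
    rcases le_or_gt 0 τ with h | h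
    · exact lt_of_lt_of_le (by linarith) (mul_nonneg h hu.1.le)
    · nlinarith [hu.1, hu.2]
  exact mul_pos (pow_pos hu.1 _) (mul_pos (hR _ this) (Real.exp_pos _))

/-- The function `τ ↦ (∫_0^τ x^k R(x) e^{-μx} dx)^{1/(k+1)}`, extended smoothly to `τ < 0`. -/
def profilePsi (k : ℕ) (R : ℝ[X]) (μ τ : ℝ) : ℝ :=
  τ * profileS k R μ τ ^ (((k : ℝ) + 1)⁻¹)

lemma profilePsi_pow (k : ℕ) {R : ℝ[X]} {μ τ : ℝ} (hS : 0 < profileS k R μ τ) :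
    profilePsi k R μ τ ^ (k + 1) = τ ^ (k + 1) * profileS k R μ τ := by
  rw [profilePsi, mul_pow, ← Real.rpow_natCast (_ ^ _), ← Real.rpow_mul hS.le]
  congr 1
  push_cast
  rw [inv_mul_cancel₀ (by positivity), Real.rpow_one]

lemma contDiffAt_profilePsi (k : ℕ) {R : ℝ[X]} {p : ℝ × ℝ} (hS : 0 < profileS k R p.1 p.2) :
    ContDiffAt ℝ ∞ (Function.uncurry (profilePsi k R)) p :=
  contDiffAt_snd.mul ((contDiffAt_profileS k R p).rpow_const_of_ne hS.ne')

/-- The derivative of `profilePsi` in the variable `τ`. -/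
def profileDer (k : ℕ) (R : ℝ[X]) (μ τ : ℝ) : ℝ :=
  R.eval τ * Real.exp (-μ * τ) / ((k + 1) * (profileS k R μ τ ^ (((k : ℝ) + 1)⁻¹)) ^ k)

/-- For `τ ≠ 0` differentiate `Ψ^{k+1} = τ^{k+1} S` and cancel `τ^k`. At `τ = 0` this is impossible,
and the product rule is used together with `S(0) = R(0)/(k + 1)`. -/
lemma hasDerivAt_profilePsi (k : ℕ) {R : ℝ[X]} {μ τ : ℝ} (hS : 0 < profileS k R μ τ) :
    HasDerivAt (profilePsi k R μ) (profileDer k R μ τ) τ := by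
  have hd : DifferentiableAt ℝ (profileS k R μ) τ :=
    DifferentiableAt.comp (g := Function.uncurry (profileS k R)) (f := fun τ => (μ, τ)) τ
      ((contDiffAt_profileS k R (μ, τ)).differentiableAt (by simp))
      ((differentiableAt_const _).prodMk differentiableAt_id)
  have hd2 : DifferentiableAt ℝ (fun τ => profileS k R μ τ ^ (((k : ℝ) + 1)⁻¹)) τ :=
    hd.rpow_const (Or.inl hS.ne')
  have hd3 : DifferentiableAt ℝ (profilePsi k R μ) τ := differentiableAt_id.mul hd2
  set A := profileS k R μ τ ^ (((k : ℝ) + 1)⁻¹) with hA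
  have hA0 : 0 < A := Real.rpow_pos_of_pos hS _
  have hAk : A ^ (k + 1) = profileS k R μ τ := by
    rw [hA, ← Real.rpow_natCast, ← Real.rpow_mul hS.le]
    push_cast
    rw [inv_mul_cancel₀ (by positivity), Real.rpow_one]
  have hk : (0 : ℝ) < k + 1 := by positivity
  suffices h : profileDer k R μ τ = deriv (profilePsi k R μ) τ by rw [h]; exact hd3.hasDerivAt
  rcases eq_or_ne τ 0 with h0 | h0
  · subst h0
    have : HasDerivAt (profilePsi k R μ) (1 * A + 0 * _) 0 :=
      (hasDerivAt_id (0 : ℝ)).mul hd2.hasDerivAt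
    rw [this.deriv, profileDer, ← hA]
    have h1 : R.eval 0 = (k + 1) * A ^ (k + 1) := by
      rw [hAk, profileS_zero]; field_simp
    rw [h1]
    field_simp
    simp [pow_succ]
  · have hev : (fun τ => profilePsi k R μ τ ^ (k + 1)) =ᶠ[𝓝 τ]
        fun τ => τ ^ (k + 1) * profileS k R μ τ := by
      filter_upwards [hd.continuousAt.eventually_const_lt hS] with x hx
      exact profilePsi_pow k hx
    have h1 := (hd3.hasDerivAt.fun_pow (k + 1)).unique
      ((hasDerivAt_pow_mul_profileS k R μ τ).congr_of_eventuallyEq hev)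
    have h2 : profilePsi k R μ τ = τ * A := rfl
    rw [h2, Nat.add_sub_cancel] at h1
    push_cast at h1
    rw [profileDer, ← hA, div_eq_iff (by positivity)]
    have h3 : τ ^ k ≠ 0 := pow_ne_zero _ h0
    apply mul_left_cancel₀ h3
    rw [← h1]
    ring

lemma exists_pos_of_pos_on_nonneg {R : ℝ[X]} (hR : ∀ x, 0 ≤ x → 0 < R.eval x) :
    ∃ ε, 0 < ε ∧ ∀ x, -ε < x → 0 < R.eval x := by
  have hc := (contDiff_polynomial_eval R).continuous
  obtain ⟨ε, hε, h⟩ := Metric.eventually_nhds_iff.1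
    (hc.continuousAt.eventually_const_lt (hR 0 le_rfl))
  refine ⟨ε, hε, fun x hx => ?_⟩
  rcases le_or_gt 0 x with h0 | h0
  · exact hR x h0
  · refine h ?_
    rw [Real.dist_eq, sub_zero, abs_of_neg h0]; linarith

/-- `Q'/Q` tends to `0` for a polynomial, hence eventually exceeds any negative constant. An
exponential weight thus eventually dominates the polynomial. -/
lemma exists_forall_deriv_ge {Q : ℝ[X]} (hQ : ∀ x, 0 < x → 0 < Q.eval x) {c : ℝ} (hc : c < 0) :
    ∃ a, 0 < a ∧ ∀ x, a ≤ x → c * Q.eval x ≤ Q.derivative.eval x := by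
  have hQ0 : Q ≠ 0 := by rintro rfl; simpa using hQ 1 one_pos
  have h1 := Polynomial.div_tendsto_atTop_zero_of_degree_lt Q.derivative Q
    (Polynomial.degree_derivative_lt hQ0)
  obtain ⟨a, ha⟩ := eventually_atTop.1 (h1.eventually_const_lt hc)
  refine ⟨max a 1, by positivity, fun x hx => ?_⟩
  have hx0 : 0 < Q.eval x := hQ x (lt_of_lt_of_le (by positivity) hx)
  have := ha x ((le_max_left _ _).trans hx)
  rw [lt_div_iff₀ hx0] at this
  exact this.le

end MomentumProfile

/-! ### The inverse function `τ(s)`, its range and its growth. -/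

section MomentumProfile

open MeasureTheory Polynomial

/-- The inverse function of `profilePsi k R μ` on `(-ε, ∞)`. -/
def profileTau (k : ℕ) (R : ℝ[X]) (ε μ s : ℝ) : ℝ :=
  Function.invFunOn (profilePsi k R μ) (Ioi (-ε)) s

section

variable (k : ℕ) {R : ℝ[X]} {ε : ℝ} (hε : 0 < ε) (hR : ∀ x, -ε < x → 0 < R.eval x)
include hε hR

lemma profileDer_pos (μ : ℝ) {τ : ℝ} (hτ : -ε < τ) : 0 < profileDer k R μ τ := by
  have := profileS_pos k hε hR μ hτ
  have := hR τ hτ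
  rw [profileDer]
  positivity

lemma strictMonoOn_profilePsi (μ : ℝ) : StrictMonoOn (profilePsi k R μ) (Ioi (-ε)) := by
  refine strictMonoOn_of_deriv_pos (convex_Ioi _) (fun τ hτ =>
    (hasDerivAt_profilePsi k (profileS_pos k hε hR μ hτ)).continuousAt.continuousWithinAt) ?_
  intro τ hτ
  rw [interior_Ioi] at hτ
  rw [(hasDerivAt_profilePsi k (profileS_pos k hε hR μ hτ)).deriv]
  exact profileDer_pos k hε hR μ hτ

lemma profileTau_profilePsi (μ : ℝ) {τ : ℝ} (hτ : -ε < τ) :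
    profileTau k R ε μ (profilePsi k R μ τ) = τ :=
  (strictMonoOn_profilePsi k hε hR μ).injOn.leftInvOn_invFunOn hτ

/-- The implicit function theorem for `Ψ(μ, τ) - s`, whose `τ`-derivative is positive, gives
smoothness in `(μ, s)` jointly. Injectivity of `Ψ` on `(-ε, ∞)` identifies the implicit function
with the inverse chosen globally. -/
lemma contDiffAt_profileTau (μ : ℝ) {τ : ℝ} (hτ : -ε < τ) :
    ContDiffAt ℝ ∞ (Function.uncurry (profileTau k R ε)) (μ, profilePsi k R μ τ) := by
  have hS := profileS_pos k hε hR μ hτ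
  have hΨ := contDiffAt_profilePsi k (p := (μ, τ)) hS
  let f : (ℝ × ℝ) × ℝ → ℝ := fun z => profilePsi k R z.1.1 z.2 - z.1.2
  let u : (ℝ × ℝ) × ℝ := ((μ, profilePsi k R μ τ), τ)
  have hf : ContDiffAt ℝ ∞ f u := by
    refine ContDiffAt.sub ?_ (contDiffAt_snd.comp _ contDiffAt_fst)
    exact ContDiffAt.comp (g := Function.uncurry (profilePsi k R)) u hΨ
      ((contDiffAt_fst.comp _ contDiffAt_fst).prodMk contDiffAt_snd)
  have hn : (∞ : ℕ∞ω) ≠ 0 := by simp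
  have hinv : (fderiv ℝ f u ∘L .inr ℝ (ℝ × ℝ) ℝ).IsInvertible := by
    have h1 : HasFDerivAt (fun t => f ((μ, profilePsi k R μ τ), t))
        (fderiv ℝ f u ∘L .inr ℝ (ℝ × ℝ) ℝ) τ :=
      HasFDerivAt.comp (g := f) τ (hf.differentiableAt (by simp)).hasFDerivAt
        (hasFDerivAt_prodMk_right _ _)
    -- The partial derivative of `f` in its last variable is multiplication by `Ψ' ≠ 0`, hence
    -- invertible.
    have h2 : HasDerivAt (fun t => f ((μ, profilePsi k R μ τ), t)) (profileDer k R μ τ) τ :=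
      (hasDerivAt_profilePsi k hS).sub_const _
    rw [h1.unique h2.hasFDerivAt]
    refine ⟨ContinuousLinearEquiv.unitsEquivAut ℝ (Units.mk0 _ (profileDer_pos k hε hR μ hτ).ne'),
      ?_⟩
    ext; simp
  have hc : ContDiffAt ℝ ∞ (hf.implicitFunction hn hinv) (μ, profilePsi k R μ τ) :=
    hf.contDiffAt_implicitFunction hn hinv
  refine hc.congr_of_eventuallyEq ?_
  have h0 : hf.implicitFunction hn hinv (μ, profilePsi k R μ τ) = τ :=
    hf.implicitFunction_apply_self hn hinv
  have h1 : ∀ᶠ x in 𝓝 (μ, profilePsi k R μ τ), f (x, hf.implicitFunction hn hinv x) = f u :=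
    hf.eventually_apply_implicitFunction hn hinv
  have h2 : ∀ᶠ x in 𝓝 (μ, profilePsi k R μ τ), -ε < hf.implicitFunction hn hinv x :=
    hc.continuousAt.eventually_const_lt (by rw [h0]; exact hτ)
  filter_upwards [h1, h2] with x hx1 hx2
  have h3 : profilePsi k R x.1 (hf.implicitFunction hn hinv x) = x.2 := by
    have : f u = 0 := sub_self _
    rw [this] at hx1
    exact sub_eq_zero.1 hx1
  change profileTau k R ε x.1 x.2 = _
  rw [← h3, profileTau_profilePsi k hε hR _ hx2]

/-- `Ψ` maps neighbourhoods of `τ` onto neighbourhoods of its image. So the chosen inverse is a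
genuine right inverse near `s`, also for slightly negative `s` when `τ = 0`. -/
lemma eventually_profilePsi_profileTau (μ : ℝ) {τ : ℝ} (hτ : -ε < τ) :
    ∀ᶠ s in 𝓝 (profilePsi k R μ τ), -ε < profileTau k R ε μ s ∧
      profilePsi k R μ (profileTau k R ε μ s) = s := by
  have hS := profileS_pos k hε hR μ hτ
  have hc : ContDiffAt ℝ ∞ (profilePsi k R μ) τ :=
    ContDiffAt.comp (g := Function.uncurry (profilePsi k R)) (f := fun τ => (μ, τ)) τ
      (contDiffAt_profilePsi k (p := (μ, τ)) hS) (contDiffAt_const.prodMk contDiffAt_id)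
  have hd : HasStrictDerivAt (profilePsi k R μ) (profileDer k R μ τ) τ := by
    have := hc.hasStrictDerivAt (by simp)
    rwa [(hasDerivAt_profilePsi k hS).deriv] at this
  rw [← hd.map_nhds_eq (profileDer_pos k hε hR μ hτ).ne', eventually_map]
  filter_upwards [Ioi_mem_nhds hτ] with t ht
  rw [profileTau_profilePsi k hε hR μ ht]
  exact ⟨ht, rfl⟩

/-- For `μ < 0` the integrand `x^k R(x) e^{-μx}` is increasing beyond some `a`, so the integral
grows at least linearly with slope its value at `a`. In particular `Ψ` is unbounded. -/
lemma pow_mul_profileS_ge {μ : ℝ} (hμ : μ < 0) : ∃ a c, 0 < a ∧ 0 < c ∧ ∀ τ, a ≤ τ →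
    c * (τ - a) ≤ τ ^ (k + 1) * profileS k R μ τ := by
  have hQ : ∀ x, 0 < x → 0 < (X ^ k * R).eval x := fun x hx => by
    have := hR x (by linarith)
    simp only [eval_mul, eval_pow, eval_X]; positivity
  obtain ⟨a, ha, hQ'⟩ := exists_forall_deriv_ge hQ hμ
  let G : ℝ → ℝ := fun τ => (X ^ k * R).eval τ * Real.exp (-μ * τ)
  have hG : ∀ τ, HasDerivAt G (((X ^ k * R).derivative.eval τ - μ * (X ^ k * R).eval τ) *
      Real.exp (-μ * τ)) τ := fun τ => by
    refine (((X ^ k * R).hasDerivAt τ).mul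
      (((hasDerivAt_id τ).const_mul (-μ)).exp)).congr_deriv ?_
    simp only [id]; ring
  have hGmono : MonotoneOn G (Ici a) := by
    refine monotoneOn_of_deriv_nonneg (convex_Ici a)
      (fun τ _ => (hG τ).continuousAt.continuousWithinAt)
      (fun τ _ => (hG τ).differentiableAt.differentiableWithinAt) fun τ hτ => ?_
    rw [interior_Ici] at hτ
    rw [(hG τ).deriv]
    exact mul_nonneg (by linarith [hQ' τ (le_of_lt hτ)]) (Real.exp_pos _).le
  refine ⟨a, G a, ha, mul_pos (hQ a ha) (Real.exp_pos _), fun τ hτ => ?_⟩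
  let K : ℝ → ℝ := fun τ => τ ^ (k + 1) * profileS k R μ τ - G a * (τ - a)
  have hK : ∀ τ, HasDerivAt K (G τ - G a) τ := fun τ => by
    refine ((hasDerivAt_pow_mul_profileS k R μ τ).sub
      (((hasDerivAt_id τ).sub_const a).const_mul (G a))).congr_deriv ?_
    simp [G]; ring
  have hKmono : MonotoneOn K (Ici a) := by
    refine monotoneOn_of_deriv_nonneg (convex_Ici a)
      (fun τ _ => (hK τ).continuousAt.continuousWithinAt)
      (fun τ _ => (hK τ).differentiableAt.differentiableWithinAt) fun τ hτ => ?_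
    rw [interior_Ici] at hτ
    rw [(hK τ).deriv]
    exact sub_nonneg.2 (hGmono self_mem_Ici (le_of_lt hτ : a ≤ τ) (le_of_lt hτ))
  have h1 := hKmono self_mem_Ici (show τ ∈ Ici a from hτ) hτ
  have h2 : 0 ≤ a ^ (k + 1) * profileS k R μ a :=
    mul_nonneg (by positivity) (profileS_pos k hε hR μ (by linarith)).le
  simp only [K, sub_self, mul_zero] at h1
  linarith

lemma exists_profilePsi_eq {μ : ℝ} (hμ : μ < 0) {s : ℝ} (hs : 0 ≤ s) :
    ∃ τ, 0 ≤ τ ∧ profilePsi k R μ τ = s := by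
  obtain ⟨a, c, ha, hc, h⟩ := pow_mul_profileS_ge k hε hR hμ
  -- Chosen so that the lower bound `c(τ₁ - a)` equals `s^{k+1}`; hence `Ψ(τ₁) ≥ s`, and the
  -- intermediate value theorem applies.
  set τ₁ := a + s ^ (k + 1) / c with hτ₁
  have hτ₁0 : 0 ≤ τ₁ := by positivity
  have hS := profileS_pos k hε hR μ (τ := τ₁) (by linarith)
  have h1 : s ≤ profilePsi k R μ τ₁ := by
    have h2 := h τ₁ (by rw [hτ₁]; have : 0 ≤ s ^ (k + 1) / c := by positivity
                        linarith)
    rw [← profilePsi_pow k hS, hτ₁, add_sub_cancel_left, mul_div_cancel₀ _ hc.ne'] at h2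
    exact le_of_pow_le_pow_left₀ (Nat.succ_ne_zero k)
      (mul_nonneg hτ₁0 (Real.rpow_nonneg hS.le _)) h2
  have hcont : ContinuousOn (profilePsi k R μ) (Icc 0 τ₁) := fun τ hτ =>
    (hasDerivAt_profilePsi k (profileS_pos k hε hR μ (by linarith [hτ.1]))).continuousAt.continuousWithinAt
  obtain ⟨τ, hτ, h3⟩ := intermediate_value_Icc hτ₁0 hcont
    (show s ∈ Icc _ _ from ⟨by simpa [profilePsi] using hs, h1⟩)
  exact ⟨τ, hτ.1, h3⟩

/-- The derivative `τ / Ψ'(τ)`-type quantity `φ = Ψ/Ψ'` is bounded on `[0, ∞)`. -/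
lemma exists_profilePsi_div_le {μ : ℝ} (hμ : μ < 0) :
    ∃ K, ∀ τ, 0 ≤ τ → profilePsi k R μ τ / profileDer k R μ τ ≤ K := by
  have hQ : ∀ x, 0 < x → 0 < (X ^ k * R).eval x := fun x hx => by
    have := hR x (by linarith)
    simp only [eval_mul, eval_pow, eval_X]; positivity
  -- With the constant `μ/2` in place of `μ`, half of the exponential growth rate survives: `G' ≥
  -- (-μ/2) G` beyond `a`.
  obtain ⟨a, ha, hQ'⟩ := exists_forall_deriv_ge hQ (show μ / 2 < 0 by linarith)
  let G : ℝ → ℝ := fun τ => (X ^ k * R).eval τ * Real.exp (-μ * τ)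
  have hG : ∀ τ, HasDerivAt G (((X ^ k * R).derivative.eval τ - μ * (X ^ k * R).eval τ) *
      Real.exp (-μ * τ)) τ := fun τ => by
    refine (((X ^ k * R).hasDerivAt τ).mul
      (((hasDerivAt_id τ).const_mul (-μ)).exp)).congr_deriv ?_
    simp only [id]; ring
  have hGa : 0 < G a := mul_pos (hQ a ha) (Real.exp_pos _)
  have hformula : ∀ τ, 0 < τ → profilePsi k R μ τ / profileDer k R μ τ =
      (k + 1) * (τ ^ (k + 1) * profileS k R μ τ) / G τ := by
    intro τ hτ
    have hS := profileS_pos k hε hR μ (τ := τ) (by linarith)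
    have hRτ := hR τ (by linarith)
    rw [← profilePsi_pow k hS]
    simp only [G, profileDer, profilePsi, eval_mul, eval_pow, eval_X]
    have hA := Real.rpow_pos_of_pos hS (((k : ℝ) + 1)⁻¹)
    generalize profileS k R μ τ ^ (((k : ℝ) + 1)⁻¹) = A at hA ⊢
    field_simp
    ring
  obtain ⟨C, hC⟩ := isCompact_Icc.exists_bound_of_continuousOn (s := Icc 0 a)
    (f := fun τ => profilePsi k R μ τ / profileDer k R μ τ) (by
      intro τ hτ
      have hτ' : -ε < τ := by linarith [hτ.1]
      have hS := profileS_pos k hε hR μ hτ'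
      refine ContinuousAt.continuousWithinAt (ContinuousAt.div
        (hasDerivAt_profilePsi k hS).continuousAt ?_ (profileDer_pos k hε hR μ hτ').ne')
      have hcS : ContinuousAt (profileS k R μ) τ :=
        ContinuousAt.comp (g := Function.uncurry (profileS k R)) (f := fun τ => (μ, τ))
          (contDiffAt_profileS k R (μ, τ)).continuousAt (by fun_prop)
      have hcR : ContinuousAt (fun x => R.eval x) τ :=
        (contDiff_polynomial_eval R).continuous.continuousAt
      refine ContinuousAt.div (hcR.mul (by fun_prop)) (continuousAt_const.mul
        ((hcS.rpow_const (Or.inl hS.ne')).pow k)) ?_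
      have := Real.rpow_pos_of_pos hS (((k : ℝ) + 1)⁻¹)
      positivity)
  -- `L` has to bound the ratio of the integral to its integrand `G`. The first entry gives `G ≤ L
  -- G'`, so that `L G` minus the integral is nondecreasing; the second makes this difference
  -- nonnegative at `a`.
  set L := max (2 / (-μ)) (a ^ (k + 1) * profileS k R μ a / G a) with hL
  have hL1 : 2 / (-μ) ≤ L := le_max_left _ _
  have hL2 : a ^ (k + 1) * profileS k R μ a ≤ L * G a := by
    rw [← div_le_iff₀ hGa]; exact le_max_right _ _
  refine ⟨max C ((k + 1) * L), fun τ hτ => ?_⟩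
  rcases le_or_gt τ a with hτa | hτa
  · exact (le_abs_self _).trans ((hC τ ⟨hτ, hτa⟩).trans (le_max_left _ _))
  have hGτ : 0 < G τ := mul_pos (hQ τ (ha.trans hτa)) (Real.exp_pos _)
  refine le_trans ?_ (le_max_right _ _)
  rw [hformula τ (ha.trans hτa), div_le_iff₀ hGτ, mul_assoc]
  refine mul_le_mul_of_nonneg_left ?_ (by positivity)
  let K : ℝ → ℝ := fun τ => L * G τ - τ ^ (k + 1) * profileS k R μ τ
  have hK : ∀ τ, HasDerivAt K (L * (((X ^ k * R).derivative.eval τ - μ * (X ^ k * R).eval τ) *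
      Real.exp (-μ * τ)) - G τ) τ := fun τ => by
    refine (((hG τ).const_mul L).sub (hasDerivAt_pow_mul_profileS k R μ τ)).congr_deriv ?_
    simp [G]; ring
  have hKmono : MonotoneOn K (Ici a) := by
    refine monotoneOn_of_deriv_nonneg (convex_Ici a)
      (fun τ _ => (hK τ).continuousAt.continuousWithinAt)
      (fun τ _ => (hK τ).differentiableAt.differentiableWithinAt) fun τ hτ => ?_
    rw [interior_Ici] at hτ
    rw [(hK τ).deriv]
    have h1 := hQ' τ (le_of_lt hτ)
    have h2 := hQ τ (ha.trans hτ)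
    have h3 : (2 / (-μ)) * (-(μ / 2) * (X ^ k * R).eval τ) = (X ^ k * R).eval τ := by
      have : μ ≠ 0 := hμ.ne
      field_simp
    have h4 : (X ^ k * R).eval τ ≤
        L * ((X ^ k * R).derivative.eval τ - μ * (X ^ k * R).eval τ) := by
      calc _ = (2 / (-μ)) * (-(μ / 2) * (X ^ k * R).eval τ) := h3.symm
        _ ≤ L * (-(μ / 2) * (X ^ k * R).eval τ) :=
          mul_le_mul_of_nonneg_right hL1 (mul_nonneg (by linarith) h2.le)
        _ ≤ _ := mul_le_mul_of_nonneg_left (by linarith)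
          (le_trans (div_nonneg (by norm_num) (by linarith)) hL1)
    have h5 := mul_le_mul_of_nonneg_right h4 (Real.exp_pos (-μ * τ)).le
    simp only [G]
    linarith
  have h1 := hKmono self_mem_Ici (show τ ∈ Ici a from hτa.le) hτa.le
  simp only [K] at h1
  linarith

end

/-- The momentum profile: for `μ < 0`, the function `τ = s T(s)` solves
`τ^k R(τ) s τ' = (k + 1) s^{k+1} e^{μτ}`, and `F' = T`. -/
theorem exists_momentum_profile (k : ℕ) {R : ℝ[X]} (hR : ∀ x, 0 ≤ x → 0 < R.eval x) :
    ∃ F T D : ℝ → ℝ → ℝ, ∀ μ < 0,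
      (∀ s, 0 ≤ s → ContDiffAt ℝ ∞ (Function.uncurry F) (μ, s) ∧
        ContDiffAt ℝ ∞ (Function.uncurry T) (μ, s) ∧
        HasDerivAt (F μ) (T μ s) s ∧ 0 < T μ s ∧
        HasDerivAt (fun s => s * T μ s) (D μ s) s ∧ 0 < D μ s ∧
        (s * T μ s) ^ k * R.eval (s * T μ s) * (s * D μ s) =
          (k + 1) * s ^ (k + 1) * Real.exp (μ * (s * T μ s))) ∧
      (∃ K, ∀ s, 0 ≤ s → s * D μ s ≤ K) ∧
      ∀ C, ∃ B, ∀ s, 0 ≤ s → s * T μ s ≤ C → s ≤ B := by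
  obtain ⟨ε, hε, hR'⟩ := exists_pos_of_pos_on_nonneg hR
  -- `T` should be `τ/s`; since `s = τ S^{1/(k+1)}`, it equals `S^{-1/(k+1)}`, which makes sense and
  -- is smooth at `s = 0`.
  let T : ℝ → ℝ → ℝ := fun μ s => profileS k R μ (profileTau k R ε μ s) ^ (-((k : ℝ) + 1)⁻¹)
  -- The primitive of `T` vanishing at `0`, rescaled to the fixed interval `[0, 1]` in order to be
  -- jointly smooth in `(μ, s)`.
  let F : ℝ → ℝ → ℝ := fun μ s => s * ∫ x in (0 : ℝ)..1, T μ (s * x)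
  let D : ℝ → ℝ → ℝ := fun μ s => (profileDer k R μ (profileTau k R ε μ s))⁻¹
  have hτ : ∀ μ < 0, ∀ s, 0 ≤ s → 0 ≤ profileTau k R ε μ s ∧
      profilePsi k R μ (profileTau k R ε μ s) = s := by
    intro μ hμ s hs
    obtain ⟨τ, h0, h1⟩ := exists_profilePsi_eq k hε hR' hμ hs
    rw [← h1, profileTau_profilePsi k hε hR' μ (by linarith)]
    exact ⟨h0, rfl⟩
  have hτc : ∀ μ < 0, ∀ s, 0 ≤ s → ContDiffAt ℝ ∞ (Function.uncurry (profileTau k R ε)) (μ, s) := by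
    intro μ hμ s hs
    obtain ⟨h0, h1⟩ := hτ μ hμ s hs
    have := contDiffAt_profileTau k hε hR' μ (τ := profileTau k R ε μ s) (by linarith)
    rwa [h1] at this
  have hSp : ∀ μ < 0, ∀ s, 0 ≤ s → 0 < profileS k R μ (profileTau k R ε μ s) := fun μ hμ s hs =>
    profileS_pos k hε hR' μ (by linarith [(hτ μ hμ s hs).1])
  have hTc : ∀ μ < 0, ∀ s, 0 ≤ s → ContDiffAt ℝ ∞ (Function.uncurry T) (μ, s) := by
    intro μ hμ s hs
    refine ContDiffAt.rpow_const_of_ne ?_ (hSp μ hμ s hs).ne'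
    exact ContDiffAt.comp (g := Function.uncurry (profileS k R)) (μ, s)
      (contDiffAt_profileS k R _) (contDiffAt_fst.prodMk (hτc μ hμ s hs))
  have hT1 : ∀ μ < 0, ∀ s, 0 ≤ s → ContDiffAt ℝ ∞ (T μ) s := fun μ hμ s hs =>
    ContDiffAt.comp (g := Function.uncurry T) (f := fun s => (μ, s)) s (hTc μ hμ s hs)
      (contDiffAt_const.prodMk contDiffAt_id)
  have hF : ∀ μ s, F μ s = ∫ x in (0 : ℝ)..s, T μ x := fun μ s => by
    have := intervalIntegral.mul_integral_comp_mul_left (a := 0) (b := 1) (c := s) (f := T μ)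
    rwa [mul_zero, mul_one] at this
  have hsT' : ∀ μ s, -ε < profileTau k R ε μ s → profilePsi k R μ (profileTau k R ε μ s) = s →
      s * T μ s = profileTau k R ε μ s := fun μ s h0 h1 => by
    have hS := profileS_pos k hε hR' μ h0
    have hA := Real.rpow_pos_of_pos hS (((k : ℝ) + 1)⁻¹)
    simp only [T]
    rw [Real.rpow_neg hS.le, ← div_eq_mul_inv, div_eq_iff hA.ne']
    exact h1.symm
  have hsT : ∀ μ < 0, ∀ s, 0 ≤ s → s * T μ s = profileTau k R ε μ s := fun μ hμ s hs =>
    hsT' μ s (lt_of_lt_of_le (by linarith) (hτ μ hμ s hs).1) (hτ μ hμ s hs).2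
  refine ⟨F, T, D, fun μ hμ => ⟨fun s hs => ?_, ?_, ?_⟩⟩
  · have hτs := hτ μ hμ s hs
    have hε' : -ε < profileTau k R ε μ s := by linarith
    have hev := eventually_profilePsi_profileTau k hε hR' μ hε'
    rw [hτs.2] at hev
    refine ⟨?_, hTc μ hμ s hs, ?_, Real.rpow_pos_of_pos (hSp μ hμ s hs) _, ?_,
      inv_pos.2 (profileDer_pos k hε hR' μ hε'), ?_⟩
    · refine contDiffAt_snd.mul (contDiffAt_parametric_integral (E := ℝ × ℝ) (F := ℝ)
        (f := fun p x => T p.1 (p.2 * x)) fun x hx => ?_)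
      refine ContDiffAt.comp (g := Function.uncurry T) (f := fun z : (ℝ × ℝ) × ℝ =>
        (z.1.1, z.1.2 * z.2)) ((μ, s), x) (hTc μ hμ (s * x) (mul_nonneg hs hx.1)) ?_
      exact ContDiff.contDiffAt (by fun_prop)
    · have hF' : F μ = fun s => ∫ x in (0 : ℝ)..s, T μ x := funext (hF μ)
      rw [hF']
      have hcont : ContinuousOn (T μ) (uIcc 0 s) := fun x hx => by
        rw [uIcc_of_le hs] at hx
        exact (hT1 μ hμ x hx.1).continuousAt.continuousWithinAt
      refine intervalIntegral.integral_hasDerivAt_right hcont.intervalIntegrable ?_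
        (hT1 μ hμ s hs).continuousAt
      obtain ⟨U, hU, hUo, hsU⟩ := eventually_nhds_iff.1
        (((hT1 μ hμ s hs).of_le (show (1 : ℕ∞ω) ≤ ∞ by simp)).eventually (by simp))
      exact ContinuousOn.stronglyMeasurableAtFilter hUo
        (fun x hx => (hU x hx).continuousAt.continuousWithinAt) s hsU
    · have hd : HasDerivAt (profileTau k R ε μ) (D μ s) s := by
        have hcont : ContinuousAt (profileTau k R ε μ) s :=
          ContinuousAt.comp (g := Function.uncurry (profileTau k R ε)) (f := fun s => (μ, s))
            (hτc μ hμ s hs).continuousAt (by fun_prop)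
        exact HasDerivAt.of_local_left_inverse hcont
          (hasDerivAt_profilePsi k (hSp μ hμ s hs)) (profileDer_pos k hε hR' μ hε').ne'
          (hev.mono fun x hx => hx.2)
      exact hd.congr_of_eventuallyEq (hev.mono fun x hx => hsT' μ x hx.1 hx.2)
    · rw [hsT μ hμ s hs]
      have hS := hSp μ hμ s hs
      have hA := Real.rpow_pos_of_pos hS (((k : ℝ) + 1)⁻¹)
      have hRp := hR' _ hε'
      simp only [D, profileDer]
      set τ := profileTau k R ε μ s
      set A := profileS k R μ τ ^ (((k : ℝ) + 1)⁻¹) with hAdef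
      -- After substituting `s = τA` and `D = 1/Ψ'`, the differential equation is an algebraic
      -- identity.
      have h1 : s = τ * A := by rw [← hτs.2, profilePsi]
      rw [h1, neg_mul, Real.exp_neg]
      field_simp
      ring
  · obtain ⟨K, hK⟩ := exists_profilePsi_div_le k hε hR' hμ
    refine ⟨K, fun s hs => ?_⟩
    have := hK _ (hτ μ hμ s hs).1
    rw [(hτ μ hμ s hs).2] at this
    simpa [D, div_eq_mul_inv] using this
  · intro C
    refine ⟨profilePsi k R μ (max C 0), fun s hs h => ?_⟩
    rw [hsT μ hμ s hs] at h
    rw [← (hτ μ hμ s hs).2]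
    refine (strictMonoOn_profilePsi k hε hR' μ).monotoneOn ?_ ?_ (h.trans (le_max_left _ _))
    · exact lt_of_lt_of_le (neg_lt_zero.2 hε) (hτ μ hμ s hs).1
    · exact lt_of_lt_of_le (neg_lt_zero.2 hε) (le_max_right _ _)

end MomentumProfile

/-! ### Forms, `i∂∂̄` and pullbacks in the preferred charts. -/

section Charts

set_option synthInstance.maxHeartbeats 200000
set_option linter.unusedSectionVars false

variable {V : Type*} [NormedAddCommGroup V] [NormedSpace ℂ V]
  {H : Type*} [TopologicalSpace H] {I : ModelWithCorners ℂ V H} [I.Boundaryless]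
  {N : Type*} [TopologicalSpace N] [ChartedSpace H N] [IsManifold I ω N]
  {V' : Type*} [NormedAddCommGroup V'] [NormedSpace ℂ V']
  {H' : Type*} [TopologicalSpace H'] {I' : ModelWithCorners ℂ V' H'} [I'.Boundaryless]
  {N' : Type*} [TopologicalSpace N'] [ChartedSpace H' N'] [IsManifold I' ω N']

variable (I) in
lemma contDiffAt_transition (c p : N) {z : V} (hz : z ∈ (extChartAt I c).target)
    (hp : (extChartAt I c).symm z ∈ (extChartAt I p).source) :
    ContDiffAt ℂ ω (extChartAt I p ∘ (extChartAt I c).symm) z := by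
  have h := contDiffWithinAt_ext_coord_change (I := I) (n := ω) p c (y := z)
    ⟨hz, hp⟩
  rwa [I.range_eq_univ, contDiffWithinAt_univ] at h

variable (I) in
lemma tangentCoordChange_eq_fderiv (c p : N) {z : V} (hz : z ∈ (extChartAt I c).target) :
    tangentCoordChange I c p ((extChartAt I c).symm z) =
      fderiv ℂ (extChartAt I p ∘ (extChartAt I c).symm) z := by
  rw [tangentCoordChange_def, I.range_eq_univ, fderivWithin_univ, (extChartAt I c).right_inv hz]

variable (I) in
lemma eventually_mem_target (c : N) {z : V} (hz : z ∈ (extChartAt I c).target) :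
    ∀ᶠ y in 𝓝 z, y ∈ (extChartAt I c).target :=
  extChartAt_target_mem_nhds' hz

variable (I) in
lemma eventually_symm_mem_source (c p : N) {z : V} (hz : z ∈ (extChartAt I c).target)
    (hp : (extChartAt I c).symm z ∈ (extChartAt I p).source) :
    ∀ᶠ y in 𝓝 z, (extChartAt I c).symm y ∈ (extChartAt I p).source :=
  (continuousAt_extChartAt_symm'' hz).eventually (extChartAt_source_mem_nhds' hp)

variable (I) in
lemma inChart_eq {k : ℕ} (η : Form V N k) (c : N) {z : V} (hz : z ∈ (extChartAt I c).target) :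
    inChart I η c z = (η ((extChartAt I c).symm z)).compContinuousLinearMap
      (fderiv ℝ (extChartAt I ((extChartAt I c).symm z) ∘ (extChartAt I c).symm) z) := by
  have h := contDiffAt_transition I c _ hz (mem_extChartAt_source (I := I) _)
  rw [inChart, tangentCoordChange_eq_fderiv I c _ hz,
    (h.differentiableAt (by simp)).fderiv_restrictScalars ℝ]

variable (I) in
lemma inChart_self {k : ℕ} (η : Form V N k) (x : N) :
    inChart I η x (extChartAt I x x) = η x := by
  rw [inChart, extChartAt_to_inv]
  ext v
  rw [ContinuousAlternatingMap.compContinuousLinearMap_apply]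
  congr 1
  funext i
  exact tangentCoordChange_self (mem_extChartAt_source x)

lemma inChart_add {k : ℕ} (η η' : Form V N k) (c : N) (z : V) :
    inChart I (η + η') c z = inChart I η c z + inChart I η' c z := rfl

lemma inChart_smul {k : ℕ} (a : ℝ) (η : Form V N k) (c : N) (z : V) :
    inChart I (a • η) c z = a • inChart I η c z := rfl

lemma inChart_neg {k : ℕ} (η : Form V N k) (c : N) (z : V) :
    inChart I (-η) c z = - inChart I η c z := rfl

lemma inChart_sub {k : ℕ} (η η' : Form V N k) (c : N) (z : V) :
    inChart I (η - η') c z = inChart I η c z - inChart I η' c z := rfl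

/-- The local expression of a function, transported from one chart to another. -/
lemma comp_symm_eventuallyEq {X : Type*} (u : N → X) (c p : N) {z : V}
    (hz : z ∈ (extChartAt I c).target)
    (hp : (extChartAt I c).symm z ∈ (extChartAt I p).source) :
    u ∘ (extChartAt I c).symm =ᶠ[𝓝 z]
      (u ∘ (extChartAt I p).symm) ∘ (extChartAt I p ∘ (extChartAt I c).symm) := by
  filter_upwards [eventually_symm_mem_source I c p hz hp] with y hy
  simp only [Function.comp_apply, (extChartAt I p).left_inv hy]

lemma contDiffAt_comp_symm {n : ℕ∞ω} {X : Type*} [NormedAddCommGroup X] [NormedSpace ℝ X] {u : N → X}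
    (c p : N) {z : V} (hz : z ∈ (extChartAt I c).target)
    (hp : (extChartAt I c).symm z ∈ (extChartAt I p).source)
    (hu : ContDiffAt ℝ n (u ∘ (extChartAt I p).symm)
      (extChartAt I p ((extChartAt I c).symm z))) :
    ContDiffAt ℝ n (u ∘ (extChartAt I c).symm) z :=
  (ContDiffAt.comp z hu (((contDiffAt_transition I c p hz hp).restrict_scalars ℝ).of_le
    le_top)).congr_of_eventuallyEq (comp_symm_eventuallyEq u c p hz hp)

lemma dcV_comp {u : V' → ℝ} {f : V → V'} {z : V} (hu : DifferentiableAt ℝ u (f z))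
    (hf : DifferentiableAt ℂ f z) :
    dcV (u ∘ f) z = (dcV u (f z)).compContinuousLinearMap (fderiv ℝ f z) := by
  have hfr : DifferentiableAt ℝ f z := hf.restrictScalars ℝ
  ext v
  rw [ContinuousAlternatingMap.compContinuousLinearMap_apply, dcV_apply, dcV_apply,
    fderiv_comp z hu hfr]
  simp [fderiv_restrictScalars_I hf]

/-- Chart changes are holomorphic, so `i∂∂̄u` transforms as a form. Agreement of `η` with `i∂∂̄u` is
only required at one point: the curvature form is defined with a potential that varies from point to
point. -/
lemma inChart_of_eq_ddbar {η : Form V N 2} {u : N → ℝ} (c : N) {z : V}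
    (hz : z ∈ (extChartAt I c).target)
    (hη : η ((extChartAt I c).symm z) = ddbar I u ((extChartAt I c).symm z))
    (hu : ContDiffAt ℝ 2 (u ∘ (extChartAt I c).symm) z) :
    inChart I η c z = ddbarV (u ∘ (extChartAt I c).symm) z := by
  set p := (extChartAt I c).symm z with hp
  have hps := mem_extChartAt_source (I := I) p
  have hcs : p ∈ (extChartAt I c).source := (extChartAt I c).map_target hz
  have hu' : ContDiffAt ℝ 2 (u ∘ (extChartAt I p).symm) (extChartAt I p p) := by
    refine contDiffAt_comp_symm p c (mem_extChartAt_target p) ?_ ?_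
    · rwa [extChartAt_to_inv]
    · rw [extChartAt_to_inv, hp, (extChartAt I c).right_inv hz]; exact hu
  rw [inChart_eq I η c hz, hη, ddbar, ddbarV_congr (comp_symm_eventuallyEq u c p hz hps),
    ddbarV_comp (u := u ∘ (extChartAt I p).symm)
      (f := extChartAt I p ∘ (extChartAt I c).symm) hu' ((contDiffAt_transition I c p hz hps).of_le le_top)]
  rfl

lemma inChart_ddbar {u : N → ℝ} (c : N) {z : V} (hz : z ∈ (extChartAt I c).target)
    (hu : ContDiffAt ℝ 2 (u ∘ (extChartAt I c).symm) z) :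
    inChart I (ddbar I u) c z = ddbarV (u ∘ (extChartAt I c).symm) z :=
  inChart_of_eq_ddbar c hz rfl hu

variable (I) in
/-- The 1-form `(i/2)(∂̄u - ∂u)` on a complex manifold. -/
def dcForm (u : N → ℝ) : Form V N 1 := fun x => dcV (u ∘ (extChartAt I x).symm) (extChartAt I x x)

lemma inChart_dcForm {u : N → ℝ} (c : N) {z : V} (hz : z ∈ (extChartAt I c).target)
    (hu : ContDiffAt ℝ 1 (u ∘ (extChartAt I c).symm) z) :
    inChart I (dcForm I u) c z = dcV (u ∘ (extChartAt I c).symm) z := by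
  set p := (extChartAt I c).symm z with hp
  have hps := mem_extChartAt_source (I := I) p
  have hcs : p ∈ (extChartAt I c).source := (extChartAt I c).map_target hz
  have hu' : ContDiffAt ℝ 1 (u ∘ (extChartAt I p).symm) (extChartAt I p p) := by
    refine contDiffAt_comp_symm p c (mem_extChartAt_target p) ?_ ?_
    · rwa [extChartAt_to_inv]
    · rw [extChartAt_to_inv, hp, (extChartAt I c).right_inv hz]; exact hu
  have h2 : dcV (u ∘ (extChartAt I c).symm) z = dcV ((u ∘ (extChartAt I p).symm) ∘
      (extChartAt I p ∘ (extChartAt I c).symm)) z := by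
    rw [dcV_eq_dcL, dcV_eq_dcL, (comp_symm_eventuallyEq u c p hz hps).fderiv_eq]
  rw [inChart_eq I _ c hz, h2, dcV_comp (u := u ∘ (extChartAt I p).symm)
      (f := extChartAt I p ∘ (extChartAt I c).symm) (hu'.differentiableAt one_ne_zero)
    ((contDiffAt_transition I c p hz hps).differentiableAt (by simp))]
  rfl

variable (I) in
/-- Smoothness of a real function in the preferred charts. -/
def SmoothInCharts (u : N → ℝ) : Prop :=
  ∀ c : N, ∀ z ∈ (extChartAt I c).target, ContDiffAt ℝ ∞ (u ∘ (extChartAt I c).symm) z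

/-- Exactness of `i∂∂̄u` with an explicit smooth primitive; this gives the statement on cohomology
classes. -/
lemma extD_dcForm {u : N → ℝ} (hu : SmoothInCharts I u) :
    extD I (dcForm I u) = ddbar I u := by
  funext x
  refine Filter.EventuallyEq.extDeriv_eq ?_
  filter_upwards [eventually_mem_target I x (mem_extChartAt_target x)] with z hz
  exact inChart_dcForm x hz ((hu x z hz).of_le (by simp))

lemma isSmoothForm_dcForm {u : N → ℝ} (hu : SmoothInCharts I u) :
    IsSmoothForm I (dcForm I u) := fun c =>
  ContDiffOn.congr (f := dcV (u ∘ (extChartAt I c).symm))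
    (fun z hz => (contDiffAt_dcV (hu c z hz)).contDiffWithinAt)
    fun z hz => inChart_dcForm c hz ((hu c z hz).of_le (by simp))

/-- `pullback` uses the charts centred at the point and its image, whereas the right side uses
charts at `c` and `c'`. The two expressions agree by the chain rule, comparing the derivatives of
the two transition maps. -/
lemma inChart_pullback {k : ℕ} {f : N → N'} (η : Form V' N' k) (c : N) (c' : N') {z : V}
    (hz : z ∈ (extChartAt I c).target)
    (hf : MDifferentiableAt I I' f ((extChartAt I c).symm z))
    (hc' : f ((extChartAt I c).symm z) ∈ (extChartAt I' c').source) :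
    inChart I (pullback I I' f η) c z =
      (inChart I' η c' (extChartAt I' c' (f ((extChartAt I c).symm z)))).compContinuousLinearMap
        (fderiv ℝ (extChartAt I' c' ∘ f ∘ (extChartAt I c).symm) z) := by
  set p := (extChartAt I c).symm z with hp
  have hcs : p ∈ (extChartAt I c).source := (extChartAt I c).map_target hz
  have hps := mem_extChartAt_source (I := I) p
  have hfps := mem_extChartAt_source (I := I') (f p)
  have hzc : extChartAt I c p = z := (extChartAt I c).right_inv hz
  set q := f p with hq
  have hqt : extChartAt I' c' q ∈ (extChartAt I' c').target := (extChartAt I' c').map_source hc'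
  have hinv : (extChartAt I' c').symm (extChartAt I' c' q) = q := (extChartAt I' c').left_inv hc'
  -- derivatives of the local expressions
  have h1 : DifferentiableAt ℂ (extChartAt I' q ∘ f ∘ (extChartAt I p).symm) (extChartAt I p p) := by
    have := hf.differentiableWithinAt_writtenInExtChartAt
    rwa [I.range_eq_univ, differentiableWithinAt_univ] at this
  have h2 : mfderiv I I' f p =
      fderiv ℂ (extChartAt I' q ∘ f ∘ (extChartAt I p).symm) (extChartAt I p p) := by
    have h : fderivWithin ℂ (writtenInExtChartAt I I' p f) (range I) (extChartAt I p p) =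
        fderiv ℂ (extChartAt I' q ∘ f ∘ (extChartAt I p).symm) (extChartAt I p p) := by
      rw [I.range_eq_univ, fderivWithin_univ]; rfl
    exact hf.mfderiv.trans h
  have h3 : DifferentiableAt ℂ (extChartAt I p ∘ (extChartAt I c).symm) z :=
    (contDiffAt_transition I c p hz hps).differentiableAt (by simp)
  have hcont : ContinuousAt (f ∘ (extChartAt I c).symm) z :=
    ContinuousAt.comp (hp ▸ hf.continuousAt) (continuousAt_extChartAt_symm'' hz)
  have h4 : (extChartAt I' q ∘ f ∘ (extChartAt I p).symm) ∘ (extChartAt I p ∘ (extChartAt I c).symm)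
      =ᶠ[𝓝 z] extChartAt I' q ∘ f ∘ (extChartAt I c).symm := by
    filter_upwards [eventually_symm_mem_source I c p hz hps] with y hy
    simp only [Function.comp_apply, (extChartAt I p).left_inv hy]
  have h5 : DifferentiableAt ℂ (extChartAt I' q ∘ f ∘ (extChartAt I c).symm) z :=
    (DifferentiableAt.comp z h1 h3).congr_of_eventuallyEq h4.symm
  have h6 : fderiv ℂ (extChartAt I' q ∘ f ∘ (extChartAt I c).symm) z =
      (fderiv ℂ (extChartAt I' q ∘ f ∘ (extChartAt I p).symm) (extChartAt I p p)) ∘L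
        fderiv ℂ (extChartAt I p ∘ (extChartAt I c).symm) z := by
    rw [← h4.fderiv_eq]
    exact fderiv_comp z h1 h3
  have h7 : extChartAt I' c' ∘ f ∘ (extChartAt I c).symm =ᶠ[𝓝 z]
      (extChartAt I' c' ∘ (extChartAt I' q).symm) ∘
        (extChartAt I' q ∘ f ∘ (extChartAt I c).symm) := by
    filter_upwards [hcont.eventually (extChartAt_source_mem_nhds' (I := I') (x := q)
      (x' := (f ∘ (extChartAt I c).symm) z) hfps)] with y hy
    simp only [Function.comp_apply] at hy ⊢
    rw [(extChartAt I' q).left_inv hy]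
  have h8 : DifferentiableAt ℂ (extChartAt I' c' ∘ (extChartAt I' q).symm) (extChartAt I' q q) :=
    (contDiffAt_transition I' q c' (mem_extChartAt_target q)
      (by rwa [extChartAt_to_inv])).differentiableAt (by simp)
  have h9 : DifferentiableAt ℂ (extChartAt I' c' ∘ f ∘ (extChartAt I c).symm) z :=
    (DifferentiableAt.comp z h8 h5).congr_of_eventuallyEq h7
  have h10 : extChartAt I' q ∘ f ∘ (extChartAt I c).symm =ᶠ[𝓝 z]
      (extChartAt I' q ∘ (extChartAt I' c').symm) ∘
        (extChartAt I' c' ∘ f ∘ (extChartAt I c).symm) := by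
    filter_upwards [hcont.eventually (extChartAt_source_mem_nhds' (I := I') (x := c')
      (x' := (f ∘ (extChartAt I c).symm) z) hc')] with y hy
    simp only [Function.comp_apply] at hy ⊢
    rw [(extChartAt I' c').left_inv hy]
  have h11 : DifferentiableAt ℂ (extChartAt I' q ∘ (extChartAt I' c').symm) (extChartAt I' c' q) :=
    (contDiffAt_transition I' c' q hqt (by rwa [hinv])).differentiableAt (by simp)
  have h12 : fderiv ℂ (extChartAt I' q ∘ f ∘ (extChartAt I c).symm) z =
      (fderiv ℂ (extChartAt I' q ∘ (extChartAt I' c').symm) (extChartAt I' c' q)) ∘L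
        fderiv ℂ (extChartAt I' c' ∘ f ∘ (extChartAt I c).symm) z := by
    rw [h10.fderiv_eq]
    exact fderiv_comp z h11 h9
  rw [inChart_eq I _ c hz, h9.fderiv_restrictScalars ℝ, ← hp, h3.fderiv_restrictScalars ℝ]
  have h13 : inChart I' η c' (extChartAt I' c' q) = (η q).compContinuousLinearMap
      ((fderiv ℂ (extChartAt I' q ∘ (extChartAt I' c').symm)
        (extChartAt I' c' q)).restrictScalars ℝ) := by
    rw [inChart, hinv, tangentCoordChange_def, I'.range_eq_univ, fderivWithin_univ]
  rw [h13]
  have h14 : ∀ v, mfderiv I I' f p (fderiv ℂ (extChartAt I p ∘ (extChartAt I c).symm) z v) =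
      fderiv ℂ (extChartAt I' q ∘ (extChartAt I' c').symm) (extChartAt I' c' q)
        (fderiv ℂ (extChartAt I' c' ∘ f ∘ (extChartAt I c).symm) z v) := by
    intro v
    have := congrArg (fun L : V →L[ℂ] V' => L v) (h6.symm.trans h12)
    rw [h2]
    exact this
  ext v
  simp only [pullback, ContinuousAlternatingMap.compContinuousLinearMap_apply]
  congr 1
  funext i
  exact h14 (v i)

end Charts

/-! ### Derivatives along lines, and the complex linear part of a functional. -/

section SecondDerivative

set_option synthInstance.maxHeartbeats 200000

variable {V : Type*} [NormedAddCommGroup V] [NormedSpace ℂ V]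

lemma hasDerivAt_line (p v : V) (s : ℝ) : HasDerivAt (fun s : ℝ => p + s • v) v s := by
  simpa using ((hasDerivAt_id s).smul_const v).const_add p

lemma fderiv_eq_of_line {f : V → ℝ} {p v : V} (hf : DifferentiableAt ℝ f p) {g : ℝ → ℝ} {c : ℝ}
    (h : ∀ᶠ s in 𝓝 (0 : ℝ), f (p + s • v) = g s) (hg : HasDerivAt g c 0) :
    fderiv ℝ f p v = c := by
  have h1 : HasDerivAt (fun s : ℝ => f (p + s • v)) (fderiv ℝ f p v) 0 := by
    have : HasFDerivAt f (fderiv ℝ f p) (p + (0 : ℝ) • v) := by simpa using hf.hasFDerivAt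
    exact this.comp_hasDerivAt 0 (hasDerivAt_line p v 0)
  exact h1.unique (hg.congr_of_eventuallyEq h)

lemma fderiv2_eq_of_line {f : V → ℝ} {p v : V} (hf : ContDiffAt ℝ 2 f p) {g g' : ℝ → ℝ} {c : ℝ}
    (h : ∀ᶠ s in 𝓝 (0 : ℝ), f (p + s • v) = g s)
    (hg : ∀ᶠ s in 𝓝 (0 : ℝ), HasDerivAt g (g' s) s) (hg' : HasDerivAt g' c 0) :
    fderiv ℝ (fderiv ℝ f) p v v = c := by
  have hline : Tendsto (fun s : ℝ => p + s • v) (𝓝 0) (𝓝 p) := by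
    have := (hasDerivAt_line p v 0).continuousAt
    simpa [ContinuousAt] using this
  have h1 : ∀ᶠ s in 𝓝 (0 : ℝ), fderiv ℝ f (p + s • v) v = g' s := by
    filter_upwards [h.eventually_nhds, hg, hline.eventually (hf.eventually (by simp))]
      with s hs hgs hcs
    have e1 : HasDerivAt (fun s : ℝ => f (p + s • v)) (fderiv ℝ f (p + s • v) v) s :=
      (hcs.differentiableAt (by simp)).hasFDerivAt.comp_hasDerivAt s (hasDerivAt_line p v s)
    exact e1.unique (hgs.congr_of_eventuallyEq hs)
  have h2 : HasDerivAt (fun s : ℝ => fderiv ℝ f (p + s • v) v)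
      (fderiv ℝ (fderiv ℝ f) p v v) 0 := by
    have e1 : HasFDerivAt (fderiv ℝ f) (fderiv ℝ (fderiv ℝ f) p) (p + (0 : ℝ) • v) := by
      simpa using hf.differentiableAt_fderiv.hasFDerivAt
    exact ((ContinuousLinearMap.apply ℝ ℝ v).hasFDerivAt).comp_hasDerivAt 0
      (e1.comp_hasDerivAt 0 (hasDerivAt_line p v 0))
  exact h2.unique (hg'.congr_of_eventuallyEq h1)

/-- The complex linear part `∂` of a real linear functional. -/
def holPart (L : V →L[ℝ] ℝ) : V →L[ℂ] ℂ := (1 / 2 : ℂ) • StrongDual.extendRCLike L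

lemma holPart_apply (L : V →L[ℝ] ℝ) (v : V) :
    holPart L v = ((L v : ℂ) - Complex.I * L (Complex.I • v)) / 2 := by
  simp [holPart, StrongDual.extendRCLike_apply]
  ring

/-- The right side is the `F''`-term of `ddbarV_real_comp`. It is thereby recognised as the rank one
form `i a ∧ ā` with `a = ∂t`, suited to the determinant formula. -/
lemma two_mul_im_conj_holPart (L : V →L[ℝ] ℝ) (v w : V) :
    2 * ((starRingEnd ℂ) (holPart L v) * holPart L w).im =
      -(1 / 2) * (L v * L (Complex.I • w) - L w * L (Complex.I • v)) := by
  have hre : ∀ v, (holPart L v).re = L v / 2 := fun v => by simp [holPart_apply]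
  have him : ∀ v, (holPart L v).im = -(L (Complex.I • v)) / 2 := fun v => by simp [holPart_apply]
  rw [Complex.mul_im, Complex.conj_re, Complex.conj_im, hre, hre, him, him]
  ring

end SecondDerivative

/-! ### Hermitian metrics in a local trivialisation. -/

section FibreMetric

set_option synthInstance.maxHeartbeats 200000

open ProjBundle

variable {d k : ℕ}

/-- A Hermitian metric on the trivial bundle over `U`, given by its norm squared. -/
structure IsFibreMetric (U : Set (Cn d)) (H : Cn d × Cn (k + 1) → ℝ) : Prop where
  isOpen : IsOpen U
  smooth : ∀ q, q.1 ∈ U → ContDiffAt ℝ ∞ H q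
  sesq : ∀ z ∈ U, ∃ B : Cn (k + 1) →ₗ⋆[ℂ] Cn (k + 1) →ₗ[ℂ] ℂ,
    (∀ v w, (starRingEnd ℂ) (B v w) = B w v) ∧ ∀ w, H (z, w) = (B w w).re
  pos : ∀ z ∈ U, ∀ w, w ≠ 0 → 0 < H (z, w)

namespace IsFibreMetric

variable {U : Set (Cn d)} {H : Cn d × Cn (k + 1) → ℝ} (hH : IsFibreMetric U H)
include hH

lemma smul {z : Cn d} (hz : z ∈ U) (c : ℂ) (w : Cn (k + 1)) :
    H (z, c • w) = ‖c‖ ^ 2 * H (z, w) := by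
  obtain ⟨B, hB, h⟩ := hH.sesq z hz
  rw [h, h]
  have : B (c • w) (c • w) = ((‖c‖ ^ 2 : ℝ) : ℂ) * B w w := by
    rw [← Complex.normSq_eq_norm_sq, Complex.normSq_eq_conj_mul_self]
    simp
    ring
  rw [this, Complex.re_ofReal_mul]

lemma zero {z : Cn d} (hz : z ∈ U) : H (z, 0) = 0 := by
  simpa using hH.smul hz 0 0

lemma nonneg {z : Cn d} (hz : z ∈ U) (w : Cn (k + 1)) : 0 ≤ H (z, w) := by
  rcases eq_or_ne w 0 with rfl | hw
  · exact (hH.zero hz).ge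
  · exact (hH.pos z hz w hw).le

lemma real_smul {z : Cn d} (hz : z ∈ U) (c : ℝ) (w : Cn (k + 1)) :
    H (z, c • w) = c ^ 2 * H (z, w) := by
  have := hH.smul hz (c : ℂ) w
  simpa using this

lemma mem_nhds {p : Cn d × Cn (k + 1)} (hp : p.1 ∈ U) : ∀ᶠ q in 𝓝 p, q.1 ∈ U :=
  continuousAt_fst.eventually (hH.isOpen.mem_nhds hp)

/-- The differential of the norm squared in the directions of the fibre. -/
lemma fderiv_vertical {p : Cn d × Cn (k + 1)} (hp : p.1 ∈ U) :
    fderiv ℝ H p (0, p.2) = 2 * H p ∧ fderiv ℝ H p (Complex.I • (0, p.2)) = 0 := by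
  have hd : DifferentiableAt ℝ H p := (hH.smooth p hp).differentiableAt (by simp)
  constructor
  · refine fderiv_eq_of_line (g := fun s => (1 + s) ^ 2 * H p) hd (Eventually.of_forall fun s => ?_) ?_
    · have : p + s • ((0 : Cn d), p.2) = (p.1, (1 + s) • p.2) := by
        ext1 <;> simp [add_smul]
      rw [this, hH.real_smul hp]
    · have := (((hasDerivAt_id (0 : ℝ)).const_add 1).pow 2).mul_const (H p)
      simpa using this
  · refine fderiv_eq_of_line (g := fun s => (1 + s ^ 2) * H p) hd
      (Eventually.of_forall fun s => ?_) ?_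
    -- Moving along `i` times the Euler vector multiplies `w` by `1 + si`, and `|1 + si|² = 1 + s²`
    -- has no linear term.
    · have : p + s • (Complex.I • ((0 : Cn d), p.2)) = (p.1, (1 + s * Complex.I : ℂ) • p.2) := by
        ext1
        · simp
        · simp [add_smul, mul_smul]
      rw [this, hH.smul hp]
      congr 1
      rw [← Complex.normSq_eq_norm_sq, Complex.normSq_apply]
      simp
      ring
    · have := (((hasDerivAt_id (0 : ℝ)).pow 2).const_add 1).mul_const (H p)
      simpa using this

/-- `H` is nonnegative and vanishes on the zero section, which therefore consists of minima. -/
lemma fderiv_zero {z : Cn d} (hz : z ∈ U) : fderiv ℝ H (z, 0) = 0 := by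
  refine IsLocalMin.fderiv_eq_zero ?_
  filter_upwards [hH.mem_nhds (p := (z, 0)) hz] with q hq
  rw [hH.zero hz]
  exact hH.nonneg hq q.2

/-- Since `dH = 0` along the zero section, its derivative in horizontal directions vanishes; only
the vertical quadratic form remains. -/
lemma fderiv2_zero {z : Cn d} (hz : z ∈ U) (v : Cn d × Cn (k + 1)) :
    fderiv ℝ (fderiv ℝ H) (z, 0) v v = 2 * H (z, v.2) := by
  have hc : ContDiffAt ℝ 2 H (z, 0) := (hH.smooth (z, 0) hz).of_le two_le_infty
  have h0 : ∀ (a : Cn d), fderiv ℝ (fderiv ℝ H) (z, 0) (a, 0) = 0 := by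
    intro a
    have e1 : HasFDerivAt (fderiv ℝ H) (fderiv ℝ (fderiv ℝ H) (z, 0))
        ((z, 0) + (0 : ℝ) • (a, (0 : Cn (k + 1)))) := by
      simpa using hc.differentiableAt_fderiv.hasFDerivAt
    have e2 := e1.comp_hasDerivAt 0 (hasDerivAt_line (z, (0 : Cn (k + 1))) (a, 0) 0)
    refine e2.unique ((hasDerivAt_const (0 : ℝ) (0 : Cn d × Cn (k + 1) →L[ℝ] ℝ)).congr_of_eventuallyEq ?_)
    have hl : Tendsto (fun s : ℝ => z + s • a) (𝓝 0) (𝓝 z) := by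
      have := (hasDerivAt_line z a 0).continuousAt
      simpa [ContinuousAt] using this
    filter_upwards [hl.eventually (hH.isOpen.mem_nhds hz)] with s hs
    have : (z, (0 : Cn (k + 1))) + s • (a, (0 : Cn (k + 1))) = (z + s • a, 0) := by simp
    simp only [Function.comp_apply, this, hH.fderiv_zero hs]
  have h1 : fderiv ℝ (fderiv ℝ H) (z, 0) (0, v.2) (0, v.2) = 2 * H (z, v.2) := by
    refine fderiv2_eq_of_line (g := fun s => s ^ 2 * H (z, v.2)) (g' := fun s => 2 * s * H (z, v.2))
      hc (Eventually.of_forall fun s => ?_) (Eventually.of_forall fun s => ?_) ?_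
    · have : (z, (0 : Cn (k + 1))) + s • ((0 : Cn d), v.2) = (z, s • v.2) := by simp
      rw [this, hH.real_smul hz]
    · have := ((hasDerivAt_id s).pow 2).mul_const (H (z, v.2))
      simpa using this
    · have := ((hasDerivAt_id (0 : ℝ)).const_mul 2).mul_const (H (z, v.2))
      simpa using this
  have hv : v = (v.1, 0) + (0, v.2) := by simp
  have h2 : fderiv ℝ (fderiv ℝ H) (z, 0) v = fderiv ℝ (fderiv ℝ H) (z, 0) (0, v.2) := by
    conv_lhs => rw [hv]
    rw [map_add, h0, zero_add]
  rw [h2, fderiv2_symm hc, h2, h1]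

lemma ddbarV_zero {z : Cn d} (hz : z ∈ U) (v : Cn d × Cn (k + 1)) :
    ddbarV H (z, 0) ![v, Complex.I • v] = 2 * H (z, v.2) := by
  have hc : ContDiffAt ℝ 2 H (z, 0) := (hH.smooth (z, 0) hz).of_le two_le_infty
  rw [ddbarV_apply_I hc, hH.fderiv2_zero hz, hH.fderiv2_zero hz, Prod.smul_snd, hH.smul hz]
  simp
  ring

end IsFibreMetric

end FibreMetric

/-! ### The potential of the curvature, and its strict positivity along the fibres of `P(E)`. -/

section ProjPotential

set_option synthInstance.maxHeartbeats 200000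

open ProjBundle

variable {d k : ℕ}

lemma contDiff_homog {n : ℕ∞ω} (i : Fin (k + 1)) : ContDiff ℂ n (homog i : Cn k → Cn (k + 1)) := by
  refine contDiff_euclidean.2 fun j => ?_
  rcases Fin.eq_self_or_eq_succAbove i j with rfl | ⟨j, rfl⟩
  · simpa [homog] using contDiff_const
  · simpa [homog] using (contDiff_euclidean.1 contDiff_id j)

/-- The vector of `ℂ^{k+1}` with `i`-th coordinate `0` and other coordinates `w`. -/
def insertZero (i : Fin (k + 1)) (w : Cn k) : Cn (k + 1) :=
  WithLp.toLp 2 (i.insertNth (α := fun _ => ℂ) 0 w)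

lemma insertZero_same (i : Fin (k + 1)) (w : Cn k) : insertZero i w i = 0 := by simp [insertZero]

lemma homog_same (i : Fin (k + 1)) (w : Cn k) : homog i w i = 1 := by simp [homog]

lemma insertZero_ne_zero (i : Fin (k + 1)) {w : Cn k} (hw : w ≠ 0) : insertZero i w ≠ 0 := by
  contrapose! hw
  ext j
  have := congrArg (fun u : Cn (k + 1) => u (i.succAbove j)) hw
  simpa [insertZero] using this

lemma homog_add_smul (i : Fin (k + 1)) (u w : Cn k) (s : ℝ) :
    homog i (u + s • w) = homog i u + s • insertZero i w := by
  ext j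
  rcases Fin.eq_self_or_eq_succAbove i j with rfl | ⟨j, rfl⟩ <;> simp [homog, insertZero]

lemma insertZero_smul (i : Fin (k + 1)) (w : Cn k) (c : ℂ) :
    insertZero i (c • w) = c • insertZero i w := by
  ext j
  rcases Fin.eq_self_or_eq_succAbove i j with rfl | ⟨j, rfl⟩ <;> simp [insertZero]

/-- The potential `log h(s, s)` of the curvature of `O(-1)` in an affine chart of `P(E)`. -/
def projPot (H : Cn d × Cn (k + 1) → ℝ) (i : Fin (k + 1)) (q : Cn d × Cn k) : ℝ :=
  Real.log (H (q.1, homog i q.2))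

variable {U : Set (Cn d)} {H : Cn d × Cn (k + 1) → ℝ}

lemma IsFibreMetric.contDiffAt_projPot (hH : IsFibreMetric U H) (i : Fin (k + 1))
    {q : Cn d × Cn k} (hq : q.1 ∈ U) : ContDiffAt ℝ ∞ (projPot H i) q := by
  have h1 : ContDiffAt ℝ ∞ (fun q : Cn d × Cn k => (q.1, homog i q.2)) q :=
    contDiffAt_fst.prodMk (((contDiff_homog i).restrict_scalars ℝ).contDiffAt.comp q contDiffAt_snd)
  exact (ContDiffAt.comp (g := H) q (hH.smooth (q.1, homog i q.2) hq) h1).log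
    (hH.pos _ hq _ (homog_ne_zero i q.2)).ne'

/-- Expand the norm squared of `B(x,x) y - B(x,y) x`, which is nonzero by independence, and divide
by `B(x,x) > 0`. -/
lemma strict_cauchy_schwarz {V : Type*} [AddCommGroup V] [Module ℂ V]
    (B : V →ₗ⋆[ℂ] V →ₗ[ℂ] ℂ) (hB : ∀ v w, (starRingEnd ℂ) (B v w) = B w v)
    (hpos : ∀ v, v ≠ 0 → 0 < (B v v).re) {x y : V} (hxy : ∀ a b : ℂ, a ≠ 0 → a • y + b • x ≠ 0)
    (hx : x ≠ 0) :
    ‖B x y‖ ^ 2 < (B x x).re * (B y y).re := by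
  have hre : ∀ v, B v v = ((B v v).re : ℂ) := fun v => (Complex.conj_eq_iff_re.1 (hB v v)).symm
  have ha := hpos x hx
  set a := (B x x).re with hadef
  have h1 := hpos _ (hxy a (-(B x y)) (by exact_mod_cast ha.ne'))
  have h2 : B ((a : ℂ) • y + (-(B x y)) • x) ((a : ℂ) • y + (-(B x y)) • x) =
      ((a * (a * (B y y).re - ‖B x y‖ ^ 2) : ℝ) : ℂ) := by
    have e1 : B y x = (starRingEnd ℂ) (B x y) := (hB x y).symm
    have e2 : B x y * (starRingEnd ℂ) (B x y) = ((‖B x y‖ ^ 2 : ℝ) : ℂ) := by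
      rw [Complex.mul_conj, Complex.normSq_eq_norm_sq]
    simp only [map_add, map_smulₛₗ, LinearMap.add_apply, LinearMap.smul_apply, smul_eq_mul,
      map_neg, Complex.conj_ofReal, RingHom.id_apply, e1]
    push_cast at e2 ⊢
    rw [hre x, hre y, ← hadef]
    linear_combination (-(a : ℂ)) * e2
  rw [h2, Complex.ofReal_re] at h1
  have := (mul_pos_iff_of_pos_left ha).1 h1
  linarith

/-- On a line in the fibre the potential is `log(a + 2bs + cs²)`; the right side is the second
derivative of this at `s = 0`. -/
lemma IsFibreMetric.projPot_vertical (hH : IsFibreMetric U H) (i : Fin (k + 1)) {z : Cn d}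
    (hz : z ∈ U) {B : Cn (k + 1) →ₗ⋆[ℂ] Cn (k + 1) →ₗ[ℂ] ℂ}
    (hB : ∀ v w, (starRingEnd ℂ) (B v w) = B w v) (hBH : ∀ w, H (z, w) = (B w w).re)
    (u y : Cn k) :
    fderiv ℝ (fderiv ℝ (projPot H i)) (z, u) (0, y) (0, y) =
      (2 * (B (homog i u) (homog i u)).re * (B (insertZero i y) (insertZero i y)).re -
        4 * (B (homog i u) (insertZero i y)).re ^ 2) / (B (homog i u) (homog i u)).re ^ 2 := by
  set x := homog i u
  set Y := insertZero i y
  set a := (B x x).re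
  set b := (B x Y).re with hb
  set c := (B Y Y).re
  have ha : 0 < a := by
    have := hH.pos z hz x (homog_ne_zero i u)
    rwa [hBH] at this
  have hexp : ∀ s : ℝ, H (z, x + s • Y) = a + 2 * b * s + c * s ^ 2 := by
    intro s
    have e1 : (B Y x).re = b := by rw [← hB x Y, Complex.conj_re]
    have e3 : B (x + s • Y) (x + s • Y) = B x x + s * B x Y + s * B Y x + s * (s * B Y Y) := by
      rw [← Complex.coe_smul s Y]
      simp only [map_add, map_smulₛₗ, LinearMap.add_apply, LinearMap.smul_apply, smul_eq_mul,
        Complex.conj_ofReal, RingHom.id_apply]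
      ring
    rw [hBH, e3]
    simp only [Complex.add_re, Complex.re_ofReal_mul, e1]
    ring
  have hD : ∀ s : ℝ, HasDerivAt (fun s : ℝ => a + 2 * b * s + c * s ^ 2) (2 * b + 2 * c * s) s := by
    intro s
    have := (((hasDerivAt_id s).const_mul (2 * b)).const_add a).add
      (((hasDerivAt_id s).pow 2).const_mul c)
    refine (this.congr_deriv ?_).congr_of_eventuallyEq (Eventually.of_forall fun s => ?_)
    · simp; ring
    · simp
  have hcont : ∀ᶠ s in 𝓝 (0 : ℝ), a + 2 * b * s + c * s ^ 2 ≠ 0 :=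
    (hD 0).continuousAt.eventually_ne (by simpa using ha.ne')
  refine fderiv2_eq_of_line (g := fun s => Real.log (a + 2 * b * s + c * s ^ 2))
    (g' := fun s => (2 * b + 2 * c * s) / (a + 2 * b * s + c * s ^ 2))
    ((hH.contDiffAt_projPot i (q := (z, u)) hz).of_le two_le_infty)
    (Eventually.of_forall fun s => ?_) ?_ ?_
  · have : (z, u) + s • ((0 : Cn d), y) = (z, u + s • y) := by simp
    rw [this, projPot]
    simp only
    rw [homog_add_smul, hexp]
  · filter_upwards [hcont] with s hs
    exact (hD s).log hs
  · have h1 : HasDerivAt (fun s : ℝ => 2 * b + 2 * c * s) (2 * c) 0 := by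
      simpa using ((hasDerivAt_id (0 : ℝ)).const_mul (2 * c)).const_add (2 * b)
    refine (h1.div (hD 0) (by simpa using ha.ne')).congr_deriv ?_
    simp
    ring

/-- The curvature of `O(-1)` is negative along the fibres of `P(E)`. -/
lemma IsFibreMetric.ddbarV_projPot_vertical_pos (hH : IsFibreMetric U H) (i : Fin (k + 1))
    {z : Cn d} (hz : z ∈ U) (u : Cn k) {y : Cn k} (hy : y ≠ 0) :
    0 < ddbarV (projPot H i) (z, u) ![((0 : Cn d), y), Complex.I • ((0 : Cn d), y)] := by
  obtain ⟨B, hB, hBH⟩ := hH.sesq z hz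
  have hI : Complex.I • ((0 : Cn d), y) = ((0 : Cn d), Complex.I • y) := by simp
  rw [ddbarV_apply_I ((hH.contDiffAt_projPot i (q := (z, u)) hz).of_le two_le_infty), hI,
    hH.projPot_vertical i hz hB hBH, hH.projPot_vertical i hz hB hBH, insertZero_smul]
  have hpos : ∀ v, v ≠ 0 → 0 < (B v v).re := fun v hv => hBH v ▸ hH.pos z hz v hv
  have hcs := strict_cauchy_schwarz B hB hpos (x := homog i u) (y := insertZero i y) ?_
    (homog_ne_zero i u)
  · have e1 : B (Complex.I • insertZero i y) (Complex.I • insertZero i y) =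
        B (insertZero i y) (insertZero i y) := by
      simp only [map_smulₛₗ, LinearMap.smul_apply, smul_eq_mul, Complex.conj_I, RingHom.id_apply]
      linear_combination (-(B (insertZero i y) (insertZero i y))) * Complex.I_mul_I
    -- Replacing `y` by `iy` turns the real part of `B(x, Y)` into minus its imaginary part. The sum
    -- of the two second derivatives thus contains `|B(x, Y)|²`, and strict Cauchy–Schwarz applies.
    have e2 : (B (homog i u) (Complex.I • insertZero i y)).re =
        -(B (homog i u) (insertZero i y)).im := by
      simp
    rw [e1, e2, ← add_div, ← Complex.normSq_eq_norm_sq, Complex.normSq_apply] at *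
    have ha := hpos _ (homog_ne_zero i u)
    refine mul_pos (by norm_num) (div_pos ?_ (by positivity))
    nlinarith
  · intro a b ha h0
    -- Independence is seen in the coordinate `i`, which is `1` for the homogeneous vector and `0`
    -- for `Y`.
    have hb : b = 0 := by
      have := congrArg (fun v : Cn (k + 1) => v i) h0
      simpa [insertZero_same, homog_same] using this
    rw [hb, zero_smul, add_zero, smul_eq_zero] at h0
    exact h0.elim ha (insertZero_ne_zero i hy)

end ProjPotential

/-! ### The projection from nonzero vectors to `P(E)` in coordinates. -/

section AffineCoordinates

set_option synthInstance.maxHeartbeats 200000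

open ProjBundle

variable {d k : ℕ}

/-- The affine coordinates of the line through a vector. -/
def affineMap (i : Fin (k + 1)) (p : Cn d × Cn (k + 1)) : Cn d × Cn k :=
  (p.1, WithLp.toLp 2 fun j => p.2 (i.succAbove j) / p.2 i)

lemma contDiffAt_coord (j : Fin (k + 1)) {n : ℕ∞ω} (p : Cn d × Cn (k + 1)) :
    ContDiffAt ℂ n (fun p : Cn d × Cn (k + 1) => p.2 j) p :=
  contDiffAt_euclidean.1 contDiffAt_snd j

lemma contDiffAt_affineMap {n : ℕ∞ω} (i : Fin (k + 1)) {p : Cn d × Cn (k + 1)} (hp : p.2 i ≠ 0) :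
    ContDiffAt ℂ n (affineMap i) p :=
  contDiffAt_fst.prodMk (contDiffAt_euclidean.2 fun _ =>
    (contDiffAt_coord _ p).div (contDiffAt_coord i p) hp)

lemma homog_affineMap (i : Fin (k + 1)) {p : Cn d × Cn (k + 1)} (hp : p.2 i ≠ 0) :
    homog i (affineMap i p).2 = (p.2 i)⁻¹ • p.2 := by
  ext j
  rcases Fin.eq_self_or_eq_succAbove i j with rfl | ⟨j, rfl⟩
  · simp [homog, hp]
  · simp [homog, affineMap, div_eq_inv_mul]

lemma fderiv_affineMap (i : Fin (k + 1)) {p : Cn d × Cn (k + 1)} (hp : p.2 i ≠ 0)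
    (v : Cn d × Cn (k + 1)) :
    fderiv ℂ (affineMap i) p v = (v.1, WithLp.toLp 2 fun j =>
      (v.2 (i.succAbove j) * p.2 i - p.2 (i.succAbove j) * v.2 i) / p.2 i ^ 2) := by
  have hd : HasFDerivAt (affineMap i) (fderiv ℂ (affineMap i) p) p :=
    ((contDiffAt_affineMap (n := 1) i hp).differentiableAt one_ne_zero).hasFDerivAt
  have key : ∀ (l : Cn d × Cn k →L[ℂ] ℂ) (g : ℂ → ℂ) (c : ℂ),
      (∀ s : ℂ, l (affineMap i (p + s • v)) = g s) → HasDerivAt g c 0 →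
      l (fderiv ℂ (affineMap i) p v) = c := by
    intro l g c h hg
    have hd' : HasFDerivAt (affineMap i) (fderiv ℂ (affineMap i) p) (p + (0 : ℂ) • v) := by
      simpa using hd
    have hl : HasDerivAt (fun s : ℂ => p + s • v) v 0 := by
      simpa using ((hasDerivAt_id (0 : ℂ)).smul_const v).const_add p
    have h1 := l.hasFDerivAt.comp_hasDerivAt (0 : ℂ) (hd'.comp_hasDerivAt (0 : ℂ) hl)
    exact h1.unique (hg.congr_of_eventuallyEq (Eventually.of_forall h))
  ext j
  · refine key ((EuclideanSpace.proj j).comp (ContinuousLinearMap.fst ℂ _ _))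
      (fun s => p.1 j + s * v.1 j) (v.1 j) (fun s => by simp [affineMap]) ?_
    simpa using ((hasDerivAt_id (0 : ℂ)).mul_const (v.1 j)).const_add (p.1 j)
  · refine key ((EuclideanSpace.proj j).comp (ContinuousLinearMap.snd ℂ _ _))
      (fun s => (p.2 (i.succAbove j) + s * v.2 (i.succAbove j)) / (p.2 i + s * v.2 i)) _
      (fun s => by simp [affineMap]) ?_
    have h1 : ∀ l, HasDerivAt (fun s : ℂ => p.2 l + s * v.2 l) (v.2 l) 0 := fun l => by
      simpa using ((hasDerivAt_id (0 : ℂ)).mul_const (v.2 l)).const_add (p.2 l)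
    refine ((h1 (i.succAbove j)).div (h1 i) (by simpa using hp)).congr_deriv ?_
    simp

lemma fderiv_affineMap_real (i : Fin (k + 1)) {p : Cn d × Cn (k + 1)} (hp : p.2 i ≠ 0) :
    fderiv ℝ (affineMap i) p = (fderiv ℂ (affineMap i) p).restrictScalars ℝ :=
  ((contDiffAt_affineMap (n := 1) i hp).differentiableAt one_ne_zero).fderiv_restrictScalars ℝ

/-- The kernel of the differential of the projection to `P(E)` is the line of the Euler vector. -/
lemma eq_smul_of_fderiv_affineMap_eq_zero (i : Fin (k + 1)) {p : Cn d × Cn (k + 1)}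
    (hp : p.2 i ≠ 0) {v : Cn d × Cn (k + 1)} (hv : fderiv ℂ (affineMap i) p v = 0) :
    v = (v.2 i / p.2 i) • ((0 : Cn d), p.2) := by
  rw [fderiv_affineMap i hp, Prod.mk_eq_zero] at hv
  refine Prod.ext (by simpa using hv.1) ?_
  ext j
  rcases Fin.eq_self_or_eq_succAbove i j with rfl | ⟨j, rfl⟩
  · simp [hp]
  · have := congrArg (fun u : Cn k => u j) hv.2
    have h2 : v.2 (i.succAbove j) * p.2 i - p.2 (i.succAbove j) * v.2 i = 0 := by
      simpa [hp] using this
    simp only [Prod.smul_snd, PiLp.smul_apply, smul_eq_mul]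
    field_simp
    linear_combination h2

variable {U : Set (Cn d)} {H : Cn d × Cn (k + 1) → ℝ}

namespace IsFibreMetric

variable (hH : IsFibreMetric U H)
include hH

/-- Homogeneity, after scaling the `i`-th coordinate to `1`. The splitting separates a pluriharmonic
function from a function on `P(E)`. -/
lemma log_eq (i : Fin (k + 1)) {p : Cn d × Cn (k + 1)} (h1 : p.1 ∈ U) (hp : p.2 i ≠ 0) :
    Real.log (H p) = Real.log (‖p.2 i‖ ^ 2) + projPot H i (affineMap i p) := by
  have h2 : p.2 = p.2 i • homog i (affineMap i p).2 := by
    rw [homog_affineMap i hp, smul_smul, mul_inv_cancel₀ hp, one_smul]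
  have h3 : H p = ‖p.2 i‖ ^ 2 * H (p.1, homog i (affineMap i p).2) := by
    rw [← hH.smul h1, ← h2]
  rw [h3, Real.log_mul (by simpa using hp) (hH.pos _ h1 _ (homog_ne_zero _ _)).ne']
  rfl

lemma eventually_log_eq (i : Fin (k + 1)) {p : Cn d × Cn (k + 1)} (h1 : p.1 ∈ U)
    (hp : p.2 i ≠ 0) : (fun p => Real.log (H p)) =ᶠ[𝓝 p]
      fun p => Real.log (‖p.2 i‖ ^ 2) + (projPot H i ∘ affineMap i) p := by
  filter_upwards [hH.mem_nhds h1,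
    (contDiffAt_coord (n := 0) i p).continuousAt.eventually_ne hp] with q hq hq'
  exact hH.log_eq i hq hq'

lemma contDiffAt_log {p : Cn d × Cn (k + 1)} (h1 : p.1 ∈ U) (hp : p.2 ≠ 0) :
    ContDiffAt ℝ ∞ (fun p => Real.log (H p)) p :=
  (hH.smooth p h1).log (hH.pos _ h1 _ hp).ne'

omit hH in
lemma contDiffAt_log_coord (i : Fin (k + 1)) {p : Cn d × Cn (k + 1)} (hp : p.2 i ≠ 0) :
    ContDiffAt ℝ ∞ (fun p : Cn d × Cn (k + 1) => Real.log (‖p.2 i‖ ^ 2)) p := by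
  have h := (contDiffAt_coord (n := ∞) i p).restrict_scalars ℝ
  exact (h.norm_sq ℝ).log (by simpa using hp)

/-- The summand `log |p_i|²` disappears under `i∂∂̄`, so `i∂∂̄ log h` is the pullback of `-γ` from
`P(E)`. -/
lemma ddbarV_log (i : Fin (k + 1)) {p : Cn d × Cn (k + 1)} (h1 : p.1 ∈ U) (hp : p.2 i ≠ 0) :
    ddbarV (fun p => Real.log (H p)) p =
      (ddbarV (projPot H i) (affineMap i p)).compContinuousLinearMap
        (fderiv ℝ (affineMap i) p) := by
  have hP := (hH.contDiffAt_projPot i (q := affineMap i p) h1).of_le two_le_infty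
  have ha := contDiffAt_affineMap (n := 2) i hp
  rw [ddbarV_congr (hH.eventually_log_eq i h1 hp),
    ddbarV_add ((contDiffAt_log_coord i hp).of_le two_le_infty)
      (ContDiffAt.comp (g := projPot H i) p hP (ha.restrict_scalars ℝ)),
    ddbarV_log_norm_sq (contDiffAt_coord i p) hp, zero_add,
    ddbarV_comp (u := projPot H i) (f := affineMap i) hP ha]

/-- The decomposition `∂ log H = dp_i/p_i + (affineMap i)^* ∂(projPot H i)`: a holomorphic 1-form
plus a form factoring through the projection, as `exists_det_hermMatrix_add_wedge` demands. -/
lemma holPart_log (i : Fin (k + 1)) {p : Cn d × Cn (k + 1)} (h1 : p.1 ∈ U) (hp : p.2 i ≠ 0) :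
    holPart (fderiv ℝ (fun p => Real.log (H p)) p) =
      (p.2 i)⁻¹ • (EuclideanSpace.proj i).comp (ContinuousLinearMap.snd ℂ (Cn d) (Cn (k + 1))) +
      (holPart (fderiv ℝ (projPot H i) (affineMap i p))) ∘L fderiv ℂ (affineMap i) p := by
  have hP := (hH.contDiffAt_projPot i (q := affineMap i p) h1).differentiableAt (by simp)
  have ha := (contDiffAt_affineMap (n := 1) i hp).differentiableAt one_ne_zero
  have har : DifferentiableAt ℝ (affineMap i) p := ha.restrictScalars ℝ
  have hl : DifferentiableAt ℝ (fun p : Cn d × Cn (k + 1) => Real.log (‖p.2 i‖ ^ 2)) p :=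
    (contDiffAt_log_coord i hp).differentiableAt (by simp)
  have h2 : fderiv ℝ (fun p => Real.log (H p)) p =
      fderiv ℝ (fun p : Cn d × Cn (k + 1) => Real.log (‖p.2 i‖ ^ 2)) p +
      (fderiv ℝ (projPot H i) (affineMap i p)) ∘L fderiv ℝ (affineMap i) p := by
    rw [(hH.eventually_log_eq i h1 hp).fderiv_eq, ← fderiv_comp p hP har]
    exact fderiv_add hl (hP.comp p har)
  have h3 : ∀ v, fderiv ℝ (fun p : Cn d × Cn (k + 1) => Real.log (‖p.2 i‖ ^ 2)) p v =
      2 * (v.2 i / p.2 i).re := by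
    intro v
    refine fderiv_eq_of_line (g := fun s => Real.log (‖p.2 i + s * v.2 i‖ ^ 2)) hl
      (Eventually.of_forall fun s => by simp) ?_
    have e1 : HasDerivAt (fun s : ℝ => p.2 i + s * v.2 i) (v.2 i) 0 := by
      simpa using ((Complex.ofRealCLM.hasDerivAt (x := (0 : ℝ))).mul_const (v.2 i)).const_add (p.2 i)
    have e2 := (e1.norm_sq).log (by simpa using hp)
    refine e2.congr_deriv ?_
    have hn : Complex.normSq (p.2 i) ≠ 0 := by simpa using hp
    rw [Complex.div_re, Complex.inner]
    simp only [Complex.ofReal_zero, zero_mul, add_zero, ← Complex.normSq_eq_norm_sq, Complex.mul_re,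
      Complex.conj_re, Complex.conj_im]
    field_simp
    ring
  refine ContinuousLinearMap.ext fun v => ?_
  have h4 : fderiv ℝ (fun p => Real.log (H p)) p v = 2 * (v.2 i / p.2 i).re +
      fderiv ℝ (projPot H i) (affineMap i p) (fderiv ℂ (affineMap i) p v) := by
    rw [h2, add_apply, h3, ContinuousLinearMap.comp_apply, fderiv_affineMap_real i hp]
    rfl
  have h5 : fderiv ℝ (fun p => Real.log (H p)) p (Complex.I • v) = -(2 * (v.2 i / p.2 i).im) +
      fderiv ℝ (projPot H i) (affineMap i p) (Complex.I • fderiv ℂ (affineMap i) p v) := by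
    rw [h2, add_apply, h3, ContinuousLinearMap.comp_apply, fderiv_affineMap_real i hp]
    simp only [ContinuousLinearMap.coe_restrictScalars', map_smul, Prod.smul_snd, PiLp.smul_apply,
      smul_eq_mul, mul_div_assoc, Complex.I_mul_re]
    ring
  rw [add_apply, smul_apply, ContinuousLinearMap.comp_apply, ContinuousLinearMap.comp_apply,
    holPart_apply, holPart_apply, h4, h5]
  have h6 := Complex.re_add_im (v.2 i / p.2 i)
  have h7 : (p.2 i)⁻¹ • (EuclideanSpace.proj i : Cn (k + 1) →L[ℂ] ℂ)
      (ContinuousLinearMap.snd ℂ (Cn d) (Cn (k + 1)) v) = v.2 i / p.2 i := by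
    rw [div_eq_inv_mul]; rfl
  rw [h7]
  push_cast
  linear_combination h6

end IsFibreMetric

end AffineCoordinates

/-! ### The Calabi ansatz in a trivialisation: decomposition and positivity. -/

section CalabiAnsatz

set_option synthInstance.maxHeartbeats 200000

open ProjBundle
open scoped ComplexOrder

variable {d k : ℕ}

/-- The functions of the Calabi ansatz: a potential `F`, its derivative `T` and the derivative `D` of
the momentum `s T(s)`. -/
structure IsProfile (F T D : ℝ → ℝ) : Prop where
  smoothF : ∀ s, 0 ≤ s → ContDiffAt ℝ ∞ F s
  smoothT : ∀ s, 0 ≤ s → ContDiffAt ℝ ∞ T s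
  derivF : ∀ s, 0 ≤ s → HasDerivAt F (T s) s
  T_pos : ∀ s, 0 ≤ s → 0 < T s
  deriv_momentum : ∀ s, 0 ≤ s → HasDerivAt (fun s => s * T s) (D s) s
  D_pos : ∀ s, 0 ≤ s → 0 < D s

/-- A Kähler form `A` on `U` and a Hermitian metric on the trivial bundle over `U` whose tautological
bundle has negative curvature. -/
structure IsKahlerData (U : Set (Cn d)) (A : Cn d → Cn d [⋀^Fin 2]→L[ℝ] ℝ)
    (H : Cn d × Cn (k + 1) → ℝ) : Prop extends IsFibreMetric U H where
  smoothA : ∀ z ∈ U, ContDiffAt ℝ ∞ A z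
  invA : ∀ z ∈ U, InvI (A z)
  posA : ∀ z ∈ U, ∀ v, v ≠ 0 → 0 < A z ![v, Complex.I • v]
  curv : ∀ p, p.1 ∈ U → p.2 ≠ 0 → ∀ v,
    0 ≤ ddbarV (fun p => Real.log (H p)) p ![v, Complex.I • v]

/-- The form `π^* A + i∂∂̄ F(H)`. -/
def totalForm (A : Cn d → Cn d [⋀^Fin 2]→L[ℝ] ℝ) (F : ℝ → ℝ) (H : Cn d × Cn (k + 1) → ℝ)
    (p : Cn d × Cn (k + 1)) : (Cn d × Cn (k + 1)) [⋀^Fin 2]→L[ℝ] ℝ :=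
  (A p.1).compContinuousLinearMap (ContinuousLinearMap.fst ℝ (Cn d) (Cn (k + 1))) +
    ddbarV (fun p => F (H p)) p

/-- The form `p^* A - s γ` in an affine chart of `P(E)`. -/
def projForm (A : Cn d → Cn d [⋀^Fin 2]→L[ℝ] ℝ) (H : Cn d × Cn (k + 1) → ℝ) (i : Fin (k + 1))
    (s : ℝ) (q : Cn d × Cn k) : (Cn d × Cn k) [⋀^Fin 2]→L[ℝ] ℝ :=
  (A q.1).compContinuousLinearMap (ContinuousLinearMap.fst ℝ (Cn d) (Cn k)) +
    s • ddbarV (projPot H i) q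

lemma totalForm_apply (A : Cn d → Cn d [⋀^Fin 2]→L[ℝ] ℝ) (F : ℝ → ℝ)
    (H : Cn d × Cn (k + 1) → ℝ) (p v w : Cn d × Cn (k + 1)) :
    totalForm A F H p ![v, w] = A p.1 ![v.1, w.1] + ddbarV (fun p => F (H p)) p ![v, w] := by
  rw [totalForm, ContinuousAlternatingMap.add_apply, form2_comp_apply]; rfl

lemma projForm_apply (A : Cn d → Cn d [⋀^Fin 2]→L[ℝ] ℝ) (H : Cn d × Cn (k + 1) → ℝ)
    (i : Fin (k + 1)) (s : ℝ) (q v w : Cn d × Cn k) :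
    projForm A H i s q ![v, w] = A q.1 ![v.1, w.1] + s * ddbarV (projPot H i) q ![v, w] := by
  rw [projForm, ContinuousAlternatingMap.add_apply, form2_comp_apply]; rfl

variable {U : Set (Cn d)} {A : Cn d → Cn d [⋀^Fin 2]→L[ℝ] ℝ} {H : Cn d × Cn (k + 1) → ℝ}
  {F T D : ℝ → ℝ}

/-- In the variable `t = log s` the first derivative of the potential is the momentum `τ`; the next
lemma identifies the second derivative with `φ = s D(s)`. -/
lemma IsProfile.deriv_comp_exp (hF : IsProfile F T D) :
    deriv (F ∘ Real.exp) = (fun s => s * T s) ∘ Real.exp := by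
  funext t
  have := ((hF.derivF _ (Real.exp_pos t).le).comp t (Real.hasDerivAt_exp t)).deriv
  rw [this, Function.comp_apply, mul_comm]

lemma IsProfile.deriv2_comp_exp (hF : IsProfile F T D) (t : ℝ) :
    deriv (deriv (F ∘ Real.exp)) t = Real.exp t * D (Real.exp t) := by
  rw [hF.deriv_comp_exp, mul_comm]
  exact ((hF.deriv_momentum _ (Real.exp_pos t).le).comp t (Real.hasDerivAt_exp t)).deriv

lemma IsProfile.smooth_momentum (hF : IsProfile F T D) {s : ℝ} (hs : 0 ≤ s) :
    ContDiffAt ℝ ∞ (fun s => s * T s) s := contDiffAt_id.mul (hF.smoothT s hs)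

namespace IsFibreMetric

variable (hH : IsFibreMetric U H) (hF : IsProfile F T D)
include hH hF

lemma contDiffAt_profile {p : Cn d × Cn (k + 1)} (hp : p.1 ∈ U) :
    ContDiffAt ℝ ∞ (fun p => F (H p)) p :=
  ContDiffAt.comp (g := F) p (hF.smoothF _ (hH.nonneg hp p.2)) (hH.smooth p hp)

lemma contDiffAt_momentum {p : Cn d × Cn (k + 1)} (hp : p.1 ∈ U) :
    ContDiffAt ℝ ∞ (fun p => H p * T (H p)) p :=
  ContDiffAt.comp (g := fun s => s * T s) p (hF.smooth_momentum (hH.nonneg hp p.2)) (hH.smooth p hp)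

/-- `F(H)` is a function of `t = log H`, so `i∂∂̄F(H) = τ i∂∂̄t + φ i∂t ∧ ∂̄t`. -/
lemma ddbarV_profile {p : Cn d × Cn (k + 1)} (hp : p.1 ∈ U) (hp2 : p.2 ≠ 0)
    (v w : Cn d × Cn (k + 1)) :
    ddbarV (fun p => F (H p)) p ![v, w] =
      H p * T (H p) * ddbarV (fun p => Real.log (H p)) p ![v, w] +
      H p * D (H p) * (2 * ((starRingEnd ℂ) (holPart (fderiv ℝ (fun p => Real.log (H p)) p) v) *
        holPart (fderiv ℝ (fun p => Real.log (H p)) p) w).im) := by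
  have hpos := hH.pos _ hp _ hp2
  have hc : ContDiffAt ℝ 2 (fun p => Real.log (H p)) p :=
    (hH.contDiffAt_log hp hp2).of_le two_le_infty
  have h1 : (fun p => F (H p)) =ᶠ[𝓝 p] (F ∘ Real.exp) ∘ (fun p => Real.log (H p)) := by
    filter_upwards [hH.mem_nhds hp, (continuous_snd.continuousAt (x := p)).eventually_ne hp2] with q hq hq2
    simp only [Function.comp_apply, Real.exp_log (hH.pos _ hq _ hq2)]
  have h2 : ContDiffAt ℝ 2 (F ∘ Real.exp) (Real.log (H p)) :=
    ((hF.smoothF _ (Real.exp_pos _).le).comp _ Real.contDiff_exp.contDiffAt).of_le two_le_infty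
  rw [ddbarV_congr h1, ddbarV_real_comp (F := F ∘ Real.exp) (t := fun p => Real.log (H p)) h2 hc,
    hF.deriv2_comp_exp, hF.deriv_comp_exp, Function.comp_apply, Real.exp_log hpos,
    two_mul_im_conj_holPart]

/-- Here `log H` is not available. As `dH = 0` on the zero section, only `F'(0) i∂∂̄H` survives. -/
lemma ddbarV_profile_zero {z : Cn d} (hz : z ∈ U) (v : Cn d × Cn (k + 1)) :
    ddbarV (fun p => F (H p)) (z, 0) ![v, Complex.I • v] = T 0 * (2 * H (z, v.2)) := by
  have h0 := hH.zero hz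
  have := ddbarV_real_comp (F := F) (t := H) (z := (z, 0))
    ((hF.smoothF _ h0.ge).of_le two_le_infty) ((hH.smooth (z, 0) hz).of_le two_le_infty) v
    (Complex.I • v)
  rw [hH.fderiv_zero hz, hH.ddbarV_zero hz, h0, (hF.derivF 0 le_rfl).deriv] at this
  simp only [zero_apply, mul_zero, sub_zero, add_zero] at this
  exact this

lemma fderiv_momentum {p : Cn d × Cn (k + 1)} (hp : p.1 ∈ U) (hp2 : p.2 ≠ 0)
    (v : Cn d × Cn (k + 1)) : fderiv ℝ (fun p => H p * T (H p)) p v =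
      H p * D (H p) * fderiv ℝ (fun p => Real.log (H p)) p v := by
  have hpos := hH.pos _ hp _ hp2
  have hd : HasFDerivAt H (fderiv ℝ H p) p :=
    ((hH.smooth p hp).differentiableAt (by simp)).hasFDerivAt
  have h1 := (hF.deriv_momentum _ hpos.le).comp_hasFDerivAt p hd
  have h2 := hd.log hpos.ne'
  have h1' : fderiv ℝ (fun p => H p * T (H p)) p = _ := h1.fderiv
  rw [h1', h2.fderiv]
  simp only [smul_apply, smul_eq_mul]
  field_simp

/-- The derivatives of `F(H)` in the directions of the fibre. -/
lemma fderiv_profile_vertical {p : Cn d × Cn (k + 1)} (hp : p.1 ∈ U) :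
    fderiv ℝ (fun p => F (H p)) p (0, p.2) = 2 * (H p * T (H p)) ∧
      fderiv ℝ (fun p => F (H p)) p (Complex.I • (0, p.2)) = 0 := by
  have hd : HasFDerivAt H (fderiv ℝ H p) p :=
    ((hH.smooth p hp).differentiableAt (by simp)).hasFDerivAt
  have h1 := ((hF.derivF _ (hH.nonneg hp p.2)).comp_hasFDerivAt p hd).fderiv
  have h1' : fderiv ℝ (fun p => F (H p)) p = _ := h1
  obtain ⟨e1, e2⟩ := hH.fderiv_vertical hp
  rw [h1', smul_apply, smul_apply, e1, e2]
  simp only [smul_eq_mul, mul_zero, and_true]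
  ring

end IsFibreMetric

namespace IsKahlerData

variable (hK : IsKahlerData U A H)
include hK

/-- The potential is `log H` restricted along the holomorphic section `(z, u) ↦ (z, homog i u)`, and
semipositivity is inherited by holomorphic pullback. -/
lemma ddbarV_projPot_nonneg (i : Fin (k + 1)) {q : Cn d × Cn k} (hq : q.1 ∈ U) (v : Cn d × Cn k) :
    0 ≤ ddbarV (projPot H i) q ![v, Complex.I • v] := by
  let σ : Cn d × Cn k → Cn d × Cn (k + 1) := fun q => (q.1, homog i q.2)
  have hσ : ContDiffAt ℂ 2 σ q :=
    contDiffAt_fst.prodMk ((contDiff_homog i).contDiffAt.comp q contDiffAt_snd)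
  have hl := hK.contDiffAt_log (p := σ q) hq (homog_ne_zero i q.2)
  have : ddbarV (projPot H i) q = _ :=
    ddbarV_comp (u := fun p => Real.log (H p)) (f := σ) (hl.of_le two_le_infty) hσ
  rw [this, form2_comp_apply, fderiv_restrictScalars_I (hσ.differentiableAt (by simp))]
  exact hK.curv (σ q) hq (homog_ne_zero i q.2) _

lemma invI_projForm (i : Fin (k + 1)) (s : ℝ) {q : Cn d × Cn k} (hq : q.1 ∈ U) :
    InvI (projForm A H i s q) :=
  ((hK.invA _ hq).comp (ContinuousLinearMap.fst ℂ (Cn d) (Cn k))).add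
    (InvI.smul (ddbarV_invariant ((hK.contDiffAt_projPot i hq).of_le two_le_infty)) s)

/-- A vector with nonzero base component is detected by `A`, the curvature term being semipositive;
a vertical vector is detected by the curvature along the fibre. -/
lemma projForm_pos (i : Fin (k + 1)) {s : ℝ} (hs : 0 < s) {q : Cn d × Cn k} (hq : q.1 ∈ U)
    {v : Cn d × Cn k} (hv : v ≠ 0) : 0 < projForm A H i s q ![v, Complex.I • v] := by
  rw [projForm_apply, Prod.smul_fst]
  rcases eq_or_ne v.1 0 with h1 | h1
  · have h2 : v.2 ≠ 0 := fun h2 => hv (Prod.ext h1 h2)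
    have hv' : v = (0, v.2) := Prod.ext h1 rfl
    have := hK.ddbarV_projPot_vertical_pos i hq q.2 h2
    rw [← hv'] at this
    have h0 : A q.1 ![v.1, Complex.I • v.1] = 0 := by
      rw [h1, smul_zero]; exact form2_self _ _
    rw [h0, zero_add]
    exact mul_pos hs this
  · exact add_pos_of_pos_of_nonneg (hK.posA _ hq _ h1)
      (mul_nonneg hs.le (hK.ddbarV_projPot_nonneg i hq v))

lemma det_projForm_pos (i : Fin (k + 1)) {s : ℝ} (hs : 0 < s) {q : Cn d × Cn k} (hq : q.1 ∈ U) :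
    0 < (hermMatrix (projForm A H i s q)).det :=
  det_hermMatrix_pos (hK.invI_projForm i s hq) fun _ hv => hK.projForm_pos i hs hq hv

variable (hF : IsProfile F T D)
include hF

/-- The `A`-term and the `τ`-term both factor through the projection to `P(E)`, since `affineMap i`
covers the identity of the base. -/
lemma totalForm_eq (i : Fin (k + 1)) {p : Cn d × Cn (k + 1)} (hp : p.1 ∈ U) (hpi : p.2 i ≠ 0)
    (v w : Cn d × Cn (k + 1)) :
    totalForm A F H p ![v, w] = projForm A H i (H p * T (H p)) (affineMap i p)
        ![fderiv ℂ (affineMap i) p v, fderiv ℂ (affineMap i) p w] +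
      H p * D (H p) * (2 * ((starRingEnd ℂ) (holPart (fderiv ℝ (fun p => Real.log (H p)) p) v) *
        holPart (fderiv ℝ (fun p => Real.log (H p)) p) w).im) := by
  have hp2 : p.2 ≠ 0 := fun h => hpi (by rw [h]; rfl)
  rw [totalForm_apply, hK.ddbarV_profile hF hp hp2, hK.ddbarV_log i hp hpi, form2_comp_apply,
    projForm_apply, fderiv_affineMap_real i hpi, ContinuousLinearMap.coe_restrictScalars',
    fderiv_affineMap i hpi, fderiv_affineMap i hpi, ← add_assoc]
  rfl

lemma invI_totalForm {p : Cn d × Cn (k + 1)} (hp : p.1 ∈ U) : InvI (totalForm A F H p) :=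
  ((hK.invA _ hp).comp (ContinuousLinearMap.fst ℂ (Cn d) (Cn (k + 1)))).add
    (ddbarV_invariant ((hK.contDiffAt_profile hF hp).of_le two_le_infty))

omit hK hF in
lemma im_conj_mul_I_smul (a : (Cn d × Cn (k + 1)) →L[ℂ] ℂ) (v : Cn d × Cn (k + 1)) :
    2 * ((starRingEnd ℂ) (a v) * a (Complex.I • v)).im = 2 * ‖a v‖ ^ 2 := by
  rw [map_smul, ← Complex.normSq_eq_norm_sq, Complex.normSq_apply]
  simp

lemma le_totalForm {p : Cn d × Cn (k + 1)} (hp : p.1 ∈ U) (hp2 : p.2 ≠ 0)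
    (v : Cn d × Cn (k + 1)) :
    H p * D (H p) * (2 * ‖holPart (fderiv ℝ (fun p => Real.log (H p)) p) v‖ ^ 2) ≤
      totalForm A F H p ![v, Complex.I • v] := by
  have hs := hK.pos _ hp _ hp2
  rw [totalForm_apply, hK.ddbarV_profile hF hp hp2, im_conj_mul_I_smul, Prod.smul_fst, ← add_assoc]
  refine le_add_of_nonneg_left (add_nonneg ?_ (mul_nonneg (mul_pos hs (hF.T_pos _ hs.le)).le
    (hK.curv p hp hp2 v)))
  rcases eq_or_ne v.1 0 with h1 | h1
  · rw [h1, smul_zero, form2_self]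
  · exact (hK.posA _ hp _ h1).le

/-- On the zero section, `A` handles the base directions and `T 0 · i∂∂̄H` the fibre. Elsewhere, a
vector killed by the projection to `P(E)` is a nonzero multiple of the Euler vector, on which `∂ log
H` does not vanish. -/
lemma totalForm_pos {p : Cn d × Cn (k + 1)} (hp : p.1 ∈ U) {v : Cn d × Cn (k + 1)} (hv : v ≠ 0) :
    0 < totalForm A F H p ![v, Complex.I • v] := by
  by_cases hp2 : p.2 = 0
  · obtain ⟨z, w⟩ := p
    obtain rfl : w = 0 := hp2
    rw [totalForm_apply, hK.ddbarV_profile_zero hF hp, Prod.smul_fst]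
    have hT := hF.T_pos 0 le_rfl
    rcases eq_or_ne v.1 0 with h1 | h1
    · have h2 : v.2 ≠ 0 := fun h2 => hv (Prod.ext h1 h2)
      have := hK.pos _ hp _ h2
      rw [h1, smul_zero, form2_self]
      simp only at this ⊢
      positivity
    · have := hK.posA _ hp _ h1
      have := hK.nonneg hp v.2
      simp only at this ⊢
      positivity
  · have hs := hK.pos _ hp _ hp2
    obtain ⟨i, hpi⟩ : ∃ i, p.2 i ≠ 0 := by
      by_contra! h
      exact hp2 (PiLp.ext h)
    rw [hK.totalForm_eq hF i hp hpi, im_conj_mul_I_smul, map_smul]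
    have hφ := mul_pos hs (hF.D_pos _ hs.le)
    have hτ := mul_pos hs (hF.T_pos _ hs.le)
    by_cases hdq : fderiv ℂ (affineMap i) p v = 0
    · have hva : holPart (fderiv ℝ (fun p => Real.log (H p)) p) v ≠ 0 := by
        have hv2 : v.2 i ≠ 0 := by
          intro h0
          refine hv ?_
          rw [eq_smul_of_fderiv_affineMap_eq_zero i hpi hdq, h0, zero_div, zero_smul]
        rw [hK.holPart_log i hp hpi, add_apply, ContinuousLinearMap.comp_apply, hdq, map_zero,
          add_zero]
        exact mul_ne_zero (inv_ne_zero hpi) hv2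
      rw [hdq, smul_zero, form2_self, zero_add]
      positivity
    · exact add_pos_of_pos_of_nonneg (hK.projForm_pos i hτ (q := affineMap i p) hp hdq)
        (by positivity)

lemma det_totalForm_pos {p : Cn d × Cn (k + 1)} (hp : p.1 ∈ U) :
    0 < (hermMatrix (totalForm A F H p)).det :=
  det_hermMatrix_pos (hK.invI_totalForm hF hp) fun _ hv => hK.totalForm_pos hF hp hv

/-- The differential of the momentum is bounded with respect to the metric. -/
lemma sq_fderiv_momentum_le {K : ℝ} (hD : ∀ s, 0 ≤ s → s * D s ≤ K) {p : Cn d × Cn (k + 1)}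
    (hp : p.1 ∈ U) (v : Cn d × Cn (k + 1)) :
    (fderiv ℝ (fun p => H p * T (H p)) p v) ^ 2 ≤
      2 * K * totalForm A F H p ![v, Complex.I • v] := by
  have hK0 : 0 ≤ K := by simpa using hD 0 le_rfl
  have hpos : 0 ≤ totalForm A F H p ![v, Complex.I • v] := by
    rcases eq_or_ne v 0 with rfl | hv
    · rw [smul_zero, form2_self]
    · exact (hK.totalForm_pos hF hp hv).le
  by_cases hp2 : p.2 = 0
  · obtain ⟨z, w⟩ := p
    obtain rfl : w = 0 := hp2
    have h0 := hK.zero hp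
    have hd : HasFDerivAt H (fderiv ℝ H (z, 0)) (z, 0) :=
      ((hK.smooth (z, 0) hp).differentiableAt (by simp)).hasFDerivAt
    have h1 := ((hF.deriv_momentum _ h0.ge).comp_hasFDerivAt _ hd).fderiv
    have h1' : fderiv ℝ (fun p => H p * T (H p)) (z, 0) = _ := h1
    rw [h1', hK.fderiv_zero hp]
    rw [smul_zero, zero_apply, zero_pow two_ne_zero]
    positivity
  · have hs := hK.pos _ hp _ hp2
    have hφ := mul_pos hs (hF.D_pos _ hs.le)
    have h1 := hK.le_totalForm hF hp hp2 v
    have hφK := hD _ hs.le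
    rw [hK.fderiv_momentum hF hp hp2]
    set φ := H p * D (H p)
    set L := fderiv ℝ (fun p => Real.log (H p)) p
    -- `L v` is twice the real part of `holPart L v`. With `dτ = φ L`, the bound `φ ≤ K` and the
    -- `φ`-term of the metric, this gives the constant `2K`.
    have h2 : (L v) ^ 2 ≤ 4 * ‖holPart L v‖ ^ 2 := by
      have hre : (holPart L v).re = L v / 2 := by simp [holPart_apply]
      rw [← Complex.normSq_eq_norm_sq, Complex.normSq_apply, hre]
      nlinarith [mul_self_nonneg (holPart L v).im]
    calc (φ * L v) ^ 2 = φ * (φ * (L v) ^ 2) := by ring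
      _ ≤ φ * (φ * (4 * ‖holPart L v‖ ^ 2)) := by gcongr
      _ = 2 * φ * (φ * (2 * ‖holPart L v‖ ^ 2)) := by ring
      _ ≤ 2 * φ * totalForm A F H p ![v, Complex.I • v] := by gcongr
      _ ≤ _ := by gcongr

end IsKahlerData

end CalabiAnsatz

/-! ### The polynomial `∏ (1 + (1 - x)β) = x^k R(x)`. -/

section MomentumPolynomial

set_option synthInstance.maxHeartbeats 200000

open ProjBundle Polynomial
open scoped ComplexOrder

/-- A complex polynomial which is real on the positive axis is real. -/
lemma exists_real_polynomial {P : ℂ[X]} (hP : ∀ x : ℝ, 0 < x → (P.eval (x : ℂ)).im = 0) :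
    ∃ Q : ℝ[X], ∀ x : ℝ, P.eval (x : ℂ) = (Q.eval x : ℝ) := by
  let Q : ℝ[X] := ∑ i ∈ Finset.range (P.natDegree + 1), C (P.coeff i).re * X ^ i
  have hQ : ∀ x : ℝ, Q.eval x = (P.eval (x : ℂ)).re := by
    intro x
    rw [Polynomial.eval_eq_sum_range (p := P), Complex.re_sum]
    simp only [Q, eval_finsetSum, eval_mul, eval_C, eval_pow, eval_X]
    refine Finset.sum_congr rfl fun i _ => ?_
    rw [← Complex.ofReal_pow, Complex.re_mul_ofReal]
  have hmap : ∀ x : ℝ, (Q.map Complex.ofRealHom).eval (x : ℂ) = (Q.eval x : ℝ) := fun x =>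
    Polynomial.eval_map_apply (f := Complex.ofRealHom) (p := Q) (x := x)
  have hPQ : P = Q.map Complex.ofRealHom := by
    -- Both polynomials agree on the positive real axis, an infinite set.
    refine Polynomial.eq_of_infinite_eval_eq _ _ ?_
    refine ((Set.Ioi_infinite (0 : ℝ)).image Complex.ofReal_injective.injOn).mono ?_
    rintro _ ⟨x, hx, rfl⟩
    change P.eval (x : ℂ) = (Q.map Complex.ofRealHom).eval (x : ℂ)
    rw [hmap, hQ]
    exact Complex.ext rfl (by simpa using hP x hx)
  exact ⟨Q, fun x => by rw [hPQ]; exact hmap x⟩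

/-- The order of vanishing at `0` of a polynomial, from its asymptotics. -/
lemma exists_eq_pow_mul_of_tendsto {Q : ℝ[X]} {k : ℕ} {g : ℝ → ℝ} (hg : ContinuousAt g 0)
    (hg0 : 0 < g 0) (h : ∀ σ : ℝ, 0 < σ → Q.eval (σ ^ 2) = σ ^ (2 * k) * g σ)
    (hpos : ∀ x : ℝ, 0 < x → 0 < Q.eval x) :
    ∃ R : ℝ[X], (∀ x, 0 ≤ x → 0 < R.eval x) ∧ ∀ x, Q.eval x = x ^ k * R.eval x := by
  have hQ0 : Q ≠ 0 := by
    rintro rfl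
    simpa using hpos 1 one_pos
  obtain ⟨R, hR, hR0⟩ := exists_eq_pow_rootMultiplicity_mul_and_not_dvd Q hQ0 0
  set n := Q.rootMultiplicity 0
  rw [C_0, sub_zero] at hR hR0
  rw [X_dvd_iff, coeff_zero_eq_eval_zero] at hR0
  have hev : ∀ x, Q.eval x = x ^ n * R.eval x := fun x => by rw [hR]; simp
  have hRc : Tendsto (fun σ : ℝ => R.eval (σ ^ 2)) (𝓝[>] 0) (𝓝 (R.eval 0)) := by
    have : Continuous fun σ : ℝ => R.eval (σ ^ 2) := by fun_prop
    have h := (this.tendsto 0).mono_left (nhdsWithin_le_nhds (s := Ioi 0))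
    simpa using h
  have hgc : Tendsto g (𝓝[>] 0) (𝓝 (g 0)) := hg.tendsto.mono_left nhdsWithin_le_nhds
  have hpow : ∀ m : ℕ, 0 < m → Tendsto (fun σ : ℝ => σ ^ m) (𝓝[>] 0) (𝓝 0) := by
    intro m hm
    have := ((continuous_pow m (M := ℝ)).tendsto 0).mono_left (nhdsWithin_le_nhds (s := Ioi 0))
    simpa [hm.ne'] using this
  have hkey : ∀ σ : ℝ, 0 < σ → σ ^ (2 * n) * R.eval (σ ^ 2) = σ ^ (2 * k) * g σ := fun σ hσ => by
    rw [← h σ hσ, hev, ← pow_mul]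
  have hnk : n = k := by
    -- If the orders differ, dividing by the smaller power of `σ` and letting `σ → 0` forces `R(0) =
    -- 0` or `g(0) = 0`.
    rcases lt_trichotomy n k with hlt | heq | hlt
    · exfalso
      refine hR0 (tendsto_nhds_unique hRc (b := 0) ?_)
      have h1 := (hpow (2 * (k - n)) (by omega)).mul hgc
      rw [zero_mul] at h1
      refine h1.congr' ?_
      filter_upwards [self_mem_nhdsWithin] with σ hσ
      have hσ' : (0 : ℝ) < σ := hσ
      refine mul_left_cancel₀ (pow_ne_zero (2 * n) hσ'.ne') ?_
      rw [hkey σ hσ, ← mul_assoc, ← pow_add]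
      congr 2
      omega
    · exact heq
    · exfalso
      refine hg0.ne' (tendsto_nhds_unique hgc (b := 0) ?_)
      have h1 := (hpow (2 * (n - k)) (by omega)).mul hRc
      rw [zero_mul] at h1
      refine h1.congr' ?_
      filter_upwards [self_mem_nhdsWithin] with σ hσ
      have hσ' : (0 : ℝ) < σ := hσ
      refine mul_left_cancel₀ (pow_ne_zero (2 * k) hσ'.ne') ?_
      rw [← hkey σ hσ, ← mul_assoc, ← pow_add]
      congr 2
      omega
  have hRpos : ∀ x, 0 < x → 0 < R.eval x := fun x hx => by
    have := hpos x hx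
    rw [hev] at this
    exact (mul_pos_iff_of_pos_left (pow_pos hx n)).1 this
  refine ⟨R, fun x hx => ?_, fun x => by rw [hev, hnk]⟩
  rcases hx.eq_or_lt with rfl | hx
  · refine lt_of_le_of_ne (ge_of_tendsto hRc ?_) (Ne.symm hR0)
    filter_upwards [self_mem_nhdsWithin] with σ hσ
    have hσ' : (0 : ℝ) < σ := hσ
    exact (hRpos _ (by positivity)).le
  · exact hRpos x hx

variable {d k : ℕ} {U : Set (Cn d)} {A : Cn d → Cn d [⋀^Fin 2]→L[ℝ] ℝ}
  {H : Cn d × Cn (k + 1) → ℝ}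

/-- The map `(a, b) ↦ (x a, y b)`. -/
def scaleMap {d k : ℕ} (x y : ℝ) : (Cn d × Cn k) →L[ℂ] (Cn d × Cn k) :=
  ((x : ℂ) • ContinuousLinearMap.id ℂ (Cn d)).prodMap ((y : ℂ) • ContinuousLinearMap.id ℂ (Cn k))

lemma scaleMap_apply {d k : ℕ} (x y : ℝ) (v : Cn d × Cn k) :
    scaleMap x y v = (x • v.1, y • v.2) := by
  simp [scaleMap]
  rfl

lemma det_scaleMap {d k : ℕ} (y : ℝ) :
    LinearMap.det (scaleMap 1 y : (Cn d × Cn k) →L[ℂ] (Cn d × Cn k)).toLinearMap = (y : ℂ) ^ k := by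
  have : (scaleMap 1 y : (Cn d × Cn k) →L[ℂ] (Cn d × Cn k)).toLinearMap =
      (LinearMap.id : Cn d →ₗ[ℂ] Cn d).prodMap ((y : ℂ) • (LinearMap.id : Cn k →ₗ[ℂ] Cn k)) := by
    ext v <;> simp [scaleMap]
  rw [this, LinearMap.det_prodMap, LinearMap.det_id, LinearMap.det_smul, LinearMap.det_id]
  simp

/-- The product is the ratio of the determinants of `p^*A - xγ` and `p^*A - γ`, hence real and
positive for `x > 0`. Its order at `0` comes from scaling: with `x = σ²`, dilating the fibre
directions by `σ⁻¹` divides the determinant by `σ^{2k}` and turns the form into `L σ`, which still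
makes sense at `σ = 0` and is positive there. So the order is exactly `k`. -/
lemma IsKahlerData.exists_momentum_polynomial (hK : IsKahlerData U A H) (i : Fin (k + 1))
    {q : Cn d × Cn k} (hq : q.1 ∈ U) {β : Multiset ℂ}
    (hβ : ∀ s : ℝ, (hermMatrix (projForm A H i (1 - s) q)).det =
      (hermMatrix (projForm A H i 1 q)).det * (β.map fun b => 1 + (s : ℂ) * b).prod) :
    ∃ R : ℝ[X], (∀ x, 0 ≤ x → 0 < R.eval x) ∧ ∀ x : ℝ,
      (β.map fun b => 1 + ((1 - x : ℝ) : ℂ) * b).prod = ((x ^ k * R.eval x : ℝ) : ℂ) := by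
  let P : ℂ[X] := (β.map fun b => C 1 + (C 1 - X) * C b).prod
  have hP : ∀ x : ℝ, P.eval (x : ℂ) = (β.map fun b => 1 + ((1 - x : ℝ) : ℂ) * b).prod := by
    intro x
    simp only [P, eval_multiset_prod, Multiset.map_map, Function.comp_def]
    simp
  have h1 := hK.det_projForm_pos i one_pos hq
  set d1 := (hermMatrix (projForm A H i 1 q)).det with hd1
  have hd1r : d1 = (d1.re : ℂ) := Complex.ext rfl (by simpa using (Complex.pos_iff.1 h1).2.symm)
  have hd1p : 0 < d1.re := re_pos_of_pos h1
  have hPd : ∀ x : ℝ, (hermMatrix (projForm A H i x q)).det = d1 * P.eval (x : ℂ) := by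
    intro x
    rw [hP, ← hβ, sub_sub_cancel]
  have hPr : ∀ x : ℝ, 0 < x → (P.eval (x : ℂ)).im = 0 := by
    intro x hx
    have h2 := Complex.pos_iff.1 (hK.det_projForm_pos i hx hq)
    rw [hPd, hd1r, Complex.im_ofReal_mul] at h2
    exact (mul_eq_zero.1 h2.2.symm).resolve_left hd1p.ne'
  obtain ⟨Q, hQ⟩ := exists_real_polynomial hPr
  have hPdr : ∀ x : ℝ, (hermMatrix (projForm A H i x q)).det = ((d1.re * Q.eval x : ℝ) : ℂ) := by
    intro x
    rw [hPd, hQ, hd1r]; push_cast; simp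
  have hQpos : ∀ x : ℝ, 0 < x → 0 < Q.eval x := by
    intro x hx
    have h2 := re_pos_of_pos (hK.det_projForm_pos i hx hq)
    rw [hPdr, Complex.ofReal_re] at h2
    exact (mul_pos_iff_of_pos_left hd1p).1 h2
  -- rescaling in the directions of the fibre
  let L : ℝ → (Cn d × Cn k) [⋀^Fin 2]→L[ℝ] ℝ := fun σ =>
    (A q.1).compContinuousLinearMap
      ((ContinuousLinearMap.fst ℂ (Cn d) (Cn k)).restrictScalars ℝ) +
    (ddbarV (projPot H i) q).compContinuousLinearMap ((scaleMap σ 1).restrictScalars ℝ)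
  have hL : ∀ σ v w, L σ ![v, w] = A q.1 ![v.1, w.1] +
      ddbarV (projPot H i) q ![(σ • v.1, v.2), (σ • w.1, w.2)] := by
    intro σ v w
    simp only [L]
    rw [ContinuousAlternatingMap.add_apply, form2_comp_apply, form2_comp_apply]
    simp only [ContinuousLinearMap.coe_restrictScalars', scaleMap_apply, one_smul]
    rfl
  have hddI : InvI (ddbarV (projPot H i) q) :=
    ddbarV_invariant ((hK.contDiffAt_projPot i hq).of_le two_le_infty)
  have hLI : ∀ σ, InvI (L σ) := fun σ => ((hK.invA _ hq).comp _).add (hddI.comp _)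
  have hLdet : ∀ σ : ℝ, 0 < σ → (hermMatrix (L σ)).det =
      (((σ⁻¹ ^ k) ^ 2 * (d1.re * Q.eval (σ ^ 2)) : ℝ) : ℂ) := by
    intro σ hσ
    have e1 : L σ = (projForm A H i (σ ^ 2) q).compContinuousLinearMap
        ((scaleMap 1 σ⁻¹).restrictScalars ℝ) := by
      refine form2_ext fun v w => ?_
      rw [hL, form2_comp_apply, projForm_apply]
      simp only [ContinuousLinearMap.coe_restrictScalars', scaleMap_apply, one_smul]
      have e2 : ∀ v : Cn d × Cn k, (σ • v.1, v.2) = σ • (v.1, σ⁻¹ • v.2) := fun v => by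
        simp [smul_smul, hσ.ne']
      rw [e2 v, e2 w, form2_smul_left, form2_smul_right]
      ring
    rw [e1, det_hermMatrix_comp (hK.invI_projForm i _ hq), det_scaleMap, hPdr]
    push_cast
    simp [abs_of_pos hσ]
  -- At `σ = 0` base and fibre decouple: `A` on the base and the curvature on the fibre, where it is
  -- strictly positive.
  have hL0 : 0 < (hermMatrix (L 0)).det := by
    refine det_hermMatrix_pos (hLI 0) fun v hv => ?_
    rw [hL, zero_smul, zero_smul, Prod.smul_fst]
    by_cases h1 : v.1 = 0
    · have h2 : v.2 ≠ 0 := fun h2 => hv (Prod.ext h1 h2)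
      have := hK.ddbarV_projPot_vertical_pos i hq q.2 h2
      rw [h1, smul_zero, form2_self, zero_add]
      simpa using this
    · have h2 := hK.ddbarV_projPot_nonneg i hq ((0 : Cn d), v.2)
      refine add_pos_of_pos_of_nonneg (hK.posA _ hq _ h1) ?_
      simpa using h2
  have hLc : Continuous fun σ => (hermMatrix (L σ)).det := by
    refine Continuous.matrix_det (continuous_matrix fun a b => ?_)
    have key : ∀ v w : Cn d × Cn k, Continuous fun σ => (L σ ![v, w] : ℂ) := by
      intro v w
      simp only [hL]
      refine Complex.continuous_ofReal.comp (continuous_const.add ?_)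
      refine (ddbarV (projPot H i) q).cont.comp (continuous_pi fun j => ?_)
      fin_cases j
      · exact (continuous_id.smul continuous_const).prodMk continuous_const
      · exact (continuous_id.smul continuous_const).prodMk continuous_const
    exact ((key _ _).sub (continuous_const.mul (key _ _))).div_const 2
  have hg : ∀ σ : ℝ, 0 < σ → Q.eval (σ ^ 2) =
      σ ^ (2 * k) * (d1.re⁻¹ * (hermMatrix (L σ)).det.re) := by
    intro σ hσ
    have h1 : σ ^ (2 * k) * (σ⁻¹ ^ k) ^ 2 = 1 := by
      rw [← pow_mul, mul_comm k 2, ← mul_pow, mul_inv_cancel₀ hσ.ne', one_pow]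
    have h2 : d1.re⁻¹ * d1.re = 1 := inv_mul_cancel₀ hd1p.ne'
    rw [hLdet σ hσ, Complex.ofReal_re]
    linear_combination (-(Q.eval (σ ^ 2))) * h1 -
      (Q.eval (σ ^ 2)) * (σ ^ (2 * k) * (σ⁻¹ ^ k) ^ 2) * h2
  obtain ⟨R, hR, hQR⟩ := exists_eq_pow_mul_of_tendsto
    (continuous_const.mul (Complex.continuous_re.comp hLc)).continuousAt
    (mul_pos (inv_pos.2 hd1p) (re_pos_of_pos hL0)) hg hQpos
  exact ⟨R, hR, fun x => by rw [← hP, hQ, hQR]⟩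

end MomentumPolynomial

/-! ### The Ricci form of the ansatz in a trivialisation. -/

section LocalRicci

set_option synthInstance.maxHeartbeats 200000

open ProjBundle Polynomial
open scoped ComplexOrder

lemma contDiffAt_det {X : Type*} {𝕜 : Type*} [NontriviallyNormedField 𝕜] [NormedAlgebra 𝕜 ℂ]
    [NormedAddCommGroup X] [NormedSpace 𝕜 X] {n : ℕ∞ω}
    {ι : Type*} [Fintype ι] [DecidableEq ι] {M : X → Matrix ι ι ℂ} {x : X}
    (h : ∀ i j, ContDiffAt 𝕜 n (fun x => M x i j) x) : ContDiffAt 𝕜 n (fun x => (M x).det) x := by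
  simp_rw [Matrix.det_apply']
  exact ContDiffAt.sum fun σ _ => contDiffAt_const.mul (contDiffAt_prod fun j _ => h _ _)

lemma contDiffAt_det_hermMatrix {X : Type*} [NormedAddCommGroup X] [NormedSpace ℝ X]
    {V : Type*} [NormedAddCommGroup V] [NormedSpace ℂ V] [FiniteDimensional ℂ V] {n : ℕ∞ω}
    {α : X → V [⋀^Fin 2]→L[ℝ] ℝ} {x : X} (hα : ContDiffAt ℝ n α x) :
    ContDiffAt ℝ n (fun x => (hermMatrix (α x)).det) x := by
  refine contDiffAt_det fun i j => ?_
  have key : ∀ v : Fin 2 → V, ContDiffAt ℝ n (fun x => ((α x v : ℝ) : ℂ)) x := fun v =>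
    (Complex.ofRealCLM.contDiff.comp
      (ContinuousAlternatingMap.apply ℝ V ℝ v).contDiff).contDiffAt.comp x hα
  exact ((key _).sub (contDiffAt_const.mul (key _))).div_const 2

variable {d k : ℕ} {U : Set (Cn d)} {A : Cn d → Cn d [⋀^Fin 2]→L[ℝ] ℝ}
  {H : Cn d × Cn (k + 1) → ℝ} {F T D : ℝ → ℝ}

lemma contDiffAt_form_comp_fst {E E' : Type*} [NormedAddCommGroup E] [NormedSpace ℝ E]
    [NormedAddCommGroup E'] [NormedSpace ℝ E'] {n : ℕ∞ω} {A : E → E [⋀^Fin 2]→L[ℝ] ℝ} {q : E × E'}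
    (hA : ContDiffAt ℝ n A q.1) : ContDiffAt ℝ n (fun q : E × E' =>
      (A q.1).compContinuousLinearMap (ContinuousLinearMap.fst ℝ E E')) q := by
  let c : (E [⋀^Fin 2]→L[ℝ] ℝ) →L[ℝ] ((E × E') [⋀^Fin 2]→L[ℝ] ℝ) :=
    ContinuousAlternatingMap.compContinuousLinearMapCLM (ContinuousLinearMap.fst ℝ E E')
  exact c.contDiff.contDiffAt.comp q (ContDiffAt.comp (g := A) q hA contDiffAt_fst)

namespace IsKahlerData

variable (hK : IsKahlerData U A H)
include hK

lemma contDiffAt_projForm (i : Fin (k + 1)) (s : ℝ) {q : Cn d × Cn k} (hq : q.1 ∈ U) :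
    ContDiffAt ℝ ∞ (projForm A H i s) q := by
  have h1 : ContDiffAt ℝ ∞ (fun q : Cn d × Cn k => (A q.1).compContinuousLinearMap
      (ContinuousLinearMap.fst ℝ (Cn d) (Cn k))) q :=
    contDiffAt_form_comp_fst (hK.smoothA q.1 hq)
  exact h1.add ((contDiffAt_ddbarV (hK.contDiffAt_projPot i hq)).const_smul s)

variable (hF : IsProfile F T D)
include hF

lemma contDiffAt_totalForm {p : Cn d × Cn (k + 1)} (hp : p.1 ∈ U) :
    ContDiffAt ℝ ∞ (totalForm A F H) p := by
  have h1 : ContDiffAt ℝ ∞ (fun q : Cn d × Cn (k + 1) => (A q.1).compContinuousLinearMap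
      (ContinuousLinearMap.fst ℝ (Cn d) (Cn (k + 1)))) p :=
    contDiffAt_form_comp_fst (hK.smoothA p.1 hp)
  exact h1.add (contDiffAt_ddbarV (hK.contDiffAt_profile hF hp))

/-- The Ricci potential. -/
lemma contDiffAt_log_det_totalForm {p : Cn d × Cn (k + 1)} (hp : p.1 ∈ U) :
    ContDiffAt ℝ ∞ (fun p => Real.log (hermMatrix (totalForm A F H p)).det.re) p :=
  (Complex.reCLM.contDiff.contDiffAt.comp p
    (contDiffAt_det_hermMatrix (hK.contDiffAt_totalForm hF hp))).log
    (re_pos_of_pos (hK.det_totalForm_pos hF hp)).ne'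

/-- The determinant formula for `p^*A - τγ` plus a rank one term, with `a₀ = dp_i/p_i`. This form
and the derivative of `affineMap i` are holomorphic in `p`, so `g` is holomorphic and invisible to
`i∂∂̄ log`. -/
lemma exists_det_totalForm_eq (i : Fin (k + 1)) :
    ∃ g : Cn d × Cn (k + 1) → ℂ, (∀ p, p.2 i ≠ 0 → ContDiffAt ℂ 2 g p) ∧
      ∀ p, p.1 ∈ U → p.2 i ≠ 0 → (hermMatrix (totalForm A F H p)).det =
        ((‖g p‖ ^ 2 * (H p * D (H p)) : ℝ) : ℂ) *
          (hermMatrix (projForm A H i (H p * T (H p)) (affineMap i p))).det := by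
  obtain ⟨N, hN, hdet⟩ := exists_det_hermMatrix_add_wedge (V := Cn d × Cn (k + 1))
    (W := Cn d × Cn k) (by simp [add_assoc])
  let a₀ : Cn d × Cn (k + 1) → (Cn d × Cn (k + 1) →L[ℂ] ℂ) := fun p =>
    (p.2 i)⁻¹ • (EuclideanSpace.proj i).comp (ContinuousLinearMap.snd ℂ (Cn d) (Cn (k + 1)))
  refine ⟨fun p => (N (fderiv ℂ (affineMap i) p) (a₀ p)).det, fun p hp => ?_, fun p hp hpi => ?_⟩
  · refine contDiffAt_det fun a b => ?_
    obtain ⟨l, hl⟩ := hN a b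
    simp only [hl]
    refine l.contDiff.contDiffAt.comp p (ContDiffAt.prodMk ?_ ?_)
    · exact (contDiffAt_affineMap (n := 3) i hp).fderiv_right (by norm_num)
    · exact ((contDiffAt_coord i p).inv hp).smul contDiffAt_const
  · exact hdet _ _ _ _ (a₀ p) _ _ (hK.invI_projForm i _ (q := affineMap i p) hp)
      (hK.holPart_log i hp hpi) (hK.totalForm_eq hF i hp hpi)

/-- The Ricci form of the Calabi ansatz away from the zero section. -/
lemma ddbarV_log_det_totalForm (i : Fin (k + 1)) {μ : ℝ} {Q : ℝ → ℝ}
    (hQ : ∀ s, 0 ≤ s → Q (s * T s) * (s * D s) =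
      (k + 1) * s ^ (k + 1) * Real.exp (μ * (s * T s)))
    {p₀ : Cn d × Cn (k + 1)} (hp₀ : p₀.1 ∈ U) (hpi₀ : p₀.2 i ≠ 0)
    (heig : ∀ q : Cn d × Cn k, q.1 ∈ U → ∀ τ : ℝ, (hermMatrix (projForm A H i τ q)).det =
      (hermMatrix (projForm A H i 1 q)).det * (Q τ : ℝ))
    (hric : ddbarV (fun q => Real.log (hermMatrix (projForm A H i 1 q)).det.re) (affineMap i p₀) +
      ((k + 1 : ℕ) : ℝ) • ddbarV (projPot H i) (affineMap i p₀) = 0) :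
    ddbarV (fun p => Real.log (hermMatrix (totalForm A F H p)).det.re) p₀ =
      μ • ddbarV (fun p => H p * T (H p)) p₀ := by
  obtain ⟨g, hg, hdet⟩ := hK.exists_det_totalForm_eq hF i
  let P₁ : Cn d × Cn k → ℝ := fun q => Real.log (hermMatrix (projForm A H i 1 q)).det.re
  let P : Cn d × Cn k → ℝ := fun q => P₁ q + ((k + 1 : ℕ) : ℝ) * projPot H i q
  -- The equation for the profile replaces `Q(τ) φ` by `(k+1) s^{k+1} e^{μτ}`. What is left is
  -- pluriharmonic, except for `μτ` and `P`, the combination that the Ricci hypothesis makes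
  -- pluriharmonic at the image of `p₀`.
  have hmain : ∀ p : Cn d × Cn (k + 1), p.1 ∈ U → p.2 i ≠ 0 → g p ≠ 0 ∧
      Real.log (hermMatrix (totalForm A F H p)).det.re =
      (((Real.log (‖g p‖ ^ 2) + ((k + 1 : ℕ) : ℝ) * Real.log (‖p.2 i‖ ^ 2)) +
        (P ∘ affineMap i) p) + μ * (H p * T (H p))) + Real.log (k + 1) := by
    intro p hp hpi
    have hp2 : p.2 ≠ 0 := fun h => hpi (by rw [h]; rfl)
    have hs := hK.pos _ hp _ hp2
    have hm : (0 : ℝ) < (hermMatrix (projForm A H i 1 (affineMap i p))).det.re :=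
      re_pos_of_pos (hK.det_projForm_pos i one_pos (q := affineMap i p) hp)
    have e1 : (hermMatrix (totalForm A F H p)).det.re = ‖g p‖ ^ 2 *
        ((k + 1) * H p ^ (k + 1) * Real.exp (μ * (H p * T (H p)))) *
          (hermMatrix (projForm A H i 1 (affineMap i p))).det.re := by
      rw [hdet p hp hpi, heig _ hp, ← hQ _ hs.le, mul_comm (Matrix.det _), ← mul_assoc,
        ← Complex.ofReal_mul, Complex.re_ofReal_mul]
      ring
    have hpos := re_pos_of_pos (hK.det_totalForm_pos hF hp)
    have hgp : g p ≠ 0 := by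
      intro h0
      rw [e1, h0] at hpos
      simp at hpos
    refine ⟨hgp, ?_⟩
    have hk : (0 : ℝ) < k + 1 := by positivity
    rw [e1, Real.log_mul (by positivity) hm.ne', Real.log_mul (by positivity) (by positivity),
      Real.log_mul (by positivity) (Real.exp_ne_zero _), Real.log_exp,
      Real.log_mul (by positivity) (by positivity), Real.log_pow (H p) (k + 1), hK.log_eq i hp hpi]
    simp only [P, P₁, Function.comp_apply]
    push_cast
    ring
  have hev : (fun p => Real.log (hermMatrix (totalForm A F H p)).det.re) =ᶠ[𝓝 p₀] fun p =>
      (((Real.log (‖g p‖ ^ 2) + ((k + 1 : ℕ) : ℝ) * Real.log (‖p.2 i‖ ^ 2)) +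
        (P ∘ affineMap i) p) + μ * (H p * T (H p))) + Real.log (k + 1) := by
    filter_upwards [hK.mem_nhds hp₀,
      (contDiffAt_coord (n := 0) i p₀).continuousAt.eventually_ne hpi₀] with p hp hpi
    exact (hmain p hp hpi).2
  have hq₀ : (affineMap i p₀).1 ∈ U := hp₀
  have hgc := hg p₀ hpi₀
  have c1 : ContDiffAt ℝ 2 (fun p => Real.log (‖g p‖ ^ 2)) p₀ :=
    ((hgc.restrict_scalars ℝ).norm_sq ℝ).log (by simpa using (hmain p₀ hp₀ hpi₀).1)
  have c2 : ContDiffAt ℝ 2 (fun p : Cn d × Cn (k + 1) =>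
      ((k + 1 : ℕ) : ℝ) * Real.log (‖p.2 i‖ ^ 2)) p₀ :=
    contDiffAt_const.mul ((IsFibreMetric.contDiffAt_log_coord i hpi₀).of_le two_le_infty)
  have cP₁ : ContDiffAt ℝ 2 P₁ (affineMap i p₀) :=
    ((Complex.reCLM.contDiff.contDiffAt.comp _
      (contDiffAt_det_hermMatrix (hK.contDiffAt_projForm i 1 hq₀))).log
      (re_pos_of_pos (hK.det_projForm_pos i one_pos hq₀)).ne').of_le two_le_infty
  have cpot : ContDiffAt ℝ 2 (projPot H i) (affineMap i p₀) :=
    (hK.contDiffAt_projPot i hq₀).of_le two_le_infty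
  have cP : ContDiffAt ℝ 2 P (affineMap i p₀) := cP₁.add (contDiffAt_const.mul cpot)
  have ca := contDiffAt_affineMap (n := 2) i hpi₀
  have cPa : ContDiffAt ℝ 2 (P ∘ affineMap i) p₀ :=
    ContDiffAt.comp (g := P) p₀ cP (ca.restrict_scalars ℝ)
  have cτ : ContDiffAt ℝ 2 (fun p => μ * (H p * T (H p))) p₀ :=
    contDiffAt_const.mul ((hK.contDiffAt_momentum hF hp₀).of_le two_le_infty)
  have hP0 : ddbarV P (affineMap i p₀) = 0 := by
    rw [ddbarV_add cP₁ (contDiffAt_const.mul cpot), ddbarV_const_mul]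
    exact hric
  have hPa : ddbarV (P ∘ affineMap i) p₀ = 0 := by
    rw [ddbarV_comp (u := P) (f := affineMap i) cP ca, hP0]
    rfl
  rw [ddbarV_congr hev, ddbarV_add (((c1.add c2).add cPa).add cτ) contDiffAt_const,
    ddbarV_add ((c1.add c2).add cPa) cτ, ddbarV_add (c1.add c2) cPa, ddbarV_add c1 c2,
    ddbarV_log_norm_sq hgc (hmain p₀ hp₀ hpi₀).1, ddbarV_const_mul, ddbarV_const_mul,
    ddbarV_log_norm_sq (contDiffAt_coord i p₀) hpi₀, hPa, ddbarV_const]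
  simp

/-- An identity of Ricci forms which holds off the zero section holds everywhere. -/
lemma ddbarV_log_det_totalForm_of_ne_zero {μ : ℝ} {z : Cn d} (hz : z ∈ U)
    (h : ∀ w : Cn (k + 1), w ≠ 0 →
      ddbarV (fun p => Real.log (hermMatrix (totalForm A F H p)).det.re) (z, w) =
        μ • ddbarV (fun p => H p * T (H p)) (z, w)) (w : Cn (k + 1)) :
    ddbarV (fun p => Real.log (hermMatrix (totalForm A F H p)).det.re) (z, w) =
      μ • ddbarV (fun p => H p * T (H p)) (z, w) := by
  by_cases hw : w = 0
  · subst hw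
    have hc : ContinuousAt (fun w : Cn (k + 1) => (z, w)) 0 :=
      continuousAt_const.prodMk continuousAt_id
    have h1 : ContinuousAt (fun w : Cn (k + 1) =>
        ddbarV (fun p => Real.log (hermMatrix (totalForm A F H p)).det.re) (z, w)) 0 :=
      ContinuousAt.comp (g := ddbarV (fun p => Real.log (hermMatrix (totalForm A F H p)).det.re))
        (f := fun w : Cn (k + 1) => (z, w))
        (contDiffAt_ddbarV (hK.contDiffAt_log_det_totalForm hF (p := (z, 0)) hz)).continuousAt hc
    have h2 : ContinuousAt (fun w : Cn (k + 1) =>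
        μ • ddbarV (fun p => H p * T (H p)) (z, w)) 0 :=
      (ContinuousAt.comp (g := ddbarV (fun p => H p * T (H p)))
        (f := fun w : Cn (k + 1) => (z, w))
        (contDiffAt_ddbarV (hK.contDiffAt_momentum hF (p := (z, 0)) hz)).continuousAt hc).const_smul μ
    have h3 := h1.tendsto.mono_left (nhdsWithin_le_nhds (s := {0}ᶜ))
    have h4 := h2.tendsto.mono_left (nhdsWithin_le_nhds (s := {0}ᶜ))
    -- The fibre has positive dimension `k + 1`, so `0` is a limit of nonzero vectors and both
    -- continuous sides agree there.
    have : (𝓝[≠] (0 : Cn (k + 1))).NeBot := Module.punctured_nhds_neBot ℂ _ 0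
    refine tendsto_nhds_unique h3 (h4.congr' ?_)
    filter_upwards [self_mem_nhdsWithin] with w hw
    exact (h w hw).symm
  · exact h w hw

end IsKahlerData

end LocalRicci

/-! ### Smoothness and positivity in charts. -/

section Forms

set_option synthInstance.maxHeartbeats 200000
set_option linter.unusedSectionVars false

variable {V : Type*} [NormedAddCommGroup V] [NormedSpace ℂ V]
  {H : Type*} [TopologicalSpace H] {I : ModelWithCorners ℂ V H} [I.Boundaryless]
  {N : Type*} [TopologicalSpace N] [ChartedSpace H N] [IsManifold I ω N]

lemma contMDiffAt_realModel_iff {n : ℕ∞ω} {X : Type*} [NormedAddCommGroup X] [NormedSpace ℝ X]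
    {u : N → X} {x : N} (hc : ContinuousAt u x) :
    ContMDiffAt (realModel I) 𝓘(ℝ, X) n u x ↔
      ContDiffAt ℝ n (u ∘ (extChartAt I x).symm) (extChartAt I x x) := by
  have hr : range (realModel I) = univ := I.range_eq_univ
  rw [contMDiffAt_iff, hr, contDiffWithinAt_univ]
  exact ⟨fun h => h.2, fun h => ⟨hc, h⟩⟩

lemma smoothInCharts_of_contMDiff {u : N → ℝ} (hu : ContMDiff (realModel I) 𝓘(ℝ, ℝ) ∞ u) :
    SmoothInCharts I u := by
  intro c z hz
  have h := hu ((extChartAt I c).symm z)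
  exact contDiffAt_comp_symm c _ hz (mem_extChartAt_source _)
    ((contMDiffAt_realModel_iff h.continuousAt).1 h)

lemma SmoothInCharts.continuousAt {u : N → ℝ} (hu : SmoothInCharts I u) (x : N) :
    ContinuousAt u x := by
  have h1 := (hu x _ (mem_extChartAt_target x)).continuousAt
  have h2 : ContinuousAt ((u ∘ (extChartAt I x).symm) ∘ extChartAt I x) x :=
    ContinuousAt.comp h1 (continuousAt_extChartAt x)
  refine h2.congr ?_
  filter_upwards [extChartAt_source_mem_nhds (I := I) x] with y hy
  simp only [Function.comp_apply, (extChartAt I x).left_inv hy]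

lemma SmoothInCharts.contMDiff {u : N → ℝ} (hu : SmoothInCharts I u) :
    ContMDiff (realModel I) 𝓘(ℝ, ℝ) ∞ u := fun x =>
  (contMDiffAt_realModel_iff (hu.continuousAt x)).2 (hu x _ (mem_extChartAt_target x))

lemma InvI.inChart {η : Form V N 2} (hη : ∀ x, InvI (η x)) (c : N) (z : V) :
    InvI (inChart I η c z) := (hη _).comp _

/-- Tangent coordinate changes are complex linear and invertible, so positivity passes to every
chart. -/
lemma inChart_pos {η : Form V N 2} (hη : ∀ x (v : V), v ≠ 0 → 0 < η x ![v, Complex.I • v]) (c : N)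
    {z : V} (hz : z ∈ (extChartAt I c).target) {v : V} (hv : v ≠ 0) :
    0 < inChart I η c z ![v, Complex.I • v] := by
  set p := (extChartAt I c).symm z
  have hp : p ∈ (extChartAt I c).source := (extChartAt I c).map_target hz
  have h1 : tangentCoordChange I p c p (tangentCoordChange I c p p v) = v := by
    rw [tangentCoordChange_comp ⟨⟨hp, mem_extChartAt_source p⟩, hp⟩, tangentCoordChange_self hp]
  have h2 : tangentCoordChange I c p p v ≠ 0 := by
    intro h0
    rw [h0, map_zero] at h1
    exact hv h1.symm
  rw [inChart, form2_comp_apply]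
  simp only [ContinuousLinearMap.coe_restrictScalars', map_smul]
  exact hη _ _ h2

lemma contDiffAt_inChart {k : ℕ} {η : Form V N k} (hη : IsSmoothForm I η) (c : N) {z : V}
    (hz : z ∈ (extChartAt I c).target) : ContDiffAt ℝ ∞ (inChart I η c) z :=
  (hη c).contDiffAt (eventually_mem_target I c hz)

end Forms

/-! ### Charts of the total space of `E`. -/

section BundleCharts

set_option linter.unusedSectionVars false

open ProjBundle

variable {d k : ℕ} {D : Type*} [TopologicalSpace D] [ChartedSpace (Cn d) D]
  {E : D → Type*} [∀ x, AddCommGroup (E x)] [∀ x, Module ℂ (E x)]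
  [TopologicalSpace (TotalSpace (Cn (k + 1)) E)] [∀ x, TopologicalSpace (E x)]
  [FiberBundle (Cn (k + 1)) E] [VectorBundle ℂ (Cn (k + 1)) E]

variable (d k E) in
/-- The domain in `ℂ^d` on which the preferred trivialisation of `E` at `x₀` is defined. -/
def bundleDomain (x₀ : D) : Set (Cn d) :=
  (chartAt (Cn d) x₀).target ∩
    (chartAt (Cn d) x₀).symm ⁻¹' (trivializationAt (Cn (k + 1)) E x₀).baseSet

variable (d k E) in
/-- The vector of `E` with given coordinates. -/
def localVec (x₀ : D) (p : Cn d × Cn (k + 1)) : TotalSpace (Cn (k + 1)) E :=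
  ⟨(chartAt (Cn d) x₀).symm p.1, ofCoord k E x₀ ((chartAt (Cn d) x₀).symm p.1) p.2⟩

lemma isOpen_bundleDomain (x₀ : D) : IsOpen (bundleDomain d k E x₀) :=
  (chartAt (Cn d) x₀).isOpen_inter_preimage_symm
    (trivializationAt (Cn (k + 1)) E x₀).open_baseSet

lemma chartAt_mem_bundleDomain (x₀ : D) : chartAt (Cn d) x₀ x₀ ∈ bundleDomain d k E x₀ := by
  refine ⟨mem_chart_target _ _, ?_⟩
  rw [mem_preimage, (chartAt (Cn d) x₀).left_inv (mem_chart_source _ _)]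
  exact mem_baseSet_trivializationAt _ _ _

lemma mem_extChartAt_total_source (c v : TotalSpace (Cn (k + 1)) E) :
    v ∈ (extChartAt (totalModel d k) c).source ↔ v.proj ∈ (chartAt (Cn d) c.proj).source ∧
      v.proj ∈ (trivializationAt (Cn (k + 1)) E c.proj).baseSet := by
  rw [extChartAt_source, FiberBundle.chartedSpace_chartAt]
  simp only [OpenPartialHomeomorph.trans_source, OpenPartialHomeomorph.prod_source,
    OpenPartialHomeomorph.refl_source, mem_inter_iff, mem_preimage, mem_prod, mem_univ, and_true]
  rw [Trivialization.coe_coe]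
  constructor
  · rintro ⟨h1, h2⟩
    have h3 := (Trivialization.mem_source _).1 h1
    rw [Trivialization.coe_fst _ h1] at h2
    exact ⟨h2, h3⟩
  · rintro ⟨h1, h2⟩
    have h3 := (Trivialization.mem_source (trivializationAt (Cn (k + 1)) E c.proj)).2 h2
    refine ⟨h3, ?_⟩
    rw [Trivialization.coe_fst _ h3]
    exact h1

lemma extChartAt_total_apply (c v : TotalSpace (Cn (k + 1)) E)
    (hv : v.proj ∈ (trivializationAt (Cn (k + 1)) E c.proj).baseSet) :
    extChartAt (totalModel d k) c v =
      (chartAt (Cn d) c.proj v.proj, vecCoord k E c.proj v.proj v.2) := by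
  rw [FiberBundle.extChartAt]
  have h3 := (Trivialization.mem_source (trivializationAt (Cn (k + 1)) E c.proj)).2 hv
  refine Prod.ext ?_ rfl
  change extChartAt 𝓘(ℂ, Cn d) c.proj (trivializationAt (Cn (k + 1)) E c.proj v).1 = _
  rw [Trivialization.coe_fst _ h3]
  rfl

lemma mem_extChartAt_total_target (c : TotalSpace (Cn (k + 1)) E) (p : Cn d × Cn (k + 1)) :
    p ∈ (extChartAt (totalModel d k) c).target ↔ p.1 ∈ bundleDomain d k E c.proj := by
  rw [FiberBundle.extChartAt_target]
  simp [bundleDomain]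

lemma extChartAt_total_symm (c : TotalSpace (Cn (k + 1)) E) {p : Cn d × Cn (k + 1)}
    (hp : p.1 ∈ bundleDomain d k E c.proj) :
    (extChartAt (totalModel d k) c).symm p = localVec d k E c.proj p := by
  have hb : (chartAt (Cn d) c.proj).symm p.1 ∈
    (trivializationAt (Cn (k + 1)) E c.proj).baseSet := hp.2
  have h1 : localVec d k E c.proj p ∈ (extChartAt (totalModel d k) c).source :=
    (mem_extChartAt_total_source c _).2 ⟨(chartAt (Cn d) c.proj).map_target hp.1, hb⟩
  rw [← (extChartAt (totalModel d k) c).left_inv h1, extChartAt_total_apply _ _ hb]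
  congr 1
  refine Prod.ext ((chartAt (Cn d) c.proj).right_inv hp.1).symm ?_
  exact (vecCoord_ofCoord_self hb p.2).symm

/-- The norm squared of a Hermitian metric in the preferred trivialisation at `x₀`. -/
def HermitianMetric.localNormSq (h : HermitianMetric d k E) (x₀ : D) (p : Cn d × Cn (k + 1)) : ℝ :=
  h.normSq (localVec d k E x₀ p)

variable [IsManifold (baseModel d) ω D] [ContMDiffVectorBundle ω (Cn (k + 1)) E (baseModel d)]

lemma HermitianMetric.smoothInCharts (h : HermitianMetric d k E) :
    SmoothInCharts (totalModel d k) h.normSq := smoothInCharts_of_contMDiff h.smooth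

lemma HermitianMetric.comp_symm_eventuallyEq (h : HermitianMetric d k E) {X : Type*} (F : ℝ → X)
    (c : TotalSpace (Cn (k + 1)) E) {p : Cn d × Cn (k + 1)}
    (hp : p.1 ∈ bundleDomain d k E c.proj) :
    (fun v => F (h.normSq v)) ∘ (extChartAt (totalModel d k) c).symm =ᶠ[𝓝 p]
      fun p => F (h.localNormSq c.proj p) := by
  filter_upwards [continuousAt_fst.eventually ((isOpen_bundleDomain c.proj).mem_nhds hp)] with q hq
  simp only [Function.comp_apply, extChartAt_total_symm c hq]
  rfl

lemma HermitianMetric.isFibreMetric (h : HermitianMetric d k E) (x₀ : D) :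
    IsFibreMetric (bundleDomain d k E x₀) (h.localNormSq x₀) where
  isOpen := isOpen_bundleDomain x₀
  smooth p hp := by
    let c : TotalSpace (Cn (k + 1)) E := ⟨x₀, 0⟩
    exact (h.smoothInCharts c p ((mem_extChartAt_total_target c p).2 hp)).congr_of_eventuallyEq
      (h.comp_symm_eventuallyEq (fun x => x) c hp).symm
  sesq z hz := by
    let x := (chartAt (Cn d) x₀).symm z
    have hx : x ∈ (trivializationAt (Cn (k + 1)) E x₀).baseSet := hz.2
    let e : Cn (k + 1) →ₗ[ℂ] E x :=
      ((trivializationAt (Cn (k + 1)) E x₀).continuousLinearEquivAt ℂ x hx).symm.toLinearEquiv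
    have he : ∀ w, e w = ofCoord k E x₀ x w := fun w => by
      rw [ofCoord, dif_pos hx]; rfl
    refine ⟨(LinearMap.lcomp ℂ ℂ e) ∘ₛₗ (h.inner x) ∘ₛₗ e, fun v w => h.symm _ _ _, fun w => ?_⟩
    change (h.inner x (ofCoord k E x₀ x w) (ofCoord k E x₀ x w)).re = (h.inner x (e w) (e w)).re
    rw [he]
  pos z hz w hw := h.pos _ _ (ofCoord_ne_zero _ _ hw)

end BundleCharts

/-! ### Charts of `P(E)` and the curvature of the tautological bundle. -/

section ProjCharts

set_option synthInstance.maxHeartbeats 200000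
set_option linter.unusedSectionVars false

open ProjBundle

variable {d k : ℕ} {D : Type*} [TopologicalSpace D] [ChartedSpace (Cn d) D]
  {E : D → Type*} [∀ x, AddCommGroup (E x)] [∀ x, Module ℂ (E x)]
  [TopologicalSpace (TotalSpace (Cn (k + 1)) E)] [∀ x, TopologicalSpace (E x)]
  [FiberBundle (Cn (k + 1)) E] [VectorBundle ℂ (Cn (k + 1)) E]
  [IsManifold (baseModel d) ω D] [ContMDiffVectorBundle ω (Cn (k + 1)) E (baseModel d)]

/-- The index of the preferred affine chart of `P(E)` at a line. -/
def chartIndex (y : ProjBundle d k E) : Fin (k + 1) := (exists_homCoord_ne_zero y).choose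

lemma homCoord_chartIndex_ne_zero (y : ProjBundle d k E) :
    homCoord y.proj y (chartIndex y) ≠ 0 := (exists_homCoord_ne_zero y).choose_spec

lemma extChartAt_proj (y y' : ProjBundle d k E) :
    extChartAt (projModel d k) y y' = affineChart y.proj (chartIndex y) y' := by
  rw [extChartAt_coe, modelWithCornersSelf_coe]
  rfl

lemma extChartAt_proj_symm (y : ProjBundle d k E) (q : Cn d × Cn k) :
    (extChartAt (projModel d k) y).symm q = (affineChart y.proj (chartIndex y)).symm q := by
  rw [extChartAt_coe_symm, modelWithCornersSelf_coe_symm]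
  rfl

lemma mem_extChartAt_proj_source (y y' : ProjBundle d k E) :
    y' ∈ (extChartAt (projModel d k) y).source ↔ y' ∈
      (affineChart y.proj (chartIndex y) : PartialEquiv (ProjBundle d k E) _).source := by
  rw [extChartAt_source]
  rfl

lemma mem_extChartAt_proj_target (y : ProjBundle d k E) (q : Cn d × Cn k) :
    q ∈ (extChartAt (projModel d k) y).target ↔ q.1 ∈ bundleDomain d k E y.proj := by
  rw [extChartAt_target, modelWithCornersSelf_coe_symm, preimage_id,
    (projModel d k).range_eq_univ, inter_univ]
  rfl

lemma ProjBundle.proj_symm (y : ProjBundle d k E) (q : Cn d × Cn k) :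
    ((extChartAt (projModel d k) y).symm q).proj = (chartAt (Cn d) y.proj).symm q.1 := by
  rw [extChartAt_proj_symm]; rfl

/-- The representative of a line is only defined up to a scalar `a`; the normalisation in
`tautFrame` cancels it, leaving the vector with coordinates `homog`. -/
lemma localNormSq_tautFrame (h : HermitianMetric d k E) (y : ProjBundle d k E) {q : Cn d × Cn k}
    (hq : q.1 ∈ bundleDomain d k E y.proj) :
    h.normSq (tautFrame y ((extChartAt (projModel d k) y).symm q)) =
      h.localNormSq y.proj (q.1, homog (chartIndex y) q.2) := by
  have hb : (chartAt (Cn d) y.proj).symm q.1 ∈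
    (trivializationAt (Cn (k + 1)) E y.proj).baseSet := hq.2
  rw [extChartAt_proj_symm]
  set v := ofCoord k E y.proj ((chartAt (Cn d) y.proj).symm q.1) (homog (chartIndex y) q.2) with hv
  have hv0 : v ≠ 0 := ofCoord_ne_zero _ _ (homog_ne_zero _ _)
  obtain ⟨a, ha⟩ := Projectivization.exists_smul_eq_mk_rep ℂ v hv0
  have h1 : homCoord y.proj (mk v hv0 : ProjBundle d k E) = (a : ℂ) • homog (chartIndex y) q.2 := by
    have e1 : homCoord y.proj (mk v hv0 : ProjBundle d k E) =
      vecCoord k E y.proj _ ((a : ℂ) • v) := congrArg (vecCoord k E y.proj _) ha.symm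
    rw [e1, vecCoord_smul hb, hv, vecCoord_ofCoord_self hb]
  have h2 : tautFrame y ((affineChart y.proj (chartIndex y)).symm q : ProjBundle d k E) =
      localVec d k E y.proj (q.1, homog (chartIndex y) q.2) := by
    change (⟨_, (homCoord y.proj (mk v hv0 : ProjBundle d k E) (chartIndex y))⁻¹ •
      (Projectivization.mk ℂ v hv0).rep⟩ : TotalSpace (Cn (k + 1)) E) = ⟨_, v⟩
    rw [h1, ← ha]
    congr 1
    rw [PiLp.smul_apply, homog_same, smul_eq_mul, mul_one, Units.smul_def, smul_smul,
      inv_mul_cancel₀ a.ne_zero, one_smul]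
  rw [h2]
  rfl

lemma HermitianMetric.normSq_smul (h : HermitianMetric d k E) {x : D} (c : ℂ) (v : E x) :
    h.normSq ⟨x, c • v⟩ = ‖c‖ ^ 2 * h.normSq ⟨x, v⟩ := by
  change (h.inner x (c • v) (c • v)).re = ‖c‖ ^ 2 * (h.inner x v v).re
  have : h.inner x (c • v) (c • v) = ((‖c‖ ^ 2 : ℝ) : ℂ) * h.inner x v v := by
    rw [← Complex.normSq_eq_norm_sq, Complex.normSq_eq_conj_mul_self]
    simp
    ring
  rw [this, Complex.re_ofReal_mul]

lemma HermitianMetric.normSq_pos (h : HermitianMetric d k E) {x : D} {v : E x} (hv : v ≠ 0) :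
    0 < h.normSq ⟨x, v⟩ := h.pos x v hv

lemma log_tautFrame_eventuallyEq (h : HermitianMetric d k E) (y : ProjBundle d k E)
    {q : Cn d × Cn k} (hq : q.1 ∈ bundleDomain d k E y.proj) :
    (fun y' => Real.log (h.normSq (tautFrame y y'))) ∘ (extChartAt (projModel d k) y).symm
      =ᶠ[𝓝 q] projPot (h.localNormSq y.proj) (chartIndex y) := by
  filter_upwards [continuousAt_fst.eventually ((isOpen_bundleDomain y.proj).mem_nhds hq)] with r hr
  simp only [Function.comp_apply, localNormSq_tautFrame h y hr]
  rfl

/-- The curvature of the tautological bundle in the preferred charts of `P(E)`. -/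
lemma inChart_tautCurvature (h : HermitianMetric d k E) (y : ProjBundle d k E) {q : Cn d × Cn k}
    (hq : q.1 ∈ bundleDomain d k E y.proj) :
    inChart (projModel d k) (tautCurvature h) y q =
      - ddbarV (projPot (h.localNormSq y.proj) (chartIndex y)) q := by
  have hqt := (mem_extChartAt_proj_target y q).2 hq
  have hc := (h.isFibreMetric y.proj).contDiffAt_projPot (chartIndex y) hq
  have hev := log_tautFrame_eventuallyEq h y hq
  have hc' : ContDiffAt ℝ 2 ((fun y' => Real.log (h.normSq (tautFrame y y'))) ∘
      (extChartAt (projModel d k) y).symm) q :=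
    (hc.congr_of_eventuallyEq hev).of_le two_le_infty
  have hneg : tautCurvature h = - (- tautCurvature h) := (neg_neg _).symm
  rw [hneg, inChart_neg, inChart_of_eq_ddbar (I := projModel d k)
    (u := fun y' => Real.log (h.normSq (tautFrame y y'))) y hqt ?_ hc', ddbarV_congr hev]
  set y' := (extChartAt (projModel d k) y).symm q with hy'
  have hys : y' ∈ (extChartAt (projModel d k) y).source := (extChartAt (projModel d k) y).map_target hqt
  have h1 : (-tautCurvature h) y' =
      ddbar (projModel d k) (fun r => Real.log (h.normSq (tautFrame y' r))) y' := neg_neg _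
  rw [h1, ddbar, ddbar]
  -- the two frames differ by a holomorphic function
  set q' := extChartAt (projModel d k) y' y' with hq'
  have hq't : q' ∈ (extChartAt (projModel d k) y').target := mem_extChartAt_target y'
  have hinv : (extChartAt (projModel d k) y').symm q' = y' := extChartAt_to_inv y'
  -- In the trivialisation at `y`, the frame normalised at `y'` has `g` as its coordinate of index
  -- `chartIndex y`. Hence it is `g` times the frame normalised at `y`, and `log |g|²` is
  -- pluriharmonic.
  let g : Cn d × Cn k → ℂ := fun r => homTransition k E y'.proj y.proj (chartIndex y') r (chartIndex y)
  have hev1 : ∀ᶠ r in 𝓝 q', r ∈ (extChartAt (projModel d k) y').target ∧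
      (extChartAt (projModel d k) y').symm r ∈ (extChartAt (projModel d k) y).source :=
    (eventually_mem_target (projModel d k) y' hq't).and
      (eventually_symm_mem_source (projModel d k) y' y hq't (by rwa [hinv]))
  have hsrc : ∀ r, r ∈ (extChartAt (projModel d k) y').target →
      (extChartAt (projModel d k) y').symm r ∈ (extChartAt (projModel d k) y).source →
      r.1 ∈ overlap k E y'.proj y.proj ∧ g r ≠ 0 := by
    intro r hr hr'
    have : r ∈ ((affineChart y'.proj (chartIndex y') : PartialEquiv (ProjBundle d k E) _).symm.trans
        (affineChart y.proj (chartIndex y))).source := by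
      rw [PartialEquiv.trans_source]
      refine ⟨(mem_extChartAt_proj_target y' r).1 hr, ?_⟩
      rw [mem_extChartAt_proj_source, extChartAt_proj_symm] at hr'
      exact hr'
    rw [transition_source] at this
    exact this
  have hgr : ∀ r, r ∈ (extChartAt (projModel d k) y').target →
      (extChartAt (projModel d k) y').symm r ∈ (extChartAt (projModel d k) y).source →
      Real.log (h.normSq (tautFrame y' ((extChartAt (projModel d k) y').symm r))) =
        Real.log (‖g r‖ ^ 2) +
          Real.log (h.normSq (tautFrame y ((extChartAt (projModel d k) y').symm r))) := by
    intro r hr hr'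
    obtain ⟨hov, hg0⟩ := hsrc r hr hr'
    rw [extChartAt_proj_symm]
    set s : ProjBundle d k E := (affineChart y'.proj (chartIndex y')).symm r with hs
    have hb' : (chartAt (Cn d) y'.proj).symm r.1 ∈
      (trivializationAt (Cn (k + 1)) E y'.proj).baseSet := hov.2.2.1
    have hb : (chartAt (Cn d) y'.proj).symm r.1 ∈
      (trivializationAt (Cn (k + 1)) E y.proj).baseSet := hov.2.2.2
    set v := ofCoord k E y'.proj ((chartAt (Cn d) y'.proj).symm r.1) (homog (chartIndex y') r.2)
      with hv
    have hv0 : v ≠ 0 := ofCoord_ne_zero _ _ (homog_ne_zero _ _)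
    obtain ⟨a, ha⟩ := Projectivization.exists_smul_eq_mk_rep ℂ v hv0
    have hsv : s = mk v hv0 := rfl
    have e0 : ∀ x₁ : D, homCoord x₁ s = vecCoord k E x₁ _ ((a : ℂ) • v) := fun x₁ =>
      congrArg (vecCoord k E x₁ _) ha.symm
    have e1 : homCoord y'.proj s (chartIndex y') = a := by
      rw [e0, vecCoord_smul hb', hv, vecCoord_ofCoord_self hb', PiLp.smul_apply, homog_same,
        smul_eq_mul, mul_one]
    have e2 : homCoord y.proj s (chartIndex y) = a * g r := by
      rw [e0, vecCoord_smul hb, hv, vecCoord_ofCoord hb' hb]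
      rfl
    have ha0 : (a : ℂ) ≠ 0 := a.ne_zero
    have hrep0 : Projectivization.rep (Sigma.snd s) ≠ 0 := Projectivization.rep_nonzero _
    have f1 : h.normSq (tautFrame y' s) =
        ‖(a : ℂ)⁻¹‖ ^ 2 * h.normSq ⟨s.proj, Projectivization.rep (Sigma.snd s)⟩ := by
      rw [← h.normSq_smul, ← e1]; rfl
    have f2 : h.normSq (tautFrame y s) =
        ‖((a : ℂ) * g r)⁻¹‖ ^ 2 * h.normSq ⟨s.proj, Projectivization.rep (Sigma.snd s)⟩ := by
      rw [← h.normSq_smul, ← e2]; rfl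
    have hN := h.normSq_pos hrep0
    rw [← Real.log_mul (by simpa using hg0), f1, f2]
    · congr 1
      have hng : ‖g r‖ ≠ 0 := by simpa using hg0
      rw [norm_inv, norm_inv, norm_mul]
      field_simp
    · rw [f2]
      have : ‖((a : ℂ) * g r)⁻¹‖ ≠ 0 := by simp [ha0, hg0]
      positivity
  have hfun : (fun r => Real.log (h.normSq (tautFrame y' r))) ∘ (extChartAt (projModel d k) y').symm
      =ᶠ[𝓝 q'] fun r => Real.log (‖g r‖ ^ 2) +
        ((fun r => Real.log (h.normSq (tautFrame y r))) ∘ (extChartAt (projModel d k) y').symm) r := by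
    filter_upwards [hev1] with r hr
    exact hgr r hr.1 hr.2
  obtain ⟨hov, hg0⟩ := hsrc q' hq't (by rwa [hinv])
  have hgc : ContDiffAt ℂ 2 g q' := by
    have hopen : IsOpen {q : Cn d × Cn k | q.1 ∈ overlap (d := d) k E y'.proj y.proj} :=
      ((chartAt (Cn d) y'.proj).isOpen_inter_preimage_symm
        ((chartAt (Cn d) y.proj).open_source.inter
        ((trivializationAt (Cn (k + 1)) E y'.proj).open_baseSet.inter
          (trivializationAt (Cn (k + 1)) E y.proj).open_baseSet))).preimage continuous_fst
    exact contDiffAt_euclidean.1 (((contDiffOn_homTransition (d := d) (k := k) (E := E) y'.proj y.proj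
      (chartIndex y')).contDiffAt (hopen.mem_nhds hov)).of_le le_top) (chartIndex y)
  have hlc : ContDiffAt ℝ 2 ((fun r => Real.log (h.normSq (tautFrame y r))) ∘
      (extChartAt (projModel d k) y').symm) q' := by
    refine contDiffAt_comp_symm (I := projModel d k) y' y hq't (by rwa [hinv]) ?_
    rw [hinv, hy', (extChartAt (projModel d k) y).right_inv hqt]
    exact hc'
  rw [ddbarV_congr hfun, ddbarV_add (((hgc.restrict_scalars ℝ).norm_sq ℝ).log (by simpa using hg0)) hlc,
    ddbarV_log_norm_sq hgc hg0, zero_add]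

end ProjCharts

/-! ### The hypotheses on `ω_M` and `γ` in affine charts. -/

section ProjMetric

set_option synthInstance.maxHeartbeats 200000
set_option linter.unusedSectionVars false

open ProjBundle
open scoped ComplexOrder

variable {d k : ℕ} {D : Type*} [TopologicalSpace D] [ChartedSpace (Cn d) D]
  {E : D → Type*} [∀ x, AddCommGroup (E x)] [∀ x, Module ℂ (E x)]
  [TopologicalSpace (TotalSpace (Cn (k + 1)) E)] [∀ x, TopologicalSpace (E x)]
  [FiberBundle (Cn (k + 1)) E] [VectorBundle ℂ (Cn (k + 1)) E]
  [IsManifold (baseModel d) ω D] [ContMDiffVectorBundle ω (Cn (k + 1)) E (baseModel d)]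

lemma continuousAt_proj (y : ProjBundle d k E) :
    ContinuousAt (ProjBundle.proj : ProjBundle d k E → D) y := by
  have hs := extChartAt_source_mem_nhds (I := projModel d k) y
  have hy := (mem_extChartAt_proj_source y y).1 (mem_extChartAt_source (I := projModel d k) y)
  have h1 : (fun y' => (chartAt (Cn d) y.proj).symm (extChartAt (projModel d k) y y').1) =ᶠ[𝓝 y]
      (ProjBundle.proj : ProjBundle d k E → D) := by
    filter_upwards [hs] with y' hy'
    rw [← ProjBundle.proj_symm, (extChartAt (projModel d k) y).left_inv hy']
  refine ContinuousAt.congr ?_ h1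
  have h2 : ContinuousAt (chartAt (Cn d) y.proj).symm (extChartAt (projModel d k) y y).1 := by
    refine (chartAt (Cn d) y.proj).continuousAt_symm ?_
    exact ((mem_extChartAt_proj_target y _).1 (mem_extChartAt_target (I := projModel d k) y)).1
  exact ContinuousAt.comp (g := (chartAt (Cn d) y.proj).symm)
    (f := fun y' => (extChartAt (projModel d k) y y').1) h2
    (continuousAt_fst.comp (continuousAt_extChartAt y))

lemma mdifferentiableAt_proj (y : ProjBundle d k E) :
    MDifferentiableAt (projModel d k) (baseModel d) (ProjBundle.proj : ProjBundle d k E → D) y := by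
  rw [mdifferentiableAt_iff, (projModel d k).range_eq_univ, differentiableWithinAt_univ]
  refine ⟨continuousAt_proj y, differentiableAt_fst.congr_of_eventuallyEq ?_⟩
  filter_upwards [eventually_mem_target (projModel d k) y (mem_extChartAt_target y)] with q hq
  have hq' := (mem_extChartAt_proj_target y q).1 hq
  change chartAt (Cn d) y.proj (((extChartAt (projModel d k) y).symm q).proj) = q.1
  rw [ProjBundle.proj_symm, (chartAt (Cn d) y.proj).right_inv hq'.1]

/-- The form `p^* ω_D - γ` on `P(E)`. -/
def projMetric (ωD : Form (Cn d) D 2) (h : HermitianMetric d k E) :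
    Form (Cn d × Cn k) (ProjBundle d k E) 2 :=
  pullback (projModel d k) (baseModel d) ProjBundle.proj ωD - tautCurvature h

variable {ωD : Form (Cn d) D 2} (h : HermitianMetric d k E)

/-- The form `p^* ω_D - γ` in the preferred charts of `P(E)`. -/
lemma inChart_projMetric (y : ProjBundle d k E) {q : Cn d × Cn k}
    (hq : q.1 ∈ bundleDomain d k E y.proj) :
    inChart (projModel d k) (projMetric ωD h) y q =
    projForm (inChart (baseModel d) ωD y.proj) (h.localNormSq y.proj) (chartIndex y) 1 q := by
  have hqt := (mem_extChartAt_proj_target y q).2 hq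
  rw [projMetric, inChart_sub, inChart_tautCurvature h y hq, projForm, one_smul, sub_neg_eq_add]
  congr 1
  have hp := ProjBundle.proj_symm y q
  have hsrc : ((extChartAt (projModel d k) y).symm q).proj ∈
      (extChartAt (baseModel d) y.proj).source := by
    rw [hp, extChartAt_source]
    exact (chartAt (Cn d) y.proj).map_target hq.1
  rw [inChart_pullback (I := projModel d k) (I' := baseModel d) ωD y y.proj hqt
    (mdifferentiableAt_proj _) hsrc]
  have h1 : extChartAt (baseModel d) y.proj (((extChartAt (projModel d k) y).symm q).proj) = q.1 := by
    rw [hp]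
    exact (chartAt (Cn d) y.proj).right_inv hq.1
  rw [h1]
  congr 1
  have h2 : extChartAt (baseModel d) y.proj ∘ ProjBundle.proj ∘ (extChartAt (projModel d k) y).symm
      =ᶠ[𝓝 q] Prod.fst := by
    filter_upwards [continuousAt_fst.eventually ((isOpen_bundleDomain y.proj).mem_nhds hq)] with r hr
    change chartAt (Cn d) y.proj (((extChartAt (projModel d k) y).symm r).proj) = r.1
    rw [ProjBundle.proj_symm, (chartAt (Cn d) y.proj).right_inv hr.1]
  rw [h2.fderiv_eq]
  exact fderiv_fst

/-- The line through a nonzero vector of `E`, in the preferred charts. -/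
lemma extChartAt_proj_mk {x : D} {v : E x} (hv : v ≠ 0) :
    vecCoord k E x x v (chartIndex (mk v hv : ProjBundle d k E)) ≠ 0 ∧
      extChartAt (projModel d k) (mk v hv) (mk v hv : ProjBundle d k E) =
        affineMap (chartIndex (mk v hv : ProjBundle d k E))
          (chartAt (Cn d) x x, vecCoord k E x x v) := by
  set y : ProjBundle d k E := mk v hv with hy
  obtain ⟨a, ha, hay⟩ := homCoord_mk (d := d) (mem_baseSet_trivializationAt (Cn (k + 1)) E x) v hv
  have hne := homCoord_chartIndex_ne_zero y
  -- The homogeneous coordinates of the line are those of `v` up to one scalar, which drops out of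
  -- the quotients.
  have e : ∀ j, homCoord x y j = a * vecCoord k E x x v j := fun j => by
    rw [hy, hay]; rfl
  have hne' : homCoord x y (chartIndex y) ≠ 0 := hne
  rw [e] at hne'
  refine ⟨right_ne_zero_of_mul hne', ?_⟩
  rw [extChartAt_proj]
  refine Prod.ext rfl (PiLp.ext fun j => ?_)
  change homCoord x y _ / homCoord x y _ = vecCoord k E x x v _ / vecCoord k E x x v _
  rw [e, e, mul_div_mul_left _ _ ha]

lemma log_normSq_smoothAt {c v : TotalSpace (Cn (k + 1)) E} (hv : v.2 ≠ 0)
    (hvs : v ∈ (extChartAt (totalModel d k) c).source) :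
    ContDiffAt ℝ ∞ ((fun v => Real.log (h.normSq v)) ∘ (extChartAt (totalModel d k) c).symm)
      (extChartAt (totalModel d k) c v) := by
  have h1 := h.smoothInCharts c _ ((extChartAt (totalModel d k) c).map_source hvs)
  refine ContDiffAt.log h1 ?_
  rw [(extChartAt (totalModel d k) c).left_inv hvs]
  exact (h.normSq_pos hv).ne'

/-- If `γ` is negative semi-definite, then `i∂∂̄ log h(v, v)` is positive semi-definite on `E`. -/
lemma ddbar_log_normSq_nonneg (hneg : ∀ y v, tautCurvature h y ![v, Complex.I • v] ≤ 0)
    {v : TotalSpace (Cn (k + 1)) E} (hv : v.2 ≠ 0) (ξ : Cn d × Cn (k + 1)) :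
    0 ≤ ddbar (totalModel d k) (fun v => Real.log (h.normSq v)) v ![ξ, Complex.I • ξ] := by
  obtain ⟨x, v⟩ := v
  simp only at hv
  set y : ProjBundle d k E := mk v hv with hy
  obtain ⟨hi, hye⟩ := extChartAt_proj_mk (d := d) (k := k) (E := E) hv
  have hb := mem_baseSet_trivializationAt (Cn (k + 1)) E x
  have hx : chartAt (Cn d) x x ∈ bundleDomain d k E x := chartAt_mem_bundleDomain x
  rw [ddbar, extChartAt_total_apply ⟨x, v⟩ ⟨x, v⟩ hb, ddbarV_congr
    (h.comp_symm_eventuallyEq Real.log ⟨x, v⟩ (p := (chartAt (Cn d) x x, vecCoord k E x x v)) hx),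
    (h.isFibreMetric x).ddbarV_log (chartIndex y) hx hi, form2_comp_apply,
    fderiv_restrictScalars_I ((contDiffAt_affineMap (n := 1) _ hi).differentiableAt one_ne_zero)]
  have h1 := hneg y (fderiv ℝ (affineMap (chartIndex y)) (chartAt (Cn d) x x, vecCoord k E x x v) ξ)
  have h2 := inChart_tautCurvature h y (q := extChartAt (projModel d k) y y)
    ((mem_extChartAt_proj_target y _).1 (mem_extChartAt_target y))
  rw [inChart_self, hye] at h2
  rw [h2, ContinuousAlternatingMap.neg_apply] at h1
  exact neg_nonpos.1 h1

/-- A Kähler form on the base and a Hermitian metric with `γ ≤ 0` in the preferred trivialisation. -/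
lemma isKahlerData (hωD : IsKahler (baseModel d) ωD)
    (hneg : ∀ y v, tautCurvature h y ![v, Complex.I • v] ≤ 0) (x₀ : D) :
    IsKahlerData (bundleDomain d k E x₀) (inChart (baseModel d) ωD x₀) (h.localNormSq x₀) where
  toIsFibreMetric := h.isFibreMetric x₀
  smoothA z hz := contDiffAt_inChart hωD.smooth x₀ (by
    rw [extChartAt_target, modelWithCornersSelf_coe_symm, preimage_id, (baseModel d).range_eq_univ,
      inter_univ]
    exact hz.1)
  invA z _ := InvI.inChart hωD.invariant x₀ z
  posA z hz v hv := inChart_pos hωD.positive x₀ (by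
    rw [extChartAt_target, modelWithCornersSelf_coe_symm, preimage_id, (baseModel d).range_eq_univ,
      inter_univ]
    exact hz.1) hv
  curv p hp hp2 v := by
    let c : TotalSpace (Cn (k + 1)) E := ⟨x₀, 0⟩
    have hpt : p ∈ (extChartAt (totalModel d k) c).target := (mem_extChartAt_total_target c p).2 hp
    set w := (extChartAt (totalModel d k) c).symm p with hw
    have hws : w ∈ (extChartAt (totalModel d k) c).source :=
      (extChartAt (totalModel d k) c).map_target hpt
    have hw2 : w.2 ≠ 0 := by
      rw [hw, extChartAt_total_symm c hp]
      exact ofCoord_ne_zero _ _ hp2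
    have hwp : extChartAt (totalModel d k) c w = p := (extChartAt (totalModel d k) c).right_inv hpt
    have h1 := log_normSq_smoothAt h hw2 hws
    rw [hwp] at h1
    rw [← ddbarV_congr (h.comp_symm_eventuallyEq Real.log c hp),
      ← inChart_ddbar (I := totalModel d k) c hpt (h1.of_le two_le_infty),
      inChart_eq _ _ _ hpt, form2_comp_apply,
      fderiv_restrictScalars_I ((contDiffAt_transition (totalModel d k) c _ hpt
        (mem_extChartAt_source w)).differentiableAt (by simp))]
    exact ddbar_log_normSq_nonneg h hneg hw2 _

/-- The determinants of `p^* ω_D - τ γ`, in terms of the eigenvalues of `γ`. -/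
lemma det_projForm_eq (hωD : IsKahler (baseModel d) ωD)
    (hneg : ∀ y v, tautCurvature h y ![v, Complex.I • v] ≤ 0) {β : Multiset ℂ}
    (heig : ∀ y, relEigenvalues (projMetric ωD h y) (tautCurvature h y) = β) (y : ProjBundle d k E) {q : Cn d × Cn k}
    (hq : q.1 ∈ bundleDomain d k E y.proj) (s : ℝ) :
    (hermMatrix (projForm (inChart (baseModel d) ωD y.proj) (h.localNormSq y.proj)
      (chartIndex y) (1 - s) q)).det =
    (hermMatrix (projForm (inChart (baseModel d) ωD y.proj) (h.localNormSq y.proj)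
      (chartIndex y) 1 q)).det * (β.map fun b => 1 + (s : ℂ) * b).prod := by
  set ωM := projMetric ωD h with hωM
  have hform : ∀ (y : ProjBundle d k E) (s : ℝ) {q : Cn d × Cn k},
      q.1 ∈ bundleDomain d k E y.proj →
      inChart (projModel d k) (ωM + s • tautCurvature h) y q =
      projForm (inChart (baseModel d) ωD y.proj) (h.localNormSq y.proj) (chartIndex y) (1 - s) q := by
    intro y s q hq
    rw [inChart_add, inChart_smul, inChart_projMetric h y hq, inChart_tautCurvature h y hq]
    refine form2_ext fun v w => ?_
    rw [ContinuousAlternatingMap.add_apply, ContinuousAlternatingMap.smul_apply,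
      ContinuousAlternatingMap.neg_apply, projForm_apply, projForm_apply, smul_eq_mul]
    ring
  have hform1 : inChart (projModel d k) ωM y q = projForm (inChart (baseModel d) ωD y.proj)
      (h.localNormSq y.proj) (chartIndex y) 1 q := inChart_projMetric h y hq
  -- Eigenvalues are given at `y'` in its own tangent coordinates. Passing to the chart at `y`
  -- multiplies both determinants by the same `|det|²`.
  set y' := (extChartAt (projModel d k) y).symm q with hy'
  have hcent : (extChartAt (projModel d k) y' y').1 ∈ bundleDomain d k E y'.proj :=
    (mem_extChartAt_proj_target y' _).1 (mem_extChartAt_target y')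
  have hK := isKahlerData h hωD hneg y'.proj
  have hval : ∀ s : ℝ, ωM y' + s • tautCurvature h y' = projForm (inChart (baseModel d) ωD y'.proj)
      (h.localNormSq y'.proj) (chartIndex y') (1 - s) (extChartAt (projModel d k) y' y') := by
    intro s
    rw [← hform y' s hcent, inChart_self]
    rfl
  have hval0 : ωM y' = projForm (inChart (baseModel d) ωD y'.proj)
      (h.localNormSq y'.proj) (chartIndex y') 1 (extChartAt (projModel d k) y' y') := by
    rw [← inChart_projMetric h y' hcent, inChart_self]
  have hdet0 : (hermMatrix (ωM y')).det ≠ 0 := by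
    rw [hval0]
    exact (hK.det_projForm_pos (chartIndex y') one_pos hcent).ne'
  have hInv : ∀ s : ℝ, InvI (ωM y' + s • tautCurvature h y') := fun s => by
    rw [hval]
    exact hK.invI_projForm _ _ hcent
  have hInv0 : InvI (ωM y') := by
    rw [hval0]
    exact hK.invI_projForm _ _ hcent
  rw [← hform y s hq, ← hform1, inChart, inChart]
  have h1 := det_hermMatrix_comp (hInv s)
    (tangentCoordChange (projModel d k) y y' y')
  have h2 := det_hermMatrix_comp hInv0
    (tangentCoordChange (projModel d k) y y' y')
  refine h1.trans ?_
  rw [det_hermMatrix_add_smul _ _ hdet0, heig y', ← mul_assoc, ← h2]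

/-- The hypothesis `Ric(ω_M) = -m γ` in an affine chart of `P(E)`. -/
lemma ricci_projForm (hRic : ricciForm (projModel d k)
      (projMetric ωD h) =
        - ((k + 1 : ℕ) : ℝ) • tautCurvature h) (y : ProjBundle d k E) :
    ddbarV (fun q => Real.log (hermMatrix (projForm (inChart (baseModel d) ωD y.proj)
      (h.localNormSq y.proj) (chartIndex y) 1 q)).det.re) (extChartAt (projModel d k) y y) +
    ((k + 1 : ℕ) : ℝ) • ddbarV (projPot (h.localNormSq y.proj) (chartIndex y))
      (extChartAt (projModel d k) y y) = 0 := by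
  have hcent : (extChartAt (projModel d k) y y).1 ∈ bundleDomain d k E y.proj :=
    (mem_extChartAt_proj_target y _).1 (mem_extChartAt_target y)
  have h1 := congrFun hRic y
  have h2 := inChart_tautCurvature h y hcent
  rw [inChart_self] at h2
  rw [ricciForm, Pi.smul_apply, h2, smul_neg, neg_smul, neg_neg] at h1
  rw [← h1, ← ddbarV_congr (u := fun q => Real.log (hermMatrix (inChart (projModel d k)
    (projMetric ωD h) y q)).det.re)]
  · exact add_neg_cancel _
  · filter_upwards [continuousAt_fst.eventually ((isOpen_bundleDomain y.proj).mem_nhds hcent)]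
      with q hq
    rw [inChart_projMetric h y hq]

end ProjMetric

/-! ### The global form on `E`: Kähler property, class and Ricci form. -/

section TotalMetric

set_option synthInstance.maxHeartbeats 200000
set_option linter.unusedSectionVars false

open ProjBundle
open scoped ComplexOrder

variable {d k : ℕ} {D : Type*} [TopologicalSpace D] [ChartedSpace (Cn d) D]
  {E : D → Type*} [∀ x, AddCommGroup (E x)] [∀ x, Module ℂ (E x)]
  [TopologicalSpace (TotalSpace (Cn (k + 1)) E)] [∀ x, TopologicalSpace (E x)]
  [FiberBundle (Cn (k + 1)) E] [VectorBundle ℂ (Cn (k + 1)) E]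
  [IsManifold (baseModel d) ω D] [ContMDiffVectorBundle ω (Cn (k + 1)) E (baseModel d)]

/-- The form `π^* ω_D + i∂∂̄ F(h(v, v))` on `E`. -/
def solForm (ωD : Form (Cn d) D 2) (h : HermitianMetric d k E) (F : ℝ → ℝ) :
    Form (Cn d × Cn (k + 1)) (TotalSpace (Cn (k + 1)) E) 2 :=
  pullback (totalModel d k) (baseModel d) TotalSpace.proj ωD +
    ddbar (totalModel d k) (fun v => F (h.normSq v))

variable {ωD : Form (Cn d) D 2} (h : HermitianMetric d k E) {F T D' : ℝ → ℝ}

/-- Smoothness of `F` in a full neighbourhood of `s = 0` is what allows the zero section, where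
`h(v, v) = 0`. -/
lemma smoothInCharts_comp_normSq (hF : ∀ s, 0 ≤ s → ContDiffAt ℝ ∞ F s) :
    SmoothInCharts (totalModel d k) (fun v => F (h.normSq v)) := by
  intro c p hp
  have hp' := (mem_extChartAt_total_target c p).1 hp
  refine ContDiffAt.congr_of_eventuallyEq ?_ (h.comp_symm_eventuallyEq F c hp')
  exact ContDiffAt.comp (g := F) p (hF _ ((h.isFibreMetric c.proj).nonneg hp' p.2))
    ((h.isFibreMetric c.proj).smooth p hp')

lemma inChart_pullback_proj (c : TotalSpace (Cn (k + 1)) E) {p : Cn d × Cn (k + 1)}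
    (hp : p.1 ∈ bundleDomain d k E c.proj) :
    inChart (totalModel d k) (pullback (totalModel d k) (baseModel d) TotalSpace.proj ωD) c p =
      (inChart (baseModel d) ωD c.proj p.1).compContinuousLinearMap
        (ContinuousLinearMap.fst ℝ (Cn d) (Cn (k + 1))) := by
  have hpt := (mem_extChartAt_total_target c p).2 hp
  have hproj : ∀ q : Cn d × Cn (k + 1), q.1 ∈ bundleDomain d k E c.proj →
      ((extChartAt (totalModel d k) c).symm q).proj = (chartAt (Cn d) c.proj).symm q.1 :=
    fun q hq => by rw [extChartAt_total_symm c hq]; rfl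
  have hsrc : ((extChartAt (totalModel d k) c).symm p).proj ∈
      (extChartAt (baseModel d) c.proj).source := by
    rw [hproj p hp, extChartAt_source]
    exact (chartAt (Cn d) c.proj).map_target hp.1
  have hmd : MDifferentiableAt (totalModel d k) (baseModel d)
      (TotalSpace.proj : TotalSpace (Cn (k + 1)) E → D) ((extChartAt (totalModel d k) c).symm p) :=
    (Bundle.contMDiff_proj E (n := 1) (IB := baseModel d)).contMDiffAt.mdifferentiableAt one_ne_zero
  rw [inChart_pullback (I := totalModel d k) (I' := baseModel d) ωD c c.proj hpt hmd hsrc]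
  have h1 : extChartAt (baseModel d) c.proj (((extChartAt (totalModel d k) c).symm p).proj) = p.1 := by
    rw [hproj p hp]
    exact (chartAt (Cn d) c.proj).right_inv hp.1
  rw [h1]
  congr 1
  have h2 : extChartAt (baseModel d) c.proj ∘ (TotalSpace.proj : TotalSpace (Cn (k + 1)) E → D) ∘
      (extChartAt (totalModel d k) c).symm =ᶠ[𝓝 p] Prod.fst := by
    filter_upwards [continuousAt_fst.eventually ((isOpen_bundleDomain c.proj).mem_nhds hp)] with r hr
    change chartAt (Cn d) c.proj (((extChartAt (totalModel d k) c).symm r).proj) = r.1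
    rw [hproj r hr, (chartAt (Cn d) c.proj).right_inv hr.1]
  rw [h2.fderiv_eq]
  exact fderiv_fst

lemma inChart_solForm (hF : ∀ s, 0 ≤ s → ContDiffAt ℝ ∞ F s) (c : TotalSpace (Cn (k + 1)) E)
    {p : Cn d × Cn (k + 1)} (hp : p.1 ∈ bundleDomain d k E c.proj) :
    inChart (totalModel d k) (solForm ωD h F) c p =
      totalForm (inChart (baseModel d) ωD c.proj) F (h.localNormSq c.proj) p := by
  have hpt := (mem_extChartAt_total_target c p).2 hp
  rw [solForm, inChart_add, inChart_pullback_proj c hp, inChart_ddbar c hpt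
    ((smoothInCharts_comp_normSq h hF c p hpt).of_le two_le_infty),
    ddbarV_congr (h.comp_symm_eventuallyEq F c hp)]
  rfl

lemma eventually_inChart_solForm (hF : ∀ s, 0 ≤ s → ContDiffAt ℝ ∞ F s)
    (c : TotalSpace (Cn (k + 1)) E) {p : Cn d × Cn (k + 1)}
    (hp : p.1 ∈ bundleDomain d k E c.proj) :
    inChart (totalModel d k) (solForm ωD h F) c =ᶠ[𝓝 p]
      totalForm (inChart (baseModel d) ωD c.proj) F (h.localNormSq c.proj) := by
  filter_upwards [continuousAt_fst.eventually ((isOpen_bundleDomain c.proj).mem_nhds hp)] with r hr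
  exact inChart_solForm h hF c hr

lemma extChartAt_self_mem_bundleDomain (c : TotalSpace (Cn (k + 1)) E) :
    (extChartAt (totalModel d k) c c).1 ∈ bundleDomain d k E c.proj :=
  (mem_extChartAt_total_target c _).1 (mem_extChartAt_target c)

lemma solForm_eq (hF : ∀ s, 0 ≤ s → ContDiffAt ℝ ∞ F s) (c : TotalSpace (Cn (k + 1)) E) :
    solForm ωD h F c = totalForm (inChart (baseModel d) ωD c.proj) F (h.localNormSq c.proj)
      (extChartAt (totalModel d k) c c) := by
  rw [← inChart_solForm h hF c (extChartAt_self_mem_bundleDomain c), inChart_self]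

/-- The difference is `i∂∂̄F(h)`, the exterior derivative of a globally smooth 1-form. -/
lemma solForm_sameClass (hF : ∀ s, 0 ≤ s → ContDiffAt ℝ ∞ F s) :
    SameClass (totalModel d k) (solForm ωD h F)
      (pullback (totalModel d k) (baseModel d) TotalSpace.proj ωD) := by
  refine ⟨dcForm (totalModel d k) (fun v => F (h.normSq v)),
    isSmoothForm_dcForm (smoothInCharts_comp_normSq h hF), ?_⟩
  rw [extD_dcForm (smoothInCharts_comp_normSq h hF), solForm, add_sub_cancel_left]

/-- The form `π^* ω_D + i∂∂̄ F(h(v, v))` is closed. -/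
lemma extD_solForm (hωD : IsKahler (baseModel d) ωD) (hF : ∀ s, 0 ≤ s → ContDiffAt ℝ ∞ F s) :
    extD (totalModel d k) (solForm ωD h F) = 0 := by
  funext c
  have hp := extChartAt_self_mem_bundleDomain (d := d) c
  set p := extChartAt (totalModel d k) c c with hpdef
  have hp1 : p.1 = extChartAt (baseModel d) c.proj c.proj := by
    rw [hpdef, extChartAt_total_apply c c (mem_baseSet_trivializationAt _ _ _)]
    rfl
  rw [extD, (eventually_inChart_solForm h hF c hp).extDeriv_eq]
  set A := inChart (baseModel d) ωD c.proj with hA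
  have hAc : ContDiffAt ℝ ∞ A p.1 := by
    rw [hp1]
    exact contDiffAt_inChart hωD.smooth c.proj (mem_extChartAt_target _)
  have hA0 : extDeriv A p.1 = 0 := by
    rw [hp1]
    exact congrFun hωD.closed c.proj
  have hFH : ContDiffAt ℝ ∞ (fun p => F (h.localNormSq c.proj p)) p :=
    ContDiffAt.comp (g := F) p (hF _ ((h.isFibreMetric c.proj).nonneg hp p.2))
      ((h.isFibreMetric c.proj).smooth p hp)
  have h1 : DifferentiableAt ℝ (fun p : Cn d × Cn (k + 1) => (A p.1).compContinuousLinearMap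
      (ContinuousLinearMap.fst ℝ (Cn d) (Cn (k + 1)))) p :=
    (contDiffAt_form_comp_fst hAc).differentiableAt (by simp)
  have h2 : DifferentiableAt ℝ (ddbarV (fun p => F (h.localNormSq c.proj p))) p :=
    (contDiffAt_ddbarV hFH).differentiableAt (by simp)
  have h3 : extDeriv (fun p : Cn d × Cn (k + 1) => (A p.1).compContinuousLinearMap
      (ContinuousLinearMap.fst ℝ (Cn d) (Cn (k + 1)))) p = 0 := by
    have e1 : (fun p : Cn d × Cn (k + 1) => (A p.1).compContinuousLinearMap
        (ContinuousLinearMap.fst ℝ (Cn d) (Cn (k + 1)))) =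
        fun p => (A (Prod.fst p)).compContinuousLinearMap
          (fderiv ℝ (Prod.fst : Cn d × Cn (k + 1) → Cn d) p) := by
      funext p
      rw [fderiv_fst]
    rw [e1, extDeriv_pullback (r := ∞) (f := (Prod.fst : Cn d × Cn (k + 1) → Cn d))
      (hAc.differentiableAt (by simp)) contDiffAt_fst (by simpa using two_le_infty), hA0]
    rfl
  have h4 : totalForm A F (h.localNormSq c.proj) =
      (fun p : Cn d × Cn (k + 1) => (A p.1).compContinuousLinearMap
      (ContinuousLinearMap.fst ℝ (Cn d) (Cn (k + 1)))) +
        ddbarV (fun p => F (h.localNormSq c.proj p)) := rfl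
  rw [h4, extDeriv_add h1 h2, h3, extDeriv_ddbarV hFH, add_zero]
  rfl

variable (hωD : IsKahler (baseModel d) ωD)
  (hneg : ∀ y v, tautCurvature h y ![v, Complex.I • v] ≤ 0)
include hωD hneg

lemma isKahler_solForm (hF : IsProfile F T D') :
    IsKahler (totalModel d k) (solForm ωD h F) where
  smooth c := by
    have hK := isKahlerData h hωD hneg c.proj
    intro p hp
    have hp' := (mem_extChartAt_total_target c p).1 hp
    exact ((hK.contDiffAt_totalForm hF hp').congr_of_eventuallyEq
      (eventually_inChart_solForm h hF.smoothF c hp')).contDiffWithinAt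
  closed := extD_solForm h hωD hF.smoothF
  invariant c v w := by
    rw [solForm_eq h hF.smoothF c]
    exact (isKahlerData h hωD hneg c.proj).invI_totalForm hF (extChartAt_self_mem_bundleDomain c) v w
  positive c v hv := by
    rw [solForm_eq h hF.smoothF c]
    exact (isKahlerData h hωD hneg c.proj).totalForm_pos hF (extChartAt_self_mem_bundleDomain c) hv

/-- The Ricci form of `π^* ω_D + i∂∂̄ F(h(v, v))`. -/
lemma ricciForm_solForm (hF : IsProfile F T D') {β : Multiset ℂ}
    (heig : ∀ y : ProjBundle d k E, relEigenvalues (projMetric ωD h y) (tautCurvature h y) = β)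
    (hRic : ricciForm (projModel d k) (projMetric ωD h) = - ((k + 1 : ℕ) : ℝ) • tautCurvature h)
    {μ : ℝ} {Q : ℝ → ℝ}
    (hβQ : ∀ x : ℝ, (β.map fun b => 1 + ((1 - x : ℝ) : ℂ) * b).prod = (Q x : ℝ))
    (hQ : ∀ s, 0 ≤ s → Q (s * T s) * (s * D' s) =
      (k + 1) * s ^ (k + 1) * Real.exp (μ * (s * T s))) (c : TotalSpace (Cn (k + 1)) E) :
    ricciForm (totalModel d k) (solForm ωD h F) c =
      - (μ • ddbarV (fun p => h.localNormSq c.proj p * T (h.localNormSq c.proj p))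
        (extChartAt (totalModel d k) c c)) := by
  have hp := extChartAt_self_mem_bundleDomain (d := d) c
  have hK := isKahlerData h hωD hneg c.proj
  have hev : (fun z => Real.log (hermMatrix (inChart (totalModel d k) (solForm ωD h F) c z)).det.re)
      =ᶠ[𝓝 (extChartAt (totalModel d k) c c)] fun z => Real.log (hermMatrix
        (totalForm (inChart (baseModel d) ωD c.proj) F (h.localNormSq c.proj) z)).det.re := by
    filter_upwards [eventually_inChart_solForm h hF.smoothF c hp] with z hz
    rw [hz]
  rw [ricciForm, ddbarV_congr hev, extChartAt_total_apply c c (mem_baseSet_trivializationAt _ _ _)]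
  congr 1
  refine hK.ddbarV_log_det_totalForm_of_ne_zero hF (chartAt_mem_bundleDomain c.proj) (fun w hw => ?_) _
  have hb := mem_baseSet_trivializationAt (Cn (k + 1)) E c.proj
  have hv0 : ofCoord k E c.proj c.proj w ≠ 0 := ofCoord_ne_zero _ _ hw
  obtain ⟨hi, hye⟩ := extChartAt_proj_mk (d := d) (k := k) (E := E) hv0
  rw [vecCoord_ofCoord_self hb] at hi hye
  -- The line through the given vector is taken as centre of the chart of `P(E)`, because the Ricci
  -- hypothesis is an equation at chart centres.
  set y : ProjBundle d k E := ProjBundle.mk (ofCoord k E c.proj c.proj w) hv0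
  have hric := ricci_projForm h hRic y
  rw [hye] at hric
  refine hK.ddbarV_log_det_totalForm hF (chartIndex y) hQ (chartAt_mem_bundleDomain c.proj) hi ?_ hric
  intro q hq τ
  have := det_projForm_eq h hωD hneg heig y (q := q) hq (1 - τ)
  rw [sub_sub_cancel, hβQ] at this
  exact this

end TotalMetric

/-! ### The Euler field and the Lie derivative. -/

section Euler

set_option synthInstance.maxHeartbeats 200000
set_option linter.unusedSectionVars false

open ProjBundle

variable {d k : ℕ} {D : Type*} [TopologicalSpace D] [ChartedSpace (Cn d) D]
  {E : D → Type*} [∀ x, AddCommGroup (E x)] [∀ x, Module ℂ (E x)]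
  [TopologicalSpace (TotalSpace (Cn (k + 1)) E)] [∀ x, TopologicalSpace (E x)]
  [FiberBundle (Cn (k + 1)) E] [VectorBundle ℂ (Cn (k + 1)) E]

lemma ofCoord_smul (x₀ x : D) (a : ℂ) (u : Cn (k + 1)) :
    ofCoord k E x₀ x (a • u) = a • ofCoord k E x₀ x u := by
  unfold ofCoord
  split_ifs <;> exact map_smul _ _ _

/-- The Euler field in the preferred chart. -/
lemma eulerField_eq (v : TotalSpace (Cn (k + 1)) E) :
    eulerField d k E v = (0, (extChartAt (totalModel d k) v v).2) := by
  have hb := mem_baseSet_trivializationAt (Cn (k + 1)) E v.proj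
  let γ : ℂ → TotalSpace (Cn (k + 1)) E := fun s => ⟨v.proj, s • v.2⟩
  let g : ℂ → Cn d × Cn (k + 1) := fun s =>
    (chartAt (Cn d) v.proj v.proj, s • vecCoord k E v.proj v.proj v.2)
  have hγ : ∀ s, extChartAt (totalModel d k) v (γ s) = g s := fun s => by
    rw [extChartAt_total_apply v (γ s) hb, vecCoord_smul hb]
  have hsrc : ∀ s, γ s ∈ (extChartAt (totalModel d k) v).source := fun s =>
    (mem_extChartAt_total_source v (γ s)).2 ⟨mem_chart_source _ _, hb⟩
  have hγ' : γ = (extChartAt (totalModel d k) v).symm ∘ g := by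
    funext s
    rw [Function.comp_apply, ← hγ, (extChartAt (totalModel d k) v).left_inv (hsrc s)]
  have hgd : HasDerivAt g (0, vecCoord k E v.proj v.proj v.2) 1 :=
    (hasDerivAt_const _ _).prodMk (by
      simpa using (hasDerivAt_id (1 : ℂ)).smul_const (vecCoord k E v.proj v.proj v.2))
  have hcont : ContinuousAt γ 1 := by
    rw [hγ']
    refine ContinuousAt.comp ?_ hgd.continuousAt
    refine continuousAt_extChartAt_symm'' ?_
    rw [← hγ]
    exact (extChartAt (totalModel d k) v).map_source (hsrc 1)
  -- The preferred chart of the total space depends only on the base point, which is the same for `γ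
  -- 1` and `v`.
  have hwr : writtenInExtChartAt 𝓘(ℂ, ℂ) (totalModel d k) 1 γ = g := by
    funext s
    change extChartAt (totalModel d k) (γ 1) (γ s) = g s
    rw [extChartAt_total_apply (γ 1) (γ s) hb, vecCoord_smul hb]
  have hmd : MDifferentiableAt 𝓘(ℂ, ℂ) (totalModel d k) γ 1 := by
    rw [mdifferentiableAt_iff, hwr]
    exact ⟨hcont, hgd.differentiableAt.differentiableWithinAt⟩
  let A : ℂ →L[ℂ] Cn d × Cn (k + 1) := mfderiv 𝓘(ℂ, ℂ) (totalModel d k) γ 1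
  have h1 : A =
      fderivWithin ℂ (writtenInExtChartAt 𝓘(ℂ, ℂ) (totalModel d k) 1 γ) (range 𝓘(ℂ, ℂ))
        (extChartAt 𝓘(ℂ, ℂ) (1 : ℂ) 1) := hmd.mfderiv
  have h2 : eulerField d k E v = A 1 := rfl
  rw [h2, h1, hwr, modelWithCornersSelf_coe, range_id, fderivWithin_univ,
    extChartAt_total_apply v v hb]
  exact hgd.hasFDerivAt.fderiv ▸ (by simp)

variable [IsManifold (baseModel d) ω D] [ContMDiffVectorBundle ω (Cn (k + 1)) E (baseModel d)]

/-- The Euler field is compatible with the changes of charts. -/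
lemma fderiv_transition_euler (c p : TotalSpace (Cn (k + 1)) E) {z : Cn d × Cn (k + 1)}
    (hz : z.1 ∈ bundleDomain d k E c.proj)
    (hp : (extChartAt (totalModel d k) c).symm z ∈ (extChartAt (totalModel d k) p).source) :
    fderiv ℂ (extChartAt (totalModel d k) p ∘ (extChartAt (totalModel d k) c).symm) z (0, z.2) =
      (0, (extChartAt (totalModel d k) p ((extChartAt (totalModel d k) c).symm z)).2) := by
  have hd := (contDiffAt_transition (totalModel d k) c p
    ((mem_extChartAt_total_target c z).2 hz) hp).differentiableAt (by simp)
  have hd' : HasFDerivAt (extChartAt (totalModel d k) p ∘ (extChartAt (totalModel d k) c).symm)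
      (fderiv ℂ (extChartAt (totalModel d k) p ∘ (extChartAt (totalModel d k) c).symm) z)
      (z + (0 : ℂ) • ((0 : Cn d), z.2)) := by
    simpa using hd.hasFDerivAt
  have hl : HasDerivAt (fun s : ℂ => z + s • ((0 : Cn d), z.2)) (0, z.2) 0 := by
    simpa using ((hasDerivAt_id (0 : ℂ)).smul_const ((0 : Cn d), z.2)).const_add z
  rw [extChartAt_total_symm c hz] at hp ⊢
  set x := (chartAt (Cn d) c.proj).symm z.1 with hx
  have hb : x ∈ (trivializationAt (Cn (k + 1)) E p.proj).baseSet :=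
    ((mem_extChartAt_total_source p _).1 hp).2
  rw [extChartAt_total_apply p _ hb]
  have hval : ∀ s : ℂ, (extChartAt (totalModel d k) p ∘ (extChartAt (totalModel d k) c).symm)
      (z + s • ((0 : Cn d), z.2)) = (chartAt (Cn d) p.proj x,
        (1 + s) • vecCoord k E p.proj x (ofCoord k E c.proj x z.2)) := by
    intro s
    have e1 : z + s • ((0 : Cn d), z.2) = (z.1, (1 + s) • z.2) := by
      ext1 <;> simp [add_smul]
    rw [e1, Function.comp_apply, extChartAt_total_symm c (p := (z.1, (1 + s) • z.2)) hz,
      ← vecCoord_smul hb, ← ofCoord_smul]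
    exact extChartAt_total_apply p _ hb
  refine (hd'.comp_hasDerivAt (0 : ℂ) hl).unique ?_
  refine HasDerivAt.congr_of_eventuallyEq ?_ (Eventually.of_forall hval)
  refine (hasDerivAt_const _ _).prodMk ?_
  change HasDerivAt _ (vecCoord k E p.proj x (ofCoord k E c.proj x z.2)) 0
  simpa using ((hasDerivAt_id (0 : ℂ)).const_add 1).smul_const
    (vecCoord k E p.proj x (ofCoord k E c.proj x z.2))

/-- Real multiples of the Euler field are holomorphic. -/
lemma isHolomorphicField_euler (a : ℝ) :
    IsHolomorphicField (totalModel d k) (a • eulerField d k E) := by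
  intro c
  let X : ∀ v : TotalSpace (Cn (k + 1)) E, TangentSpace (totalModel d k) v := a • eulerField d k E
  have h1 := (Bundle.contMDiffAt_section (n := ω) (IB := totalModel d k) (F := Cn d × Cn (k + 1))
    (E := TangentSpace (totalModel d k)) (s := X) c).2
  refine h1 ?_
  let l : Cn d × Cn (k + 1) →L[ℂ] Cn d × Cn (k + 1) :=
    (a : ℂ) • (ContinuousLinearMap.inr ℂ (Cn d) (Cn (k + 1))).comp (ContinuousLinearMap.snd ℂ _ _)
  have h2 : ContMDiffAt (totalModel d k) 𝓘(ℂ, Cn d × Cn (k + 1)) ω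
      (l ∘ extChartAt (totalModel d k) c) c :=
    l.contMDiff.contMDiffAt.comp c contMDiffAt_extChartAt
  refine h2.congr_of_eventuallyEq ?_
  filter_upwards [extChartAt_source_mem_nhds (I := totalModel d k) c] with v hv
  rw [TangentBundle.trivializationAt_apply]
  change fderivWithin ℂ (extChartAt (totalModel d k) c ∘ (extChartAt (totalModel d k) v).symm)
    (range (totalModel d k)) (extChartAt (totalModel d k) v v) (a • eulerField d k E v) = _
  have h3 := fderiv_transition_euler (d := d) v c (z := extChartAt (totalModel d k) v v)
    (extChartAt_self_mem_bundleDomain v) (by rwa [extChartAt_to_inv])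
  rw [extChartAt_to_inv] at h3
  rw [(totalModel d k).range_eq_univ, fderivWithin_univ, eulerField_eq, ← Complex.coe_smul, map_smul,
    h3]
  simp [l]

/-- The Euler field reads `(0, z.2)` in every chart, so contraction with it is contraction with a
linear vector field. -/
lemma inChart_contract_euler {j : ℕ} (η : Form (Cn d × Cn (k + 1)) (TotalSpace (Cn (k + 1)) E) (j + 1))
    (a : ℝ) (c : TotalSpace (Cn (k + 1)) E) {z : Cn d × Cn (k + 1)}
    (hz : z.1 ∈ bundleDomain d k E c.proj) :
    inChart (totalModel d k) (contract (a • eulerField d k E) η) c z =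
      (inChart (totalModel d k) η c z).curryLeft (a • ((0 : Cn d), z.2)) := by
  have hzt := (mem_extChartAt_total_target c z).2 hz
  rw [inChart_eq _ _ c hzt, inChart_eq _ _ c hzt]
  set p := (extChartAt (totalModel d k) c).symm z
  have hps := mem_extChartAt_source (I := totalModel d k) p
  have h1 : fderiv ℝ (extChartAt (totalModel d k) p ∘ (extChartAt (totalModel d k) c).symm) z
      (a • ((0 : Cn d), z.2)) = a • eulerField d k E p := by
    rw [((contDiffAt_transition (totalModel d k) c p hzt hps).differentiableAt
      (by simp)).fderiv_restrictScalars ℝ, map_smul, eulerField_eq]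
    congr 1
    exact fderiv_transition_euler c p hz hps
  ext v
  rw [ContinuousAlternatingMap.compContinuousLinearMap_apply, contract,
    ContinuousAlternatingMap.curryLeft_apply_apply, ContinuousAlternatingMap.curryLeft_apply_apply,
    ContinuousAlternatingMap.compContinuousLinearMap_apply]
  congr 1
  funext i
  refine Fin.cases ?_ (fun i => rfl) i
  exact h1.symm

variable {ωD : Form (Cn d) D 2} (h : HermitianMetric d k E) {F T D' : ℝ → ℝ}

/-- The Lie derivative of `π^* ω_D + i∂∂̄ F(h(v, v))` along multiples of the Euler field. -/
lemma lieD_solForm (hωD : IsKahler (baseModel d) ωD) (hF : IsProfile F T D') (μ : ℝ)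
    (c : TotalSpace (Cn (k + 1)) E) :
    lieD (totalModel d k) ((μ / 2) • eulerField d k E) (solForm ωD h F) c =
      μ • ddbarV (fun p => h.localNormSq c.proj p * T (h.localNormSq c.proj p))
        (extChartAt (totalModel d k) c c) := by
  have hH := h.isFibreMetric c.proj
  have hp := extChartAt_self_mem_bundleDomain (d := d) c
  set p := extChartAt (totalModel d k) c c
  -- The form is closed, so only `d ι_X` contributes to the Lie derivative.
  have h0 : contract ((μ / 2) • eulerField d k E) (extD (totalModel d k) (solForm ωD h F)) = 0 := by
    rw [extD_solForm h hωD hF.smoothF]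
    funext v
    ext
    rfl
  rw [lieD, h0, add_zero, extD]
  let L : Cn d × Cn (k + 1) →L[ℂ] Cn d × Cn (k + 1) :=
    ((μ / 2 : ℝ) : ℂ) • (ContinuousLinearMap.inr ℂ (Cn d) (Cn (k + 1))).comp
      (ContinuousLinearMap.snd ℂ _ _)
  have hL : ∀ z, L z = (μ / 2) • ((0 : Cn d), z.2) := fun z => by
    rw [← Complex.coe_smul]; rfl
  have hev : inChart (totalModel d k) (contract ((μ / 2) • eulerField d k E) (solForm ωD h F)) c
      =ᶠ[𝓝 p] fun z => (ddbarV (fun p => F (h.localNormSq c.proj p)) z).curryLeft (L z) := by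
    filter_upwards [hH.mem_nhds hp] with z hz
    rw [inChart_contract_euler _ _ c hz, inChart_solForm h hF.smoothF c hz, ← hL]
    ext v
    rw [ContinuousAlternatingMap.curryLeft_apply_apply, ContinuousAlternatingMap.curryLeft_apply_apply]
    have e1 : Matrix.vecCons (L z) v = ![L z, v 0] := by
      ext1 i; fin_cases i <;> rfl
    rw [e1, totalForm_apply, hL]
    have e2 : ((μ / 2) • ((0 : Cn d), z.2)).1 = (0 : ℝ) • (0 : Cn d) := by simp
    rw [e2, form2_smul_left, zero_mul, zero_add]
  have hu := hH.contDiffAt_profile hF hp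
  rw [hev.extDeriv_eq, extDeriv_curryLeft_ddbarV (hu.of_le (WithTop.coe_le_coe.2 le_top)) L]
  -- The Euler field differentiates `F(H)` to `2 H T(H)`; the factor `μ/2` turns this into `μτ`.
  · have hev2 : (fun z => fderiv ℝ (fun p => F (h.localNormSq c.proj p)) z (L z)) =ᶠ[𝓝 p]
        fun z => μ * (h.localNormSq c.proj z * T (h.localNormSq c.proj z)) := by
      filter_upwards [hH.mem_nhds hp] with z hz
      rw [hL, map_smul, (hH.fderiv_profile_vertical hF hz).1, smul_eq_mul]
      ring
    rw [ddbarV_congr hev2, ddbarV_const_mul]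
  · filter_upwards [hH.mem_nhds hp] with z hz
    rw [hL, smul_comm, map_smul, (hH.fderiv_profile_vertical hF hz).2, smul_zero]

end Euler

/-! ### Smoothness and injectivity of the family; the soliton equation. -/

section Family

set_option synthInstance.maxHeartbeats 200000
set_option linter.unusedSectionVars false

open ProjBundle

/-- Both momenta vanish at `s = 0` and have the same derivative for `s > 0`. -/
lemma IsProfile.momentum_eq {F T D F' T' D' : ℝ → ℝ} (hF : IsProfile F T D)
    (hF' : IsProfile F' T' D') (h : ∀ s, 0 < s → D s = D' s) {s : ℝ} (hs : 0 < s) : T s = T' s := by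
  have hd : ∀ x, 0 ≤ x → HasDerivAt (fun s => s * T s - s * T' s) (D x - D' x) x := fun x hx =>
    (hF.deriv_momentum x hx).sub (hF'.deriv_momentum x hx)
  obtain ⟨c, hc, hc'⟩ := exists_hasDerivAt_eq_slope (fun s => s * T s - s * T' s)
    (fun x => D x - D' x) hs (fun x hx => (hd x hx.1).continuousAt.continuousWithinAt)
    (fun x hx => hd x hx.1.le)
  have h2 : s * T s - s * T' s = 0 := by
    simp only [h c hc.1, sub_self, sub_zero, zero_mul] at hc'
    exact (div_eq_zero_iff.1 hc'.symm).resolve_right hs.ne'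
  exact mul_left_cancel₀ hs.ne' (sub_eq_zero.1 h2)

/-- The value of the Calabi ansatz on the Euler field. -/
lemma IsKahlerData.totalForm_euler {d k : ℕ} {U : Set (Cn d)} {A : Cn d → Cn d [⋀^Fin 2]→L[ℝ] ℝ}
    {H : Cn d × Cn (k + 1) → ℝ} {F T D : ℝ → ℝ} (hK : IsKahlerData U A H) (hF : IsProfile F T D)
    {p : Cn d × Cn (k + 1)} (hp : p.1 ∈ U) (hp2 : p.2 ≠ 0) :
    totalForm A F H p ![((0 : Cn d), p.2), Complex.I • ((0 : Cn d), p.2)] = 2 * (H p * D (H p)) := by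
  obtain ⟨i, hpi⟩ : ∃ i, p.2 i ≠ 0 := by
    by_contra! h
    exact hp2 (PiLp.ext h)
  have h0 : fderiv ℂ (affineMap i) p ((0 : Cn d), p.2) = 0 := by
    rw [fderiv_affineMap i hpi]
    refine Prod.ext rfl (PiLp.ext fun j => ?_)
    simp
  have h1 : holPart (fderiv ℝ (fun p => Real.log (H p)) p) ((0 : Cn d), p.2) = 1 := by
    rw [hK.holPart_log i hp hpi, add_apply, ContinuousLinearMap.comp_apply, h0, map_zero, add_zero]
    exact inv_mul_cancel₀ hpi
  rw [hK.totalForm_eq hF i hp hpi, IsKahlerData.im_conj_mul_I_smul, map_smul, h0, smul_zero,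
    form2_self, h1]
  norm_num
  ring

variable {d k : ℕ} {D : Type*} [TopologicalSpace D] [ChartedSpace (Cn d) D]
  {E : D → Type*} [∀ x, AddCommGroup (E x)] [∀ x, Module ℂ (E x)]
  [TopologicalSpace (TotalSpace (Cn (k + 1)) E)] [∀ x, TopologicalSpace (E x)]
  [FiberBundle (Cn (k + 1)) E] [VectorBundle ℂ (Cn (k + 1)) E]
  [IsManifold (baseModel d) ω D] [ContMDiffVectorBundle ω (Cn (k + 1)) E (baseModel d)]
  {ωD : Form (Cn d) D 2} (h : HermitianMetric d k E)

lemma isSmoothFamily_solForm (hωD : IsKahler (baseModel d) ωD) {S : Set ℝ} {F : ℝ → ℝ → ℝ}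
    (hF : ∀ μ ∈ S, ∀ s, 0 ≤ s → ContDiffAt ℝ ∞ (Function.uncurry F) (μ, s)) :
    IsSmoothFamily (totalModel d k) S (fun μ => solForm ωD h (F μ)) := by
  have hF1 : ∀ μ ∈ S, ∀ s, 0 ≤ s → ContDiffAt ℝ ∞ (F μ) s := fun μ hμ s hs =>
    ContDiffAt.comp (g := Function.uncurry F) (f := fun s => (μ, s)) s (hF μ hμ s hs)
      (contDiffAt_const.prodMk contDiffAt_id)
  intro c
  have hH := h.isFibreMetric c.proj
  refine ContDiffOn.congr (f := fun q : ℝ × (Cn d × Cn (k + 1)) =>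
    totalForm (inChart (baseModel d) ωD c.proj) (F q.1) (h.localNormSq c.proj) q.2) ?_ ?_
  · rintro ⟨μ, p⟩ ⟨hμ, hp⟩
    have hp' : p.1 ∈ bundleDomain d k E c.proj := (mem_extChartAt_total_target c p).1 hp
    have hA : ContDiffAt ℝ ∞ (inChart (baseModel d) ωD c.proj) p.1 := by
      refine contDiffAt_inChart hωD.smooth c.proj ?_
      rw [extChartAt_target, modelWithCornersSelf_coe_symm, preimage_id,
        (baseModel d).range_eq_univ, inter_univ]
      exact hp'.1
    have h1 := ContDiffAt.comp (f := (Prod.snd : ℝ × (Cn d × Cn (k + 1)) → Cn d × Cn (k + 1)))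
      (μ, p) (contDiffAt_form_comp_fst (E' := Cn (k + 1)) hA) contDiffAt_snd
    have h2 : ContDiffAt ℝ ∞ (Function.uncurry fun (μ : ℝ) (p : Cn d × Cn (k + 1)) =>
        F μ (h.localNormSq c.proj p)) (μ, p) :=
      ContDiffAt.comp (g := Function.uncurry F)
        (f := fun q : ℝ × (Cn d × Cn (k + 1)) => (q.1, h.localNormSq c.proj q.2)) (μ, p)
        (hF μ hμ _ (hH.nonneg hp' p.2))
        (contDiffAt_fst.prodMk (ContDiffAt.comp (g := h.localNormSq c.proj) (μ, p)
          (hH.smooth p hp') contDiffAt_snd))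
    exact (h1.add (contDiffAt_ddbarV_param h2)).contDiffWithinAt
  · rintro ⟨μ, p⟩ ⟨hμ, hp⟩
    exact inChart_solForm h (hF1 μ hμ) c ((mem_extChartAt_total_target c p).1 hp)

variable (hωD : IsKahler (baseModel d) ωD)
  (hneg : ∀ y v, tautCurvature h y ![v, Complex.I • v] ≤ 0)
include hωD hneg

/-- The Calabi ansatz determines the profile. -/
lemma profile_eq_of_solForm_eq [Nonempty D] {F T D₁ F' T' D₁' : ℝ → ℝ} (hF : IsProfile F T D₁)
    (hF' : IsProfile F' T' D₁') (heq : solForm ωD h F = solForm ωD h F') {s : ℝ} (hs : 0 < s) :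
    D₁ s = D₁' s := by
  obtain ⟨x₀⟩ := ‹Nonempty D›
  let c : TotalSpace (Cn (k + 1)) E := ⟨x₀, 0⟩
  have hK := isKahlerData h hωD hneg x₀
  set z := chartAt (Cn d) x₀ x₀
  have hz : z ∈ bundleDomain d k E x₀ := chartAt_mem_bundleDomain x₀
  have hw₁ : homog (0 : Fin (k + 1)) 0 ≠ 0 := homog_ne_zero _ _
  have hpos := hK.pos z hz _ hw₁
  set a := h.localNormSq x₀ (z, homog (0 : Fin (k + 1)) 0)
  -- Scaled so that the norm squared takes the prescribed value `s`.
  let w : Cn (k + 1) := Real.sqrt (s / a) • homog (0 : Fin (k + 1)) 0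
  have hHw : h.localNormSq x₀ (z, w) = s := by
    rw [hK.real_smul hz, Real.sq_sqrt (by positivity)]
    exact div_mul_cancel₀ s hpos.ne'
  have hw0 : w ≠ 0 := smul_ne_zero (Real.sqrt_pos.2 (by positivity)).ne' hw₁
  have h1 := inChart_solForm (ωD := ωD) h hF.smoothF c (p := (z, w)) hz
  have h2 := inChart_solForm (ωD := ωD) h hF'.smoothF c (p := (z, w)) hz
  have h3 : totalForm (inChart (baseModel d) ωD x₀) F (h.localNormSq x₀) (z, w) =
      totalForm (inChart (baseModel d) ωD x₀) F' (h.localNormSq x₀) (z, w) := by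
    rw [← h1, ← h2, heq]
  have h4 := hK.totalForm_euler hF (p := (z, w)) hz hw0
  rw [h3, hK.totalForm_euler hF' (p := (z, w)) hz hw0, hHw] at h4
  have := mul_left_cancel₀ two_ne_zero h4
  exact (mul_left_cancel₀ hs.ne' this).symm

/-- The soliton equation. -/
lemma isSteadySoliton_solForm {F T D₁ : ℝ → ℝ} (hF : IsProfile F T D₁) {β : Multiset ℂ}
    (heig : ∀ y : ProjBundle d k E, relEigenvalues (projMetric ωD h y) (tautCurvature h y) = β)
    (hRic : ricciForm (projModel d k) (projMetric ωD h) = - ((k + 1 : ℕ) : ℝ) • tautCurvature h)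
    {μ : ℝ} {Q : ℝ → ℝ}
    (hβQ : ∀ x : ℝ, (β.map fun b => 1 + ((1 - x : ℝ) : ℂ) * b).prod = (Q x : ℝ))
    (hQ : ∀ s, 0 ≤ s → Q (s * T s) * (s * D₁ s) =
      (k + 1) * s ^ (k + 1) * Real.exp (μ * (s * T s))) :
    IsSteadySoliton (totalModel d k) (solForm ωD h F) ((μ / 2) • eulerField d k E) where
  kahler := isKahler_solForm h hωD hneg hF
  holomorphic := isHolomorphicField_euler _
  soliton := by
    funext c
    rw [ricciForm_solForm h hωD hneg hF heig hRic hβQ hQ, Pi.neg_apply, lieD_solForm h hωD hF]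

end Family

/-! ### The Riemannian distance and a completeness criterion. -/

section Lipschitz

set_option linter.unusedSectionVars false

open MeasureTheory

variable {V : Type*} [NormedAddCommGroup V] [NormedSpace ℂ V]
  {H : Type*} [TopologicalSpace H] {I : ModelWithCorners ℂ V H} [I.Boundaryless]
  {N : Type*} [TopologicalSpace N] [ChartedSpace H N] [IsManifold I ω N]

lemma SmoothInCharts.mfderiv_eq {u : N → ℝ} (hu : SmoothInCharts I u) (x : N) (v : V) :
    mfderiv (realModel I) 𝓘(ℝ, ℝ) u x v =
      fderiv ℝ (u ∘ (extChartAt I x).symm) (extChartAt I x x) v := by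
  have hr : range (realModel I) = univ := I.range_eq_univ
  rw [(hu.contMDiff.mdifferentiable (by simp) x).mfderiv, hr, fderivWithin_univ]
  rfl

/-- A function whose differential is bounded by a multiple of the Riemannian norm is Lipschitz for
the Riemannian distance. -/
lemma abs_sub_le_of_kahlerDist_lt {η : Form V N 2} {u : N → ℝ} (hu : SmoothInCharts I u) {L : ℝ}
    (hL : 0 ≤ L) (hb : ∀ x (v : V), |fderiv ℝ (u ∘ (extChartAt I x).symm) (extChartAt I x x) v| ≤
      L * √(η x ![v, Complex.I • v])) {x y : N} {r : ℝ}
    (hr : kahlerDist I η x y < ENNReal.ofReal r) : |u y - u x| ≤ L * r := by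
  let _ : ∀ x : N, ENorm (TangentSpace (realModel I) x) := kahlerNorm I η
  obtain ⟨γ, hx, hy, hγ, hlen⟩ := Manifold.exists_lt_of_riemannianEDist_lt
    (I := realModel I) (x := x) (y := y) hr
  have hu1 : ContMDiff (realModel I) 𝓘(ℝ, ℝ) 1 u := hu.contMDiff.of_le (by simp)
  have hg : ContDiffOn ℝ 1 (u ∘ γ) (Icc 0 1) := by
    rw [← contMDiffOn_iff_contDiffOn]
    exact hu1.comp_contMDiffOn hγ
  have h1 : ‖(u ∘ γ) 1 - (u ∘ γ) 0‖ₑ ≤ ENNReal.ofReal L * ENNReal.ofReal r := by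
    calc ‖(u ∘ γ) 1 - (u ∘ γ) 0‖ₑ
        ≤ ∫⁻ t in Icc (0 : ℝ) 1, ‖derivWithin (u ∘ γ) (Icc 0 1) t‖ₑ :=
          enorm_sub_le_lintegral_derivWithin_Icc_of_contDiffOn_Icc hg zero_le_one
      _ ≤ ∫⁻ t in Icc (0 : ℝ) 1, ENNReal.ofReal L *
            ‖mfderivWithin 𝓘(ℝ, ℝ) (realModel I) γ (Icc 0 1) t 1‖ₑ := by
          refine setLIntegral_mono' measurableSet_Icc fun t ht => ?_
          have h2 : mfderivWithin 𝓘(ℝ, ℝ) 𝓘(ℝ, ℝ) (u ∘ γ) (Icc 0 1) t =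
              (mfderiv (realModel I) 𝓘(ℝ, ℝ) u (γ t)) ∘L
                (mfderivWithin 𝓘(ℝ, ℝ) (realModel I) γ (Icc 0 1) t) := by
            refine mfderiv_comp_mfderivWithin _ (hu1.mdifferentiable one_ne_zero _)
              (hγ.mdifferentiableOn one_ne_zero t ht) ?_
            rw [uniqueMDiffWithinAt_iff_uniqueDiffWithinAt]
            exact uniqueDiffOn_Icc zero_lt_one _ ht
          have h3 : derivWithin (u ∘ γ) (Icc 0 1) t =
              mfderiv (realModel I) 𝓘(ℝ, ℝ) u (γ t)
                (mfderivWithin 𝓘(ℝ, ℝ) (realModel I) γ (Icc 0 1) t 1) := by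
            rw [← fderivWithin_derivWithin, ← mfderivWithin_eq_fderivWithin]
            exact congr($h2 1)
          have h4 := hb (γ t) (mfderivWithin 𝓘(ℝ, ℝ) (realModel I) γ (Icc 0 1) t 1)
          have h5 := hu.mfderiv_eq (γ t) (mfderivWithin 𝓘(ℝ, ℝ) (realModel I) γ (Icc 0 1) t 1)
          replace h4 := (congrArg abs (h3.trans h5)).trans_le h4
          rw [Real.enorm_eq_ofReal_abs]
          refine (ENNReal.ofReal_le_ofReal h4).trans ?_
          rw [ENNReal.ofReal_mul hL]
          rfl
      _ = ENNReal.ofReal L * Manifold.pathELength (realModel I) γ 0 1 := by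
          rw [lintegral_const_mul' _ _ ENNReal.ofReal_ne_top,
            Manifold.pathELength_eq_lintegral_mfderivWithin_Icc]
      _ ≤ ENNReal.ofReal L * ENNReal.ofReal r := by gcongr
  have hr0 : 0 ≤ r := by
    by_contra! h0
    rw [ENNReal.ofReal_of_nonpos h0.le] at hr
    exact not_lt_bot hr
  rw [Function.comp_apply, Function.comp_apply, hx, hy, Real.enorm_eq_ofReal_abs,
    ← ENNReal.ofReal_mul hL] at h1
  exact (ENNReal.ofReal_le_ofReal_iff (mul_nonneg hL hr0)).1 h1

/-- Holomorphic transition maps are real smooth; this provides smooth bump functions. -/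
lemma isManifold_realModel : IsManifold (realModel I) ∞ N := by
  have hr : range (realModel I) = univ := I.range_eq_univ
  refine isManifold_of_contDiffOn _ _ _ fun e e' he he' => ?_
  have h := (contDiffGroupoid ω I).compatible he he'
  rw [contDiffGroupoid, mem_groupoid_of_pregroupoid] at h
  exact (h.1.restrict_scalars ℝ).of_le le_top

/-- On a compact set, a continuous family of positive hermitian forms is bounded below. -/
lemma exists_form_lower_bound [FiniteDimensional ℝ V] {A : V → V [⋀^Fin 2]→L[ℝ] ℝ} {K : Set V}
    (hK : IsCompact K) (hA : ContinuousOn A K)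
    (hpos : ∀ z ∈ K, ∀ v : V, v ≠ 0 → 0 < A z ![v, Complex.I • v]) :
    ∃ c > 0, ∀ z ∈ K, ∀ v : V, c * ‖v‖ ^ 2 ≤ A z ![v, Complex.I • v] := by
  have hcont : ContinuousOn (fun q : V × V => A q.1 ![q.2, Complex.I • q.2])
      (K ×ˢ Metric.sphere (0 : V) 1) := by
    have h1 : ContinuousOn (fun q : V × V => A q.1) (K ×ˢ Metric.sphere (0 : V) 1) :=
      hA.comp continuousOn_fst fun q hq => hq.1
    have h2 : Continuous (fun q : V × V => ![q.2, Complex.I • q.2]) := by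
      refine continuous_pi fun i => ?_
      fin_cases i
      · exact continuous_snd
      · exact continuous_snd.const_smul Complex.I
    have h3 : Continuous fun q : (V [⋀^Fin 2]→L[ℝ] ℝ) × (Fin 2 → V) => q.1 q.2 := by
      fun_prop
    exact h3.comp_continuousOn (h1.prodMk h2.continuousOn)
  obtain ⟨c, hc, hle⟩ : ∃ c > 0, ∀ q ∈ K ×ˢ Metric.sphere (0 : V) 1,
      c ≤ A q.1 ![q.2, Complex.I • q.2] := by
    refine (hK.prod (isCompact_sphere 0 1)).exists_forall_le' hcont fun q hq => hpos q.1 hq.1 _ ?_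
    rintro h0
    simpa [h0] using hq.2
  refine ⟨c, hc, fun z hz v => ?_⟩
  rcases eq_or_ne v 0 with rfl | hv
  · have : A z ![0, Complex.I • (0 : V)] = 0 := (A z).map_coord_zero 0 rfl
    rw [this]
    simp
  have hv' : ‖v‖ ≠ 0 := norm_ne_zero_iff.2 hv
  have h1 := hle (z, ‖v‖⁻¹ • v) ⟨hz, by simp [norm_smul, hv']⟩
  have h2 : A z ![‖v‖⁻¹ • v, Complex.I • ‖v‖⁻¹ • v] =
      ‖v‖⁻¹ * (‖v‖⁻¹ * A z ![v, Complex.I • v]) := by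
    have h3 : ![‖v‖⁻¹ • v, Complex.I • ‖v‖⁻¹ • v] =
        fun i => (fun _ : Fin 2 => ‖v‖⁻¹) i • (![v, Complex.I • v] : Fin 2 → V) i := by
      funext i
      fin_cases i
      · rfl
      · exact smul_comm _ _ _
    rw [h3, ContinuousAlternatingMap.map_smul_univ]
    simp only [Finset.prod_const, Finset.card_univ, Fintype.card_fin, smul_eq_mul]
    ring
  rw [h2] at h1
  have h4 : c * ‖v‖ ^ 2 ≤ ‖v‖⁻¹ * (‖v‖⁻¹ * A z ![v, Complex.I • v]) * ‖v‖ ^ 2 := by gcongr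
  refine h4.trans (le_of_eq ?_)
  field_simp

/-- Smooth bump functions on a manifold with a positive form are Lipschitz for the
Riemannian distance. -/
lemma exists_bump_bound [FiniteDimensional ℝ V] [T2Space N] {η : Form V N 2}
    (hη : IsSmoothForm I η) (hpos : ∀ x (v : V), v ≠ 0 → 0 < η x ![v, Complex.I • v])
    (x₀ : N) {s : Set N} (hs : s ∈ 𝓝 x₀) :
    ∃ u : N → ℝ, SmoothInCharts I u ∧ u =ᶠ[𝓝 x₀] 1 ∧ (∀ x, u x ≠ 0 → x ∈ s) ∧
      ∃ L, 0 ≤ L ∧ ∀ x (v : V), |fderiv ℝ (u ∘ (extChartAt I x).symm) (extChartAt I x x) v| ≤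
        L * √(η x ![v, Complex.I • v]) := by
  have : IsManifold (realModel I) ∞ N := isManifold_realModel
  obtain ⟨f, hfs, -⟩ := (SmoothBumpFunction.nhds_basis_support (I := realModel I) hs).mem_iff.1 hs
  have hsm : SmoothInCharts I f := smoothInCharts_of_contMDiff f.contMDiff
  have hsrc : tsupport f ⊆ (extChartAt I x₀).source := f.tsupport_subset_extChartAt_source
  set K := extChartAt I x₀ '' tsupport f with hKdef
  have hK : IsCompact K :=
    f.hasCompactSupport.isCompact.image_of_continuousOn ((continuousOn_extChartAt x₀).mono hsrc)
  have hKt : K ⊆ (extChartAt I x₀).target := by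
    rintro _ ⟨x, hx, rfl⟩
    exact (extChartAt I x₀).map_source (hsrc hx)
  obtain ⟨c, hc, hle⟩ := exists_form_lower_bound hK ((hη x₀).continuousOn.mono hKt)
    fun z hz v hv => inChart_pos hpos x₀ (hKt hz) hv
  set g := f ∘ (extChartAt I x₀).symm with hg
  have hdc : ContinuousOn (fun z => fderiv ℝ g z) K := fun z hz =>
    ((hsm x₀ z (hKt hz)).fderiv_right (m := 0) (by simp)).continuousAt.continuousWithinAt
  obtain ⟨C, hC⟩ := (hK.image_of_continuousOn hdc).isBounded.exists_norm_le
  have hC0 : 0 ≤ max C 0 := le_max_right _ _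
  -- On the compact support, `max C 0` bounds the differential in the chart and `c` bounds the
  -- metric from below; off the support the differential is zero.
  refine ⟨f, hsm, f.eventuallyEq_one, fun x hx => hfs (subset_tsupport _ hx) , max C 0 / √c,
    by positivity, fun x v => ?_⟩
  by_cases hx : x ∈ tsupport f
  · have hxs := hsrc hx
    set z := extChartAt I x₀ x with hz
    have hzK : z ∈ K := ⟨x, hx, rfl⟩
    have hsz : (extChartAt I x₀).symm z = x := (extChartAt I x₀).left_inv hxs
    set φ := extChartAt I x₀ ∘ (extChartAt I x).symm with hφ
    have hzt := mem_extChartAt_target (I := I) x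
    have hxx : (extChartAt I x).symm (extChartAt I x x) = x := extChartAt_to_inv x
    have hφd : ContDiffAt ℂ ω φ (extChartAt I x x) :=
      contDiffAt_transition I x x₀ hzt (by rwa [hxx])
    have hφz : φ (extChartAt I x x) = z := by simp only [hφ, Function.comp_apply, hxx, hz]
    have h1 : fderiv ℝ (f ∘ (extChartAt I x).symm) (extChartAt I x x) =
        (fderiv ℝ g z).comp (fderiv ℝ φ (extChartAt I x x)) := by
      rw [(comp_symm_eventuallyEq f x x₀ hzt (by rwa [hxx])).fderiv_eq, fderiv_comp, ← hφ, hφz]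
      · rw [← hφ, hφz]
        exact (hsm x₀ z (hKt hzK)).differentiableAt (by simp)
      · exact (hφd.differentiableAt (by simp)).restrictScalars ℝ
    set w := tangentCoordChange I x x₀ x v with hw
    have hφv : fderiv ℝ φ (extChartAt I x x) v = w := by
      rw [(hφd.differentiableAt (by simp)).fderiv_restrictScalars ℝ, hw, hφ,
        ← tangentCoordChange_eq_fderiv I x x₀ hzt, hxx]
      rfl
    have h2 : inChart I η x₀ z ![w, Complex.I • w] = η x ![v, Complex.I • v] := by
      rw [inChart, hsz, form2_comp_apply]
      simp only [ContinuousLinearMap.coe_restrictScalars', map_smul]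
      rw [hw, tangentCoordChange_comp ⟨⟨mem_extChartAt_source x, hxs⟩, mem_extChartAt_source x⟩,
        tangentCoordChange_self (mem_extChartAt_source x)]
    have h3 := hle z hzK w
    rw [h2] at h3
    have h4 : √c * ‖w‖ ≤ √(η x ![v, Complex.I • v]) := by
      refine Real.le_sqrt_of_sq_le ?_
      rwa [mul_pow, Real.sq_sqrt hc.le]
    rw [h1, ContinuousLinearMap.comp_apply, hφv, ← Real.norm_eq_abs]
    have hc' : 0 < √c := Real.sqrt_pos.2 hc
    calc ‖fderiv ℝ g z w‖ ≤ ‖fderiv ℝ g z‖ * ‖w‖ := ContinuousLinearMap.le_opNorm _ _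
      _ ≤ max C 0 * ‖w‖ := by
          gcongr
          exact (hC _ ⟨z, hzK, rfl⟩).trans (le_max_left _ _)
      _ = max C 0 / √c * (√c * ‖w‖) := by field_simp
      _ ≤ _ := by gcongr
  · have h0 : f ∘ (extChartAt I x).symm =ᶠ[𝓝 (extChartAt I x x)] fun _ => 0 := by
      have h1 : ∀ᶠ y in 𝓝 ((extChartAt I x).symm (extChartAt I x x)), f y = 0 := by
        rw [extChartAt_to_inv]
        exact notMem_tsupport_iff_eventuallyEq.1 hx
      exact (continuousAt_extChartAt_symm x).eventually h1
    rw [h0.fderiv_eq]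
    simp
    positivity

/-- A Cauchy sequence which stays in a compact set converges. -/
lemma exists_tendsto_of_mem_compact [FiniteDimensional ℝ V] [T2Space N] {η : Form V N 2}
    (hη : IsSmoothForm I η) (hpos : ∀ x (v : V), v ≠ 0 → 0 < η x ![v, Complex.I • v])
    {S : Set N} (hS : IsCompact S) {u : ℕ → N} (hu : ∀ n, u n ∈ S)
    (hc : ∀ ε : ENNReal, 0 < ε → ∃ K, ∀ i ≥ K, ∀ j ≥ K, kahlerDist I η (u i) (u j) < ε) :
    ∃ x, Tendsto u atTop (𝓝 x) := by
  obtain ⟨x, -, hx⟩ := hS.exists_mapClusterPt (f := atTop) (u := u)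
    (tendsto_principal.2 (Eventually.of_forall hu))
  refine ⟨x, fun s hs => ?_⟩
  obtain ⟨f, hf, hf1, hfs, L, hL, hfL⟩ := exists_bump_bound hη hpos x hs
  -- Terms this close change `f` by less than `1`. Since `f = 1` at infinitely many terms, `f`
  -- cannot vanish at any late term, and these all lie in `s`.
  obtain ⟨K, hK⟩ := hc (ENNReal.ofReal (1 / (2 * (L + 1)))) (by simp; positivity)
  have hfreq : ∃ᶠ n in atTop, f (u n) = 1 := mapClusterPt_iff_frequently.1 hx _ hf1
  obtain ⟨j, hj', hj1⟩ := (hfreq.and_eventually (eventually_ge_atTop K)).exists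
  change ∀ᶠ n in atTop, u n ∈ s
  filter_upwards [eventually_ge_atTop K] with i hi
  refine hfs _ fun h0 => ?_
  have h1 := abs_sub_le_of_kahlerDist_lt hf hL hfL (hK i hi j hj1)
  rw [hj', h0, sub_zero, abs_one] at h1
  have h2 : L * (1 / (2 * (L + 1))) < 1 := by
    rw [mul_one_div, div_lt_one (by positivity)]
    linarith
  linarith

/-- Completeness criterion: a proper function which is Lipschitz for the Riemannian distance. -/
lemma isCompleteMetric_of_proper [FiniteDimensional ℝ V] [T2Space N] {η : Form V N 2}
    (hη : IsSmoothForm I η) (hpos : ∀ x (v : V), v ≠ 0 → 0 < η x ![v, Complex.I • v])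
    {τ : N → ℝ} (hτ : SmoothInCharts I τ) {L : ℝ} (hL : 0 ≤ L)
    (hb : ∀ x (v : V), |fderiv ℝ (τ ∘ (extChartAt I x).symm) (extChartAt I x x) v| ≤
      L * √(η x ![v, Complex.I • v]))
    (hproper : ∀ C, ∃ S, IsCompact S ∧ ∀ x, τ x ≤ C → x ∈ S) : IsCompleteMetric I η := by
  intro u hu
  obtain ⟨K, hK⟩ := hu (ENNReal.ofReal 1) (by simp)
  -- From index `K` on, the distance to `u K` is below `1`, so the Lipschitz function exceeds its
  -- value at `u K` by at most `L`.
  obtain ⟨S, hS, hS'⟩ := hproper (τ (u K) + L * 1)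
  have hmem : ∀ n, u (n + K) ∈ S := fun n => by
    refine hS' _ ?_
    have := (abs_le.1 (abs_sub_le_of_kahlerDist_lt hτ hL hb (hK K le_rfl (n + K) (by lia)))).2
    linarith
  obtain ⟨x, hx⟩ := exists_tendsto_of_mem_compact hη hpos hS hmem fun ε hε => by
    obtain ⟨M, hM⟩ := hu ε hε
    exact ⟨M, fun i hi j hj => hM _ (by lia) _ (by lia)⟩
  exact ⟨x, (tendsto_add_atTop_iff_nat K).1 hx⟩

end Lipschitz

/-! ### Compact sublevel sets and completeness. -/

section Completeness

set_option synthInstance.maxHeartbeats 200000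
set_option linter.unusedSectionVars false

open ProjBundle

/-- Minimum over the compact product of `K` with the unit sphere, extended by homogeneity. -/
lemma IsFibreMetric.exists_lower_bound {d k : ℕ} {U : Set (Cn d)} {H : Cn d × Cn (k + 1) → ℝ}
    (hH : IsFibreMetric U H) {K : Set (Cn d)} (hK : IsCompact K) (hKU : K ⊆ U) :
    ∃ c > 0, ∀ z ∈ K, ∀ w, c * ‖w‖ ^ 2 ≤ H (z, w) := by
  obtain ⟨c, hc, hle⟩ : ∃ c > 0, ∀ q ∈ K ×ˢ Metric.sphere (0 : Cn (k + 1)) 1, c ≤ H q := by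
    refine (hK.prod (isCompact_sphere 0 1)).exists_forall_le'
      (fun q hq => (hH.smooth q (hKU hq.1)).continuousAt.continuousWithinAt)
      fun q hq => hH.pos q.1 (hKU hq.1) _ ?_
    rintro h0
    simpa [h0] using hq.2
  refine ⟨c, hc, fun z hz w => ?_⟩
  rcases eq_or_ne w 0 with rfl | hw
  · simp [hH.zero (hKU hz)]
  have hw' : ‖w‖ ≠ 0 := norm_ne_zero_iff.2 hw
  have h1 := hle (z, ‖w‖⁻¹ • w) ⟨hz, by simp [norm_smul, hw']⟩
  rw [hH.real_smul (hKU hz)] at h1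
  have h2 : c * ‖w‖ ^ 2 ≤ ‖w‖⁻¹ ^ 2 * H (z, w) * ‖w‖ ^ 2 := by gcongr
  refine h2.trans (le_of_eq ?_)
  field_simp

/-- The total space of a fibre bundle with Hausdorff base and fibre is Hausdorff. -/
lemma t2Space_totalSpace {B : Type*} [TopologicalSpace B] [T2Space B] (F : Type*)
    [TopologicalSpace F] [T2Space F] (E : B → Type*) [∀ x, TopologicalSpace (E x)]
    [TopologicalSpace (TotalSpace F E)] [FiberBundle F E] : T2Space (TotalSpace F E) := by
  refine ⟨fun v w hvw => ?_⟩
  by_cases hp : v.proj = w.proj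
  · set e := trivializationAt F E v.proj
    have hv : v ∈ e.source := e.mem_source.2 (mem_baseSet_trivializationAt _ _ _)
    have hw : w ∈ e.source := e.mem_source.2 (hp ▸ mem_baseSet_trivializationAt _ _ _)
    have hne : e v ≠ e w := fun h => hvw (e.injOn hv hw h)
    obtain ⟨s, t, hs, ht, hvs, hwt, hst⟩ := t2_separation hne
    obtain ⟨s', hs's, hs'o, hvs'⟩ := mem_nhds_iff.1
      ((e.continuousAt hv).preimage_mem_nhds (hs.mem_nhds hvs))
    obtain ⟨t', ht't, ht'o, hwt'⟩ := mem_nhds_iff.1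
      ((e.continuousAt hw).preimage_mem_nhds (ht.mem_nhds hwt))
    exact ⟨s', t', hs'o, ht'o, hvs', hwt', (hst.preimage e).mono hs's ht't⟩
  · obtain ⟨s, t, hs, ht, hvs, hwt, hst⟩ := t2_separation hp
    have hc := FiberBundle.continuous_proj F E
    exact ⟨_, _, hs.preimage hc, ht.preimage hc, hvs, hwt, hst.preimage _⟩

variable {d k : ℕ} {D : Type*} [TopologicalSpace D] [ChartedSpace (Cn d) D]
  {E : D → Type*} [∀ x, AddCommGroup (E x)] [∀ x, Module ℂ (E x)]
  [TopologicalSpace (TotalSpace (Cn (k + 1)) E)] [∀ x, TopologicalSpace (E x)]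
  [FiberBundle (Cn (k + 1)) E] [VectorBundle ℂ (Cn (k + 1)) E]
  [IsManifold (baseModel d) ω D] [ContMDiffVectorBundle ω (Cn (k + 1)) E (baseModel d)]
  {ωD : Form (Cn d) D 2} (h : HermitianMetric d k E)

/-- Given an ultrafilter on the set, the base points converge by compactness of `D`. In a
trivialisation near the limit `H ≥ c‖w‖²`, which confines the fibre coordinates to a closed ball,
and the limit is found there. -/
lemma HermitianMetric.isCompact_normSq_le [CompactSpace D] (B : ℝ) :
    IsCompact {v : TotalSpace (Cn (k + 1)) E | h.normSq v ≤ B} := by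
  have hclosed : IsClosed {v : TotalSpace (Cn (k + 1)) E | h.normSq v ≤ B} :=
    isClosed_le (continuous_iff_continuousAt.2 h.smoothInCharts.continuousAt) continuous_const
  rw [isCompact_iff_ultrafilter_le_nhds]
  intro f hf
  obtain ⟨x₀, -, hx₀⟩ := isCompact_iff_ultrafilter_le_nhds.1 (isCompact_univ (X := D))
    (f.map TotalSpace.proj) (by simp)
  have hx₀ : Tendsto (TotalSpace.proj : TotalSpace (Cn (k + 1)) E → D) f (𝓝 x₀) := hx₀
  set z₀ := chartAt (Cn d) x₀ x₀
  have hz₀ : z₀ ∈ bundleDomain d k E x₀ := chartAt_mem_bundleDomain x₀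
  obtain ⟨r, hr, hrU⟩ := Metric.nhds_basis_closedBall.mem_iff.1
    ((isOpen_bundleDomain x₀).mem_nhds hz₀)
  obtain ⟨c, hc, hle⟩ := (h.isFibreMetric x₀).exists_lower_bound
    (isCompact_closedBall z₀ r) hrU
  let c₀ : TotalSpace (Cn (k + 1)) E := ⟨x₀, 0⟩
  set e := extChartAt (totalModel d k) c₀
  have hev : ∀ᶠ v in (f : Filter (TotalSpace (Cn (k + 1)) E)), v ∈ e.source ∧
      e v ∈ Metric.closedBall z₀ r ×ˢ Metric.closedBall (0 : Cn (k + 1)) √(B / c) := by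
    have h1 : ∀ᶠ x in 𝓝 x₀, x ∈ (chartAt (Cn d) x₀).source ∧
        x ∈ (trivializationAt (Cn (k + 1)) E x₀).baseSet ∧
        chartAt (Cn d) x₀ x ∈ Metric.closedBall z₀ r :=
      ((chartAt (Cn d) x₀).open_source.eventually_mem (mem_chart_source _ _)).and
        (((trivializationAt (Cn (k + 1)) E x₀).open_baseSet.eventually_mem
          (mem_baseSet_trivializationAt _ _ _)).and
        (((chartAt (Cn d) x₀).continuousAt (mem_chart_source _ _)).eventually
          (Metric.closedBall_mem_nhds _ hr)))
    filter_upwards [hx₀.eventually h1, hf (mem_principal_self _)] with v hv hvB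
    have hvs : v ∈ e.source := (mem_extChartAt_total_source c₀ v).2 ⟨hv.1, hv.2.1⟩
    have hev := extChartAt_total_apply (d := d) c₀ v hv.2.1
    have hz : (e v).1 ∈ Metric.closedBall z₀ r := by rw [hev]; exact hv.2.2
    refine ⟨hvs, hz, ?_⟩
    have h2 := hle _ hz (e v).2
    have h3 : h.localNormSq x₀ (e v) = h.normSq v := by
      rw [HermitianMetric.localNormSq, ← extChartAt_total_symm c₀ (hrU hz)]
      exact congrArg h.normSq (e.left_inv hvs)
    rw [Prod.mk.eta, h3] at h2
    rw [mem_closedBall_zero_iff]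
    refine Real.le_sqrt_of_sq_le ?_
    rw [le_div_iff₀ hc, mul_comm]
    exact h2.trans hvB
  obtain ⟨p, hp, hfp⟩ := isCompact_iff_ultrafilter_le_nhds.1
    ((isCompact_closedBall z₀ r).prod (isCompact_closedBall (0 : Cn (k + 1)) √(B / c)))
    (f.map e) (le_principal_iff.2 (hev.mono fun v hv => hv.2))
  have hpt : p ∈ e.target := (mem_extChartAt_total_target c₀ p).2 (hrU hp.1)
  have hlim : (f : Filter (TotalSpace (Cn (k + 1)) E)) ≤ 𝓝 (e.symm p) := by
    have h1 : Tendsto (e.symm ∘ e) f (𝓝 (e.symm p)) :=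
      (continuousAt_extChartAt_symm'' hpt).tendsto.comp hfp
    have h2 : Tendsto id (f : Filter (TotalSpace (Cn (k + 1)) E)) (𝓝 (e.symm p)) :=
      h1.congr' (hev.mono fun v hv => e.left_inv hv.1)
    exact h2
  exact ⟨e.symm p, isClosed_iff_ultrafilter.1 hclosed _ f hlim (le_principal_iff.1 hf), hlim⟩

/-- Completeness of the Calabi ansatz metrics. -/
lemma isCompleteMetric_solForm [CompactSpace D] [T2Space D] (hωD : IsKahler (baseModel d) ωD)
    (hneg : ∀ y v, tautCurvature h y ![v, Complex.I • v] ≤ 0) {F T D₁ : ℝ → ℝ}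
    (hF : IsProfile F T D₁) {K : ℝ} (hD : ∀ s, 0 ≤ s → s * D₁ s ≤ K)
    (hproper : ∀ C, ∃ B, ∀ s, 0 ≤ s → s * T s ≤ C → s ≤ B) :
    IsCompleteMetric (totalModel d k) (solForm ωD h F) := by
  have : T2Space (TotalSpace (Cn (k + 1)) E) := t2Space_totalSpace _ _
  have : FiniteDimensional ℝ (Cn d × Cn (k + 1)) := inferInstance
  have hkahler := isKahler_solForm h hωD hneg hF
  refine isCompleteMetric_of_proper hkahler.smooth hkahler.positive
    (smoothInCharts_comp_normSq h (F := fun s => s * T s) fun s hs => hF.smooth_momentum hs)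
    -- The proper Lipschitz function is the momentum `τ`; its Lipschitz constant comes from `|dτ|² ≤
    -- 2K |·|²`.
    (L := √(2 * K)) (Real.sqrt_nonneg _) (fun c v => ?_) fun C => ?_
  · have hp := extChartAt_self_mem_bundleDomain (d := d) c
    have h1 := (isKahlerData h hωD hneg c.proj).sq_fderiv_momentum_le hF hD hp v
    rw [(h.comp_symm_eventuallyEq (fun s => s * T s) c hp).fderiv_eq,
      solForm_eq h hF.smoothF, ← Real.sqrt_mul (by simpa using hD 0 le_rfl)]
    exact Real.abs_le_sqrt h1
  · obtain ⟨B, hB⟩ := hproper C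
    refine ⟨_, h.isCompact_normSq_le B, fun v hv => hB _ ?_ hv⟩
    have h0 : v.proj ∈ (trivializationAt (Cn (k + 1)) E v.proj).baseSet :=
      mem_baseSet_trivializationAt _ _ _
    have hp := extChartAt_self_mem_bundleDomain (d := d) v
    have h1 := (h.isFibreMetric v.proj).nonneg hp (extChartAt (totalModel d k) v v).2
    rwa [Prod.mk.eta, HermitianMetric.localNormSq, ← extChartAt_total_symm v hp,
      extChartAt_to_inv] at h1

end Completeness

end KRS

end

/-! ### The theorem. -/

open KRS in
theorem theorem1p2 (d k : ℕ)
    -- `D` is a compact complex manifold of dimension `d`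
    (D : Type*) [TopologicalSpace D] [CompactSpace D] [T2Space D] [Nonempty D]
    [ChartedSpace (Cn d) D] [IsManifold (baseModel d) ω D]
    -- `E` is a holomorphic vector bundle of rank `m = k + 1` over `D`
    (E : D → Type*) [∀ x, AddCommGroup (E x)] [∀ x, Module ℂ (E x)]
    [TopologicalSpace (TotalSpace (Cn (k + 1)) E)] [∀ x, TopologicalSpace (E x)]
    [FiberBundle (Cn (k + 1)) E] [VectorBundle ℂ (Cn (k + 1)) E]
    [ContMDiffVectorBundle ω (Cn (k + 1)) E (baseModel d)]
    -- a Kähler form on `D` and a Hermitian metric on `E`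
    (ωD : Form (Cn d) D 2) (hωD : IsKahler (baseModel d) ωD) (h : HermitianMetric d k E)
    -- the curvature form `γ` of `O(-1)` and `ω_M = p^* ω_D - γ` on `M = P(E)`
    (γ ωM : Form (Cn d × Cn k) (ProjBundle d k E) 2) (hγ : γ = tautCurvature h)
    (hωM : ωM = pullback (projModel d k) (baseModel d) ProjBundle.proj ωD - γ)
    -- `γ` is negative semi-definite and has constant eigenvalues with respect to `ω_M`
    (hneg : ∀ y v, γ y ![v, Complex.I • v] ≤ 0)
    (heig : ∃ β : Multiset ℂ, ∀ y, relEigenvalues (ωM y) (γ y) = β)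
    -- `Ric(ω_M) = - m γ`
    (hRic : ricciForm (projModel d k) ωM = - ((k + 1 : ℕ) : ℝ) • γ) :
    -- there is a smooth family of pairwise distinct Kähler forms, indexed by `μ < 0`, such that
    ∃ Ω : ℝ → Form (Cn d × Cn (k + 1)) (TotalSpace (Cn (k + 1)) E) 2,
      IsSmoothFamily (totalModel d k) (Iio 0) Ω ∧ InjOn Ω (Iio 0) ∧
      ∀ μ < 0,
        -- `Ω μ` is a steady soliton with the vector field `μ Re (z ∂/∂z)`
        IsSteadySoliton (totalModel d k) (Ω μ) ((μ / 2) • eulerField d k E) ∧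
        -- which is complete and lies in the class of `π^* ω_D`
        IsCompleteMetric (totalModel d k) (Ω μ) ∧
        SameClass (totalModel d k) (Ω μ)
          (pullback (totalModel d k) (baseModel d) TotalSpace.proj ωD) := by
  subst hγ
  obtain rfl : ωM = projMetric ωD h := hωM
  obtain ⟨β, heig⟩ := heig
  obtain ⟨x₀⟩ := ‹Nonempty D›
  have : Nonempty D := ⟨x₀⟩
  -- Any line will do: the eigenvalues are constant, so the polynomial computed at one point serves
  -- everywhere.
  let y : ProjBundle d k E := ProjBundle.mk (x := x₀) (ProjBundle.ofCoord k E x₀ x₀ (ProjBundle.homog 0 0))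
    (ProjBundle.ofCoord_ne_zero _ _ (ProjBundle.homog_ne_zero 0 0))
  have hx₀ : chartAt (Cn d) x₀ x₀ ∈ bundleDomain d k E y.proj := chartAt_mem_bundleDomain x₀
  obtain ⟨R, hR, hβR⟩ := (isKahlerData h hωD hneg y.proj).exists_momentum_polynomial
    (chartIndex y) (q := (chartAt (Cn d) x₀ x₀, 0)) hx₀
    (fun s => det_projForm_eq h hωD hneg heig y hx₀ s)
  obtain ⟨F, T, D₁, hprofile⟩ := exists_momentum_profile k hR
  have hF : ∀ μ < 0, IsProfile (F μ) (T μ) (D₁ μ) := fun μ hμ =>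
    { smoothF := fun s hs => ContDiffAt.comp (g := Function.uncurry F) (f := fun s => (μ, s)) s
        ((hprofile μ hμ).1 s hs).1 (contDiffAt_const.prodMk contDiffAt_id)
      smoothT := fun s hs => ContDiffAt.comp (g := Function.uncurry T) (f := fun s => (μ, s)) s
        ((hprofile μ hμ).1 s hs).2.1 (contDiffAt_const.prodMk contDiffAt_id)
      derivF := fun s hs => ((hprofile μ hμ).1 s hs).2.2.1
      T_pos := fun s hs => ((hprofile μ hμ).1 s hs).2.2.2.1
      deriv_momentum := fun s hs => ((hprofile μ hμ).1 s hs).2.2.2.2.1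
      D_pos := fun s hs => ((hprofile μ hμ).1 s hs).2.2.2.2.2.1 }
  have hQ : ∀ μ < 0, ∀ s, 0 ≤ s → (s * T μ s) ^ k * R.eval (s * T μ s) * (s * D₁ μ s) =
      (k + 1) * s ^ (k + 1) * Real.exp (μ * (s * T μ s)) := fun μ hμ s hs =>
    ((hprofile μ hμ).1 s hs).2.2.2.2.2.2
  refine ⟨fun μ => solForm ωD h (F μ),
    isSmoothFamily_solForm h hωD fun μ hμ s hs => ((hprofile μ hμ).1 s hs).1, ?_, ?_⟩
  -- Equal forms have equal `D`, hence equal momenta at `s = 1`. The profile equation there gives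
  -- `e^{μT} = e^{μ'T}` with `T > 0`.
  · intro μ hμ μ' hμ' heq
    have hD := fun (s : ℝ) (hs : 0 < s) =>
      profile_eq_of_solForm_eq h hωD hneg (hF μ hμ) (hF μ' hμ') heq hs
    have hT : T μ 1 = T μ' 1 := (hF μ hμ).momentum_eq (hF μ' hμ') hD one_pos
    have h1 := hQ μ hμ 1 zero_le_one
    have h2 := hQ μ' hμ' 1 zero_le_one
    rw [hD 1 one_pos, hT, h2] at h1
    have h3 := Real.exp_injective (mul_left_cancel₀ (by positivity) h1)
    exact (mul_right_cancel₀ (by simpa using ((hF μ' hμ').T_pos 1 zero_le_one).ne') h3).symm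
  · intro μ hμ
    obtain ⟨-, ⟨K, hK⟩, hproper⟩ := hprofile μ hμ
    exact ⟨isSteadySoliton_solForm h hωD hneg (hF μ hμ) heig hRic hβR (hQ μ hμ),
      isCompleteMetric_solForm h hωD hneg (hF μ hμ) hK hproper,
      solForm_sameClass h (hF μ hμ).smoothF⟩
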